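/- Let $n\ge 3$ and $s\ge 0$. A conformal Killing tensor with $s$ indices on Euclidean space $\mathbb{R}^n$ is a smooth symmetric trace-free tensor field $V^{bc\cdots d}$ with $s$ indices such that the trace-free part of $\nabla^{(a}V^{bc\cdots d)}$ vanishes, i.e. $\nabla^{(a}V^{bc\cdots d)}=g^{(ab}\lambda^{c\cdots d)}$ for some $\lambda^{c\cdots d}$ (for $s=0$: $\nabla^aV=0$). Equip $\mathbb{R}^{n+2}$ with the quadratic form $\widetilde g_{AB}x^Ax^B=2x^0x^\infty+g_{ab}x^ax^b$, where $x^A=(x^0,x^a,x^\infty)$ and $g_{ab}$ is the Euclidean metric, let $\mathfrak{so}(n+1,1)$ be the Lie algebra of matrices $A^B{}_Q$ that are skew for $\widetilde g$, and lower ambient indices with $\widetilde g_{AB}$. For $x\in\mathbb{R}^n$ put $$\Phi^B=(1,\,x^b,\,-\tfrac12x^bx_b),\qquad \Psi^{bQ}=(0,\,g^{bq},\,-x^b).$$ Let $\mathcal{K}$ be the space of tensors $V^{BQCR\cdots DS}\in\bigotimes^{2s}\mathbb{R}^{n+2}$ that are skew in each of the $s$ pairs of indices $BQ$, $CR$, …,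 $DS$, are totally trace-free with respect to $\widetilde g$, and vanish when skewed over any three indices. Then: (1) The formula $$V^{bc\cdots d}=\Phi_B\Phi_C\cdots\Phi_D\,V^{BQCR\cdots DS}\,\Psi^b{}_Q\Psi^c{}_R\cdots\Psi^d{}_S$$ defines a linear isomorphism from $\mathcal{K}$ onto the space of conformal Killing tensors with $s$ indices on $\mathbb{R}^n$; in particular every conformal Killing tensor arises in this way. (2) This isomorphism intertwines the tensorial action of $A\in\mathfrak{so}(n+1,1)$ on $\mathcal{K}$ with the Lie derivative of tensor fields along the conformal Killing vector $\Phi_BA^B{}_Q\Psi^{bQ}$. (3) The space of conformal Killing tensors with $s$ indices is finite-dimensional, $\mathcal{K}$ is an irreducible $\mathfrak{so}(n+1,1)$-module, and $\mathcal{K}$ is the trace-free part of the representation given by the two-row rectangular Young tableau with $s$ boxes in each row, i.e. the space of trace-free tensors in the image of its Young symmetriser (symmetrise over each row, then skew over each column; the columns are the pairs $BQ$, $CR$, …, $DS$). Hence the conformal Killing tensors with $s$ indices on $\mathbb{R}^n$ form the finite-dimensional irreducible $\mathfrak{so}(n+1,1)$-module given by the trace-free two-row rectangular tableau with $s$ boxes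 in each row. -/

import Mathlib

open scoped ContDiff BigOperators

-- the commutator bracket on matrices
attribute [local instance] LieRing.ofAssociativeRing

namespace ConformalKilling

/-! ### Tensors in components -/

/-- Contravariant tensors over `ℝ^m`, written in components, with one index in `m` for every slot
in `ι`. -/
abbrev Tens (ι m : Type) : Type := (ι → m) → ℝ

/-- Permutation of the slots of a tensor. -/
def permute {ι m : Type} (σ : Equiv.Perm ι) : Tens ι m →ₗ[ℝ] Tens ι m where
  toFun T i := T (i ∘ σ)
  map_add' _ _ := rfl
  map_smul' _ _ := rfl

/-- The symmetric part `T^{(ab⋯c)}`. -/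
noncomputable def symmetrize {ι m : Type} [Fintype ι] [DecidableEq ι] :
    Tens ι m →ₗ[ℝ] Tens ι m :=
  ((Nat.factorial (Fintype.card ι) : ℝ)⁻¹) • ∑ σ : Equiv.Perm ι, permute σ

/-- Skewing over the slots in `S` (up to the usual factor `1 / |S|!`). -/
noncomputable def skewOver {ι m : Type} [Fintype ι] [DecidableEq ι] (S : Finset ι) :
    Tens ι m →ₗ[ℝ] Tens ι m :=
  ∑ σ : Equiv.Perm ι with (∀ p, p ∉ S → σ p = p),
    ((Equiv.Perm.sign σ : ℤ) : ℝ) • permute σ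

/-- The trace of a tensor over the slots `p`, `q` with respect to the (lower index) metric `g`.
The result is regarded as a function of all the indices that does not depend on those in the
slots `p` and `q`. -/
def contract {ι m : Type} [DecidableEq ι] [Fintype m] (g : Matrix m m ℝ) (p q : ι) :
    Tens ι m →ₗ[ℝ] Tens ι m where
  toFun T i := ∑ E, ∑ F, g E F * T (Function.update (Function.update i p E) q F)
  map_add' T U := by
    funext i
    simp only [Pi.add_apply, mul_add, Finset.sum_add_distrib]
  map_smul' c T := by
    funext i
    simp only [Pi.smul_apply, smul_eq_mul, RingHom.id_apply, Finset.mul_sum]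
    exact Finset.sum_congr rfl fun _ _ => Finset.sum_congr rfl fun _ _ => by ring

/-- Totally trace-free tensors. -/
def traceFree (ι : Type) {m : Type} [DecidableEq ι] [Fintype m] (g : Matrix m m ℝ) :
    Submodule ℝ (Tens ι m) :=
  ⨅ (p : ι) (q : ι) (_ : p ≠ q), LinearMap.ker (contract g p q)

/-- Symmetric tensors. -/
def symmetric (ι m : Type) : Submodule ℝ (Tens ι m) :=
  ⨅ σ : Equiv.Perm ι, LinearMap.eqLocus (permute σ) LinearMap.id

/-- A matrix `A^B_E` acting on the slot `p` of a tensor. -/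
def slotAct {ι m : Type} [DecidableEq ι] [Fintype m] (A : Matrix m m ℝ) (p : ι) :
    Tens ι m →ₗ[ℝ] Tens ι m where
  toFun T i := ∑ E, A (i p) E * T (Function.update i p E)
  map_add' T U := by
    funext i
    simp only [Pi.add_apply, mul_add, Finset.sum_add_distrib]
  map_smul' c T := by
    funext i
    simp only [Pi.smul_apply, smul_eq_mul, RingHom.id_apply, Finset.mul_sum]
    exact Finset.sum_congr rfl fun _ _ => by ring

/-- The action of a matrix on tensors as a derivation, i.e. the tensor power of the defining
representation of `𝔤𝔩(m)`. -/
def tensAct {ι m : Type} [Fintype ι] [DecidableEq ι] [Fintype m] (A : Matrix m m ℝ) :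
    Tens ι m →ₗ[ℝ] Tens ι m :=
  ∑ p, slotAct A p

/-! ### Conformal Killing tensors on `ℝⁿ` -/

/-- Tensor fields with `s` (upper) indices on Euclidean space `ℝⁿ`. -/
abbrev TensorField (n s : ℕ) : Type := EuclideanSpace ℝ (Fin n) → Tens (Fin s) (Fin n)

/-- The partial derivative `∂f/∂x^a`. -/
noncomputable def partialDeriv {n : ℕ} (a : Fin n) (f : EuclideanSpace ℝ (Fin n) → ℝ)
    (x : EuclideanSpace ℝ (Fin n)) : ℝ :=
  fderiv ℝ f x (EuclideanSpace.single a 1)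

/-- The gradient `∇^a V^{bc⋯d}`; the new index comes first, and is raised by the Euclidean metric
`g_{ab} = δ_{ab}`. -/
noncomputable def grad {n s : ℕ} (V : TensorField n s) : TensorField n (s + 1) :=
  fun x j => partialDeriv (j 0) (fun y => V y (Fin.tail j)) x

/-- `λ^{c⋯d} ↦ g^{ab} λ^{c⋯d}`. -/
def metricTensor {n k : ℕ} : Tens (Fin k) (Fin n) →ₗ[ℝ] Tens (Fin (k + 2)) (Fin n) where
  toFun l j := (1 : Matrix (Fin n) (Fin n) ℝ) (j 0) (j 1) * l (Fin.tail (Fin.tail j))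
  map_add' _ _ := by
    funext j
    simp only [Pi.add_apply, mul_add]
  map_smul' c l := by
    funext j
    simp only [Pi.smul_apply, smul_eq_mul, RingHom.id_apply]
    ring

/-- The tensors of the form `g^{(ab} λ^{c⋯d)}`. These are the symmetric tensors whose trace-free
part vanishes; in particular only `0` if there are fewer than two indices. -/
noncomputable def pureTrace (n : ℕ) : (k : ℕ) → Submodule ℝ (Tens (Fin k) (Fin n))
  | 0 => ⊥
  | 1 => ⊥
  | _ + 2 => LinearMap.range (symmetrize ∘ₗ metricTensor)

theorem partialDeriv_add {n s : ℕ} {V W : TensorField n s} (hV : ContDiff ℝ ∞ V)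
    (hW : ContDiff ℝ ∞ W) (a : Fin n) (i : Fin s → Fin n) (x : EuclideanSpace ℝ (Fin n)) :
    partialDeriv a (fun y => (V + W) y i) x =
      partialDeriv a (fun y => V y i) x + partialDeriv a (fun y => W y i) x := by
  have h1 : DifferentiableAt ℝ (fun y => V y i) x :=
    differentiableAt_pi.1 (hV.differentiable (by simp) x) i
  have h2 : DifferentiableAt ℝ (fun y => W y i) x :=
    differentiableAt_pi.1 (hW.differentiable (by simp) x) i
  have h : (fun y => (V + W) y i) = (fun y => V y i) + (fun y => W y i) := rfl
  rw [partialDeriv, h, fderiv_add h1 h2]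
  rfl

theorem partialDeriv_smul {n s : ℕ} {V : TensorField n s} (hV : ContDiff ℝ ∞ V) (c : ℝ)
    (a : Fin n) (i : Fin s → Fin n) (x : EuclideanSpace ℝ (Fin n)) :
    partialDeriv a (fun y => (c • V) y i) x = c * partialDeriv a (fun y => V y i) x := by
  have h1 : DifferentiableAt ℝ (fun y => V y i) x :=
    differentiableAt_pi.1 (hV.differentiable (by simp) x) i
  have h : (fun y => (c • V) y i) = c • (fun y => V y i) := rfl
  rw [partialDeriv, h, fderiv_const_smul h1]
  rfl

/-- The conformal Killing tensors with `s` indices on `ℝⁿ`: smooth symmetric trace-free tensor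
fields such that the trace-free part of `∇^{(a}V^{bc⋯d)}` vanishes, that is
`∇^{(a}V^{bc⋯d)} = g^{(ab}λ^{c⋯d)}` for some `λ^{c⋯d}`. -/
noncomputable def conformalKilling (n s : ℕ) : Submodule ℝ (TensorField n s) where
  carrier := {V | ContDiff ℝ ∞ V ∧
    (∀ x, V x ∈ symmetric (Fin s) (Fin n)) ∧
    (∀ x, V x ∈ traceFree (Fin s) (1 : Matrix (Fin n) (Fin n) ℝ)) ∧
    ∀ x, symmetrize (grad V x) ∈ pureTrace n (s + 1)}
  add_mem' := by
    rintro V W ⟨hV, hV1, hV2, hV3⟩ ⟨hW, hW1, hW2, hW3⟩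
    refine ⟨hV.add hW, fun x => add_mem (hV1 x) (hW1 x), fun x => add_mem (hV2 x) (hW2 x),
      fun x => ?_⟩
    have h : grad (V + W) x = grad V x + grad W x := by
      funext j
      exact partialDeriv_add hV hW _ _ x
    rw [h, map_add]
    exact add_mem (hV3 x) (hW3 x)
  zero_mem' := by
    refine ⟨contDiff_const, fun x => zero_mem _, fun x => zero_mem _, fun x => ?_⟩
    have h : grad (0 : TensorField n s) x = 0 := by
      funext j
      simp [grad, partialDeriv]
    rw [h, map_zero]
    exact zero_mem _
  smul_mem' := by
    rintro c V ⟨hV, hV1, hV2, hV3⟩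
    refine ⟨contDiff_const.smul hV, fun x => Submodule.smul_mem _ c (hV1 x),
      fun x => Submodule.smul_mem _ c (hV2 x), fun x => ?_⟩
    have h : grad (c • V) x = c • grad V x := by
      funext j
      exact partialDeriv_smul hV c _ _ x
    rw [h, map_smul]
    exact Submodule.smul_mem _ c (hV3 x)

/-- The Lie derivative of a contravariant tensor field along a vector field,
`(L_X V)^{b⋯d} = X^a ∂_a V^{b⋯d} - V^{a⋯d} ∂_a X^b - ⋯ - V^{b⋯a} ∂_a X^d`. -/
noncomputable def lieDerivative {n s : ℕ} (X : EuclideanSpace ℝ (Fin n) → Fin n → ℝ)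
    (V : TensorField n s) : TensorField n s :=
  fun x i => ∑ a, X x a * partialDeriv a (fun y => V y i) x -
    ∑ p, ∑ a, V x (Function.update i p a) * partialDeriv a (fun y => X y (i p)) x

/-! ### The ambient space `ℝ^{n+2}` -/

/-- The `n + 2` values `0, 1, …, n, ∞` of an ambient index. -/
abbrev AmbIndex (n : ℕ) : Type := Unit ⊕ Fin n ⊕ Unit

/-- The ambient metric `g̃_{AB} x^A x^B = 2 x^0 x^∞ + g_{ab} x^a x^b`, of signature
`(n + 1, 1)`. -/
def ambientMetric (n : ℕ) : Matrix (AmbIndex n) (AmbIndex n) ℝ :=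
  Matrix.of fun
    | .inl _, .inr (.inr _) => 1
    | .inr (.inr _), .inl _ => 1
    | .inr (.inl a), .inr (.inl b) => (1 : Matrix (Fin n) (Fin n) ℝ) a b
    | _, _ => 0

/-- The Lie algebra `𝔰𝔬(n+1,1)`, realised as the matrices `A^B_E` that are skew for the ambient
metric. -/
abbrev so (n : ℕ) : LieSubalgebra ℝ (Matrix (AmbIndex n) (AmbIndex n) ℝ) :=
  skewAdjointMatricesLieSubalgebra (ambientMetric n)

/-- Ambient tensors `V^{BQCR⋯DS} ∈ ⊗^{2s} ℝ^{n+2}`. The indices `BQ` of the `k`-th pair are in the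
slots `(k, 0)` and `(k, 1)`. -/
abbrev AmbTensor (n s : ℕ) : Type := Tens (Fin s × Fin 2) (AmbIndex n)

section LieModule

variable {ι m : Type} [DecidableEq ι] [Fintype m]

theorem slotAct_comm (A B : Matrix m m ℝ) {p q : ι} (h : p ≠ q) (T : Tens ι m) :
    slotAct A p (slotAct B q T) = slotAct B q (slotAct A p T) := by
  funext i
  simp only [slotAct, LinearMap.coe_mk, AddHom.coe_mk, Finset.mul_sum]
  rw [Finset.sum_comm]
  refine Finset.sum_congr rfl fun F _ => Finset.sum_congr rfl fun E _ => ?_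
  rw [Function.update_of_ne h.symm, Function.update_of_ne h, Function.update_comm h]
  ring

theorem slotAct_mul (A B : Matrix m m ℝ) (p : ι) (T : Tens ι m) :
    slotAct A p (slotAct B p T) = slotAct (A * B) p T := by
  funext i
  simp only [slotAct, LinearMap.coe_mk, AddHom.coe_mk, Finset.mul_sum, Function.update_self,
    Function.update_idem, Matrix.mul_apply, Finset.sum_mul]
  rw [Finset.sum_comm]
  exact Finset.sum_congr rfl fun F _ => Finset.sum_congr rfl fun E _ => by ring

theorem slotAct_add (A B : Matrix m m ℝ) (p : ι) (T : Tens ι m) :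
    slotAct (A + B) p T = slotAct A p T + slotAct B p T := by
  funext i
  simp only [slotAct, LinearMap.coe_mk, AddHom.coe_mk, Matrix.add_apply, add_mul,
    Finset.sum_add_distrib, Pi.add_apply]

theorem slotAct_smul (c : ℝ) (A : Matrix m m ℝ) (p : ι) (T : Tens ι m) :
    slotAct (c • A) p T = c • slotAct A p T := by
  funext i
  simp only [slotAct, LinearMap.coe_mk, AddHom.coe_mk, Matrix.smul_apply, smul_eq_mul, mul_assoc,
    Finset.mul_sum, Pi.smul_apply]

variable [Fintype ι]

theorem tensAct_apply (A : Matrix m m ℝ) (T : Tens ι m) :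
    tensAct A T = ∑ p, slotAct A p T := by
  simp [tensAct]

theorem tensAct_lie [DecidableEq m] (A B : Matrix m m ℝ) (T : Tens ι m) :
    tensAct A (tensAct B T) = tensAct ⁅A, B⁆ T + tensAct B (tensAct A T) := by
  have key : ∀ p q : ι, slotAct A p (slotAct B q T) =
      (if p = q then slotAct ⁅A, B⁆ p T else 0) + slotAct B q (slotAct A p T) := by
    intro p q
    by_cases h : p = q
    · subst h
      rw [if_pos rfl, slotAct_mul, slotAct_mul, ← slotAct_add, Ring.lie_def, sub_add_cancel]
    · rw [if_neg h, zero_add, slotAct_comm A B h]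
  simp only [tensAct_apply, map_sum]
  rw [Finset.sum_comm, Finset.sum_congr rfl fun p _ => Finset.sum_congr rfl fun q _ => key p q]
  simp only [Finset.sum_add_distrib, Finset.sum_ite_eq, Finset.mem_univ, if_true]

theorem tensAct_permute (A : Matrix m m ℝ) (σ : Equiv.Perm ι) (T : Tens ι m) :
    tensAct A (permute σ T) = permute σ (tensAct A T) := by
  funext i
  simp only [tensAct_apply, permute, slotAct, LinearMap.coe_mk, AddHom.coe_mk, Finset.sum_apply]
  rw [← Equiv.sum_comp σ]
  refine Finset.sum_congr rfl fun q _ => Finset.sum_congr rfl fun E _ => ?_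
  rw [Function.update_comp_equiv, Equiv.symm_apply_apply, Function.comp_apply]

theorem contract_tensAct [DecidableEq m] (g A : Matrix m m ℝ) (hA : g.IsSkewAdjoint A) {p q : ι}
    (h : p ≠ q) (T : Tens ι m) (hT : contract g p q T = 0) :
    contract g p q (tensAct A T) = 0 := by
  have hoff : ∀ r, r ≠ p → r ≠ q → contract g p q (slotAct A r T) = 0 := by
    intro r hp hq
    have : contract g p q (slotAct A r T) = slotAct A r (contract g p q T) := by
      funext i
      simp only [slotAct, contract, LinearMap.coe_mk, AddHom.coe_mk, Finset.mul_sum]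
      rw [Finset.sum_comm_cycle]
      refine Finset.sum_congr rfl fun G _ => Finset.sum_congr rfl fun E _ =>
        Finset.sum_congr rfl fun F _ => ?_
      rw [Function.update_of_ne hq, Function.update_of_ne hp, Function.update_comm hq.symm,
        Function.update_comm hp.symm]
      ring
    rw [this, hT, map_zero]
  have hpq : contract g p q (slotAct A p T) + contract g p q (slotAct A q T) = 0 := by
    have hp : contract g p q (slotAct A p T) = contract (A.transpose * g) p q T := by
      funext i
      simp only [slotAct, contract, LinearMap.coe_mk, AddHom.coe_mk, Finset.mul_sum,
        Matrix.mul_apply, Finset.sum_mul, Matrix.transpose_apply]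
      rw [Finset.sum_comm_cycle]
      refine Finset.sum_congr rfl fun G _ => ?_
      rw [Finset.sum_comm]
      refine Finset.sum_congr rfl fun F _ => Finset.sum_congr rfl fun E _ => ?_
      rw [Function.update_of_ne h, Function.update_self, Function.update_comm h.symm,
        Function.update_idem]
      ring
    have hq : contract g p q (slotAct A q T) = contract (g * A) p q T := by
      funext i
      simp only [slotAct, contract, LinearMap.coe_mk, AddHom.coe_mk, Finset.mul_sum,
        Matrix.mul_apply, Finset.sum_mul]
      refine Finset.sum_congr rfl fun E _ => ?_
      rw [Finset.sum_comm]
      refine Finset.sum_congr rfl fun G _ => Finset.sum_congr rfl fun F _ => ?_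
      rw [Function.update_self, Function.update_idem]
      ring
    have hs : A.transpose * g = -(g * A) := by
      rw [← mul_neg]
      exact hA
    rw [hp, hq, hs]
    funext i
    simp [contract]
  rw [tensAct_apply, map_sum, ← Finset.sum_subset (Finset.subset_univ {p, q}),
    Finset.sum_pair h, hpq]
  intro r _ hr
  simp only [Finset.mem_insert, Finset.mem_singleton, not_or] at hr
  exact hoff r hr.1 hr.2

end LieModule

/-- Matrices act on ambient tensors as derivations; the action of `𝔰𝔬(n+1,1)` is the
restriction. -/
instance (n s : ℕ) : LieRingModule (Matrix (AmbIndex n) (AmbIndex n) ℝ) (AmbTensor n s) where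
  bracket A T := tensAct A T
  add_lie A B T := by
    change tensAct (A + B) T = tensAct A T + tensAct B T
    simp only [tensAct_apply, slotAct_add, Finset.sum_add_distrib]
  lie_add A T U := (tensAct A).map_add T U
  leibniz_lie A B T := tensAct_lie A B T

instance (n s : ℕ) : LieModule ℝ (Matrix (AmbIndex n) (AmbIndex n) ℝ) (AmbTensor n s) where
  smul_lie c A T := by
    change tensAct (c • A) T = c • tensAct A T
    simp only [tensAct_apply, slotAct_smul, Finset.smul_sum]
  lie_smul c A T := (tensAct A).map_smul c T

/-- The ambient tensors `V^{BQCR⋯DS}` that are skew in each pair of indices `BQ`, `CR`, …, `DS`,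
are totally trace-free, and such that skewing over any three indices gives zero, as an
`𝔰𝔬(n+1,1)`-module. -/
noncomputable def ambientKilling (n s : ℕ) : LieSubmodule ℝ (so n) (AmbTensor n s) where
  carrier := {T |
    (∀ k : Fin s, permute (Equiv.swap (k, 0) (k, 1)) T = -T) ∧
    T ∈ traceFree (Fin s × Fin 2) (ambientMetric n) ∧
    ∀ S : Finset (Fin s × Fin 2), S.card = 3 → skewOver S T = 0}
  add_mem' := by
    rintro T U ⟨h1, h2, h3⟩ ⟨h1', h2', h3'⟩
    refine ⟨fun k => ?_, add_mem h2 h2', fun S hS => ?_⟩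
    · rw [map_add, h1, h1', neg_add]
    · rw [map_add, h3 S hS, h3' S hS, add_zero]
  zero_mem' := ⟨fun k => by rw [map_zero, neg_zero], zero_mem _, fun S _ => map_zero _⟩
  smul_mem' := by
    rintro c T ⟨h1, h2, h3⟩
    refine ⟨fun k => ?_, Submodule.smul_mem _ c h2, fun S hS => ?_⟩
    · rw [map_smul, h1, smul_neg]
    · rw [map_smul, h3 S hS, smul_zero]
  lie_mem := by
    rintro ⟨A, hA⟩ T ⟨h1, h2, h3⟩
    rw [mem_skewAdjointMatricesLieSubalgebra, mem_skewAdjointMatricesSubmodule] at hA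
    change (∀ k : Fin s, permute (Equiv.swap (k, 0) (k, 1)) (tensAct A T) = -(tensAct A T)) ∧
      tensAct A T ∈ traceFree (Fin s × Fin 2) (ambientMetric n) ∧
      ∀ S : Finset (Fin s × Fin 2), S.card = 3 → skewOver S (tensAct A T) = 0
    refine ⟨fun k => ?_, ?_, fun S hS => ?_⟩
    · rw [← tensAct_permute, h1, map_neg]
    · simp only [traceFree, Submodule.mem_iInf, LinearMap.mem_ker] at h2 ⊢
      exact fun p q hpq => contract_tensAct _ A hA hpq T (h2 p q hpq)
    · have h := congrArg (tensAct A) (h3 S hS)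
      rw [map_zero] at h
      rw [← h]
      simp only [skewOver, LinearMap.sum_apply, LinearMap.smul_apply, map_sum, map_smul,
        tensAct_permute]

/-- The Young symmetriser of the two-row rectangular tableau with `s` boxes in each row. The box in
row `r` and column `k` is the slot `(k, r)`. First symmetrise over each row, then skew over each
column. -/
noncomputable def youngSymmetrizer (s : ℕ) (m : Type) :
    Tens (Fin s × Fin 2) m →ₗ[ℝ] Tens (Fin s × Fin 2) m :=
  (∑ τ : Equiv.Perm (Fin s × Fin 2) with (∀ p, (τ p).1 = p.1),
      ((Equiv.Perm.sign τ : ℤ) : ℝ) • permute τ) ∘ₗ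
    ∑ σ : Equiv.Perm (Fin s × Fin 2) with (∀ p, (σ p).2 = p.2), permute σ

/-- The trace-free part of the representation of `GL(n+2, ℝ)` that belongs to the two-row
rectangular Young tableau with `s` boxes in each row: the trace-free tensors in the image of the
Young symmetriser. -/
noncomputable def traceFreeTableau (n s : ℕ) : Submodule ℝ (AmbTensor n s) :=
  LinearMap.range (youngSymmetrizer s (AmbIndex n)) ⊓
    traceFree (Fin s × Fin 2) (ambientMetric n)

/-! ### From ambient tensors to tensor fields on `ℝⁿ` -/

/-- Lowering an ambient index with the ambient metric. -/
def lower {n : ℕ} (v : AmbIndex n → ℝ) : AmbIndex n → ℝ :=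
  fun B => ∑ C, ambientMetric n B C * v C

/-- `Φ^B = (1, x^b, -x^b x_b / 2)`. -/
noncomputable def Phi {n : ℕ} (x : EuclideanSpace ℝ (Fin n)) : AmbIndex n → ℝ
  | .inl _ => 1
  | .inr (.inl b) => x b
  | .inr (.inr _) => -(∑ b, x b * x b) / 2

/-- `Ψ^{bQ} = (0, g^{bq}, -x^b)`. -/
def Psi {n : ℕ} (x : EuclideanSpace ℝ (Fin n)) (b : Fin n) : AmbIndex n → ℝ
  | .inl _ => 0
  | .inr (.inl q) => (1 : Matrix (Fin n) (Fin n) ℝ) b q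
  | .inr (.inr _) => -x b

/-- The tensor field
`V^{bc⋯d} = Φ_B Φ_C ⋯ Φ_D V^{BQCR⋯DS} Ψ^b_Q Ψ^c_R ⋯ Ψ^d_S`. -/
noncomputable def ambientToField {n s : ℕ} (T : AmbTensor n s) : TensorField n s :=
  fun x i => ∑ I : Fin s × Fin 2 → AmbIndex n,
    T I * ∏ k : Fin s, (lower (Phi x) (I (k, 0)) * lower (Psi x (i k)) (I (k, 1)))

/-- The conformal Killing vector `V^b = Φ_B A^B_Q Ψ^{bQ}` of an element `A^B_Q` of
`𝔰𝔬(n+1,1)`. -/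
noncomputable def killingVector {n : ℕ} (A : so n) : EuclideanSpace ℝ (Fin n) → Fin n → ℝ :=
  fun x b => ∑ B, ∑ Q, lower (Phi x) B * (A : Matrix (AmbIndex n) (AmbIndex n) ℝ) B Q * Psi x b Q

end ConformalKilling

open ConformalKilling

/-! Everything is translated into polynomials. An ambient tensor `T` becomes `toPoly T`, a
polynomial in two ambient covectors X and P, with X in the first and P in the second slot of every
pair. Tensors with the tableau symmetries correspond to the polynomials of bidegree (s, s)
annihilated by X·∂/∂P (`IsCurvatureLike.eq_zero_of_toPoly`, `exists_isCurvatureLike`), and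
trace-free tensors to those also annihilated by the operators `laplace`. On ℝⁿ a symmetric
trace-free tensor is a harmonic polynomial in p, hence determined modulo p², and the conformal
Killing equation says that p² divides p·∂V/∂x. The formula of the theorem is the substitution X =
Φ(x), P = p_b Ψ^b(x) (`restrict`), under which X·X = X·P = 0 and P·P = p².

In the Fischer inner product multiplication is adjoint to differentiation, so every class modulo the
ideal `nullIdeal` of X·X, X·P, P·P has exactly one harmonic representative. The algebraic core is
that for n ≥ 3 the three Euclidean quadrics have only Koszul syzygies (`koszul_of_syzygy`). It
follows that the coordinates y of X and z of P that become 1 and 0 under the substitution can be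
cancelled: y modulo the ideal, and z modulo the ideal and a power of y.

Injectivity: if the restriction vanishes, a power of y times `toPoly T` lies in the ideal, so
`toPoly T` does, and being harmonic it is zero. Surjectivity for V of degree d in x: V(x - p, p) and
V(x, p) agree modulo p². Substituting yp for x and yp - zx for p gives z^d V(x, yp - zx) ≡ y^d V(p,
yp - zx), so V(x, yp - zx) ≡ y^d F, and the harmonic representative of F is the required tensor. For
smooth V each homogeneous Taylor part at each point is again conformal Killing, hence comes from an
ambient tensor and has bounded degree, so V is a polynomial.

The Lie derivative is computed in the frame Φ, Ψ, I. For irreducibility, translations differentiate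
fields, so an invariant subspace contains constant fields. Their values form a rotation-invariant
space of harmonic polynomials, which contains the zonal harmonic, unique up to scale. Any two
nonzero invariant subspaces therefore meet, whereas a proper one would have an invariant orthogonal
complement. -/

namespace ConformalKilling

open MvPolynomial

/-! ### The Fischer inner product on polynomials -/

section Fischer

variable {σ : Type}

/-- The factorial `α!` of a multi-index. -/
noncomputable def multiFactorial (α : σ →₀ ℕ) : ℝ := α.prod fun _ k => (k.factorial : ℝ)

theorem multiFactorial_pos (α : σ →₀ ℕ) : 0 < multiFactorial α :=
  Finset.prod_pos fun _ _ => by positivity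

/-- This recursion is what makes the weights α! turn multiplication by a variable into the adjoint
of differentiation. -/
theorem multiFactorial_add_single (α : σ →₀ ℕ) (i : σ) :
    multiFactorial (α + Finsupp.single i 1) = multiFactorial α * (α i + 1) := by
  classical
  have h0 : ∀ β : σ →₀ ℕ, ∀ s : Finset σ, β.support ⊆ s →
      multiFactorial β = ∏ j ∈ s, ((β j).factorial : ℝ) := fun β s hs =>
    Finsupp.prod_of_support_subset _ hs _ (by simp)
  have h1 : (α + Finsupp.single i 1).support ⊆ insert i α.support := by
    intro j hj
    by_cases hij : j = i
    · simp [hij]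
    · simpa [Finsupp.single_apply, Ne.symm hij, hij] using hj
  rw [h0 _ _ h1, h0 α _ (Finset.subset_insert i _),
    ← Finset.mul_prod_erase _ _ (Finset.mem_insert_self i _),
    ← Finset.mul_prod_erase _ (fun j => ((α j).factorial : ℝ)) (Finset.mem_insert_self i _)]
  have h2 : ∏ j ∈ (insert i α.support).erase i, (((α + Finsupp.single i 1 : σ →₀ ℕ) j).factorial : ℝ) =
      ∏ j ∈ (insert i α.support).erase i, ((α j).factorial : ℝ) := by
    refine Finset.prod_congr rfl fun j hj => ?_
    have : j ≠ i := Finset.ne_of_mem_erase hj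
    simp [this.symm]
  rw [h2]
  simp only [Finsupp.add_apply, Finsupp.single_eq_same, Nat.factorial_succ, Nat.cast_mul,
    Nat.cast_add, Nat.cast_one]
  ring

/-- The Fischer inner product `⟨f, g⟩ = ∑ α! f_α g_α`. -/
noncomputable def fischer : MvPolynomial σ ℝ →ₗ[ℝ] MvPolynomial σ ℝ →ₗ[ℝ] ℝ :=
  (basisMonomials σ ℝ).constr ℝ fun α => multiFactorial α • lcoeff ℝ α

theorem fischer_monomial (α : σ →₀ ℕ) (a : ℝ) (g : MvPolynomial σ ℝ) :
    fischer (monomial α a) g = a * (multiFactorial α * coeff α g) := by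
  have h : (monomial α a : MvPolynomial σ ℝ) = a • basisMonomials σ ℝ α := by
    rw [coe_basisMonomials, smul_monomial, smul_eq_mul, mul_one]
  rw [h, map_smul, fischer, Module.Basis.constr_basis]
  rfl

theorem fischer_eq_sum (f g : MvPolynomial σ ℝ) :
    fischer f g = ∑ α ∈ f.support, coeff α f * (multiFactorial α * coeff α g) := by
  conv_lhs => rw [f.as_sum]
  rw [map_sum, LinearMap.sum_apply]
  exact Finset.sum_congr rfl fun α _ => fischer_monomial _ _ _

theorem fischer_comm (f g : MvPolynomial σ ℝ) : fischer f g = fischer g f := by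
  classical
  have h : fischer = (fischer (σ := σ)).flip := by
    refine (basisMonomials σ ℝ).ext fun α => (basisMonomials σ ℝ).ext fun β => ?_
    simp only [coe_basisMonomials, LinearMap.flip_apply, fischer_monomial, coeff_monomial]
    by_cases h : α = β
    · subst h; rfl
    · simp [h, Ne.symm h]
  exact congrArg (fun B => B f g) h

theorem fischer_self_eq_zero {f : MvPolynomial σ ℝ} (h : fischer f f = 0) : f = 0 := by
  rw [fischer_eq_sum] at h
  rw [Finset.sum_eq_zero_iff_of_nonneg] at h
  · rw [← support_eq_empty, Finset.eq_empty_iff_forall_notMem]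
    intro α hα
    have h1 := h α hα
    have h2 := multiFactorial_pos α
    have h3 : coeff α f ≠ 0 := mem_support_iff.1 hα
    simp_all
  · intro α _
    have := multiFactorial_pos α
    nlinarith [mul_nonneg this.le (mul_self_nonneg (coeff α f))]

theorem eq_zero_of_fischer {f : MvPolynomial σ ℝ} (h : ∀ g, fischer f g = 0) : f = 0 :=
  fischer_self_eq_zero (h f)

theorem fischer_X_mul (i : σ) (f g : MvPolynomial σ ℝ) :
    fischer (X i * f) g = fischer f (pderiv i g) := by
  induction f using MvPolynomial.induction_on' with
  | monomial α a =>
    rw [mul_comm, X, monomial_mul, mul_one, fischer_monomial,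
      fischer_monomial, multiFactorial_add_single, coeff_pderiv]
    ring
  | add p q hp hq => rw [mul_add, map_add, map_add, LinearMap.add_apply, LinearMap.add_apply, hp, hq]

/-- Extension of the adjointness of `X i` and `pderiv i` to second order. -/
theorem fischer_X_mul_X_mul (i j : σ) (f g : MvPolynomial σ ℝ) :
    fischer (X i * X j * f) g = fischer f (pderiv i (pderiv j g)) := by
  rw [mul_comm (X i), mul_assoc, fischer_X_mul, fischer_X_mul]

theorem totalDegree_pderiv_le {i : σ} {f : MvPolynomial σ ℝ} {N : ℕ}
    (hf : f.totalDegree ≤ N + 1) : (pderiv i f).totalDegree ≤ N := by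
  refine Finset.sup_le fun α hα => ?_
  rw [mem_support_iff, coeff_pderiv] at hα
  have h : α + Finsupp.single i 1 ∈ f.support := by
    rw [mem_support_iff]
    exact left_ne_zero_of_mul hα
  have h1 := (le_totalDegree h).trans hf
  rw [Finsupp.sum_add_index' (by simp) (by simp), Finsupp.sum_single_index rfl] at h1
  omega

/-- Orthogonal projection onto a finite-dimensional space of polynomials. -/
theorem exists_fischer_proj (W : Submodule ℝ (MvPolynomial σ ℝ)) [FiniteDimensional ℝ W]
    (l : W →ₗ[ℝ] ℝ) : ∃ w : W, ∀ v : W, fischer (w : MvPolynomial σ ℝ) v = l v := by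
  let φ : W →ₗ[ℝ] Module.Dual ℝ W :=
    (LinearMap.lcomp ℝ ℝ W.subtype) ∘ₗ fischer ∘ₗ W.subtype
  have hφ : ∀ w v : W, φ w v = fischer (w : MvPolynomial σ ℝ) v := fun _ _ => rfl
  have hinj : Function.Injective φ := by
    rw [injective_iff_map_eq_zero]
    intro w hw
    have h1 : fischer (w : MvPolynomial σ ℝ) w = 0 := by rw [← hφ, hw]; rfl
    exact Subtype.ext (fischer_self_eq_zero h1)
  have hsurj : Function.Surjective φ :=
    (LinearMap.injective_iff_surjective_of_finrank_eq_finrank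
      (Subspace.dual_finrank_eq).symm).1 hinj
  obtain ⟨w, hw⟩ := hsurj l
  exact ⟨w, fun v => by rw [← hφ, hw]⟩

/-- The Fischer decomposition: every polynomial is the sum of a combination of the quadratic
polynomials `Q j` and a polynomial annihilated by the adjoints `L j` of multiplication by the
`Q j`. -/
theorem fischer_decomposition [Finite σ] {κ : Type} [Fintype κ] (Q : κ → MvPolynomial σ ℝ)
    (L : κ → MvPolynomial σ ℝ → MvPolynomial σ ℝ) (hQ : ∀ j, (Q j).totalDegree ≤ 2)
    (hadj : ∀ j a g, fischer (Q j * a) g = fischer a (L j g))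
    (hdeg : ∀ j N g, g.totalDegree ≤ N + 2 → (L j g).totalDegree ≤ N) (f : MvPolynomial σ ℝ) :
    ∃ a : κ → MvPolynomial σ ℝ, ∀ j, L j (f - ∑ i, Q i * a i) = 0 := by
  classical
  let N := f.totalDegree
  let V := restrictTotalDegree σ ℝ N
  let m : (κ → V) →ₗ[ℝ] MvPolynomial σ ℝ :=
    ∑ j, (LinearMap.mulLeft ℝ (Q j)) ∘ₗ V.subtype ∘ₗ LinearMap.proj j
  have hm : ∀ a, m a = ∑ j, Q j * (a j : MvPolynomial σ ℝ) := by
    intro a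
    simp [m]
  obtain ⟨⟨w, a, ha⟩, hw⟩ := exists_fischer_proj (LinearMap.range m)
    ((fischer f) ∘ₗ (LinearMap.range m).subtype)
  refine ⟨fun j => a j, fun j => ?_⟩
  rw [← hm, ha]
  -- The residue f - w is orthogonal to the range of `m`. Although w may have degree N + 2, `L j`
  -- lowers degrees by two, so `L j (f - w)` is an admissible coefficient: pairing the residue with
  -- `Q j * L j (f - w)` gives the square norm of `L j (f - w)`.
  have hmem : L j (f - w) ∈ V := by
    rw [mem_restrictTotalDegree]
    refine hdeg j N _ ((totalDegree_sub _ _).trans (max_le (Nat.le_add_right _ _) ?_))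
    rw [← ha, hm]
    refine (totalDegree_finsetSum _ _).trans (Finset.sup_le fun i _ => ?_)
    refine (totalDegree_mul _ _).trans ?_
    have h1 := (mem_restrictTotalDegree σ N _).1 (a i).2
    have h2 := hQ i
    omega
  refine fischer_self_eq_zero ?_
  have h1 := hw ⟨m (Pi.single j ⟨_, hmem⟩), _, rfl⟩
  have h2 : m (Pi.single j ⟨_, hmem⟩) = Q j * L j (f - w) := by
    rw [hm, Finset.sum_eq_single j]
    · simp
    · intro i _ hi
      simp [Pi.single_eq_of_ne hi]
    · simp
  simp only [LinearMap.comp_apply, Submodule.subtype_apply, h2] at h1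
  rw [← hadj, fischer_comm, map_sub, LinearMap.sub_apply, h1, sub_self]

/-- The weighted homogeneous components are orthogonal projections. -/
theorem fischer_weightedHomogeneousComponent {M : Type} [AddCommMonoid M] (w : σ → M) (m : M)
    (f g : MvPolynomial σ ℝ) :
    fischer (weightedHomogeneousComponent w m f) g =
      fischer f (weightedHomogeneousComponent w m g) := by
  classical
  induction f using MvPolynomial.induction_on' with
  | monomial α a =>
    have h : weightedHomogeneousComponent w m (monomial α a) =
        if Finsupp.weight w α = m then monomial α a else 0 := by
      ext β
      rw [coeff_weightedHomogeneousComponent]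
      by_cases hβ : α = β
      · subst hβ
        split_ifs <;> simp
      · split_ifs <;> simp [coeff_monomial, hβ]
    rw [h, fischer_monomial, coeff_weightedHomogeneousComponent]
    split_ifs
    · rw [fischer_monomial]
    · simp
  | add p q hp hq => simp only [map_add, LinearMap.add_apply, hp, hq]

end Fischer

/-! ### Contracting tensors with covectors -/

section Contraction

variable {ι m R S : Type} [Fintype ι] [DecidableEq ι] [Fintype m] [CommRing R] [Algebra ℝ R]
  [CommRing S] [Algebra ℝ S]

/-- The contraction of a tensor with one covector for every slot; the covectors may have entries
in any commutative algebra. -/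
def ct (u : ι → m → R) : Tens ι m →ₗ[ℝ] R where
  toFun T := ∑ I : ι → m, T I • ∏ q, u q (I q)
  map_add' T U := by simp only [Pi.add_apply, add_smul, Finset.sum_add_distrib]
  map_smul' c T := by
    simp only [Pi.smul_apply, smul_assoc, RingHom.id_apply, Finset.smul_sum]

theorem ct_apply (u : ι → m → R) (T : Tens ι m) : ct u T = ∑ I : ι → m, T I • ∏ q, u q (I q) :=
  rfl

omit [Fintype m] [Algebra ℝ R] in
theorem prod_update_apply (u : ι → m → R) (p : ι) (a : m → R) (I : ι → m) :
    ∏ q, Function.update u p a q (I q) = a (I p) * ∏ q ∈ Finset.univ.erase p, u q (I q) := by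
  rw [← Finset.mul_prod_erase _ _ (Finset.mem_univ p), Function.update_self]
  congr 1
  refine Finset.prod_congr rfl fun q hq => ?_
  rw [Function.update_of_ne (Finset.ne_of_mem_erase hq)]

theorem ct_update (u : ι → m → R) (p : ι) (a : m → R) (T : Tens ι m) :
    ct (Function.update u p a) T =
      ∑ I : ι → m, T I • (a (I p) * ∏ q ∈ Finset.univ.erase p, u q (I q)) := by
  simp only [ct_apply, prod_update_apply]

theorem ct_update_add (u : ι → m → R) (p : ι) (a b : m → R) (T : Tens ι m) :
    ct (Function.update u p (a + b)) T =
      ct (Function.update u p a) T + ct (Function.update u p b) T := by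
  simp only [ct_update, Pi.add_apply, add_mul, smul_add, Finset.sum_add_distrib]

theorem ct_update_smul (u : ι → m → R) (p : ι) (r : R) (a : m → R) (T : Tens ι m) :
    ct (Function.update u p (r • a)) T = r * ct (Function.update u p a) T := by
  simp only [ct_update, Pi.smul_apply, smul_eq_mul, Finset.mul_sum]
  refine Finset.sum_congr rfl fun I _ => ?_
  rw [mul_assoc, mul_smul_comm]

theorem ct_update_sum {κ : Type} (s : Finset κ) (u : ι → m → R) (p : ι) (a : κ → m → R)
    (T : Tens ι m) :
    ct (Function.update u p (∑ k ∈ s, a k)) T = ∑ k ∈ s, ct (Function.update u p (a k)) T := by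
  classical
  induction s using Finset.induction_on with
  | empty => simp [ct_update]
  | insert k s hk ih => rw [Finset.sum_insert hk, Finset.sum_insert hk, ct_update_add, ih]

theorem ct_update_zero (u : ι → m → R) (p : ι) (T : Tens ι m) :
    ct (Function.update u p 0) T = 0 := by
  simp [ct_update]

theorem ct_update_neg (u : ι → m → R) (p : ι) (a : m → R) (T : Tens ι m) :
    ct (Function.update u p (-a)) T = -ct (Function.update u p a) T := by
  simp only [ct_update, Pi.neg_apply, neg_mul, smul_neg, Finset.sum_neg_distrib]

theorem ct_permute (u : ι → m → R) (σ : Equiv.Perm ι) (T : Tens ι m) :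
    ct u (permute σ T) = ct (u ∘ σ) T := by
  simp only [ct_apply, permute, LinearMap.coe_mk, AddHom.coe_mk]
  refine Fintype.sum_equiv (Equiv.arrowCongr σ.symm (Equiv.refl m)) _ _ fun I => ?_
  have h : (Equiv.arrowCongr σ.symm (Equiv.refl m)) I = I ∘ σ := by
    funext q
    simp [Equiv.arrowCongr]
  rw [h]
  congr 1
  exact (Equiv.prod_comp σ fun q => u q (I q)).symm

theorem ct_map (φ : R →ₐ[ℝ] S) (u : ι → m → R) (T : Tens ι m) :
    φ (ct u T) = ct (fun q A => φ (u q A)) T := by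
  simp only [ct_apply, map_sum, map_smul, map_prod]

omit [Fintype ι] in
theorem derivation_prod (D : Derivation ℝ R R) (s : Finset ι) (f : ι → R) :
    D (∏ q ∈ s, f q) = ∑ q ∈ s, D (f q) * ∏ k ∈ s.erase q, f k := by
  induction s using Finset.induction_on with
  | empty => simp
  | insert a s ha ih =>
    rw [Finset.prod_insert ha, Derivation.leibniz, ih, Finset.sum_insert ha,
      Finset.erase_insert ha, smul_eq_mul, smul_eq_mul, add_comm, mul_comm, Finset.mul_sum]
    congr 1
    refine Finset.sum_congr rfl fun q hq => ?_
    have hqa : q ≠ a := fun h => ha (h ▸ hq)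
    rw [Finset.erase_insert_of_ne hqa.symm, Finset.prod_insert (by simp [ha])]
    ring

theorem ct_derivation (D : Derivation ℝ R R) (u : ι → m → R) (T : Tens ι m) :
    D (ct u T) = ∑ q, ct (Function.update u q fun A => D (u q A)) T := by
  simp only [ct_update]
  rw [Finset.sum_comm, ct_apply, map_sum]
  refine Finset.sum_congr rfl fun I _ => ?_
  rw [Derivation.map_smul, derivation_prod, Finset.smul_sum]

-- Summing over the index of a slot that is already summed counts every multi-index `card m` times.
-- This isolates one slot without splitting `ι → m` into a product.
omit [DecidableEq ι] in
theorem sum_sum_update [DecidableEq ι] {M : Type} [AddCommMonoid M] (f : (ι → m) → M) (p : ι) :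
    ∑ I : ι → m, ∑ E, f (Function.update I p E) = Fintype.card m • ∑ I, f I := by
  have h : ∑ x : (ι → m) × m, f (Function.update x.1 p x.2) = ∑ x : (ι → m) × m, f x.1 := by
    refine Fintype.sum_equiv (Function.Involutive.toPerm
      (fun x : (ι → m) × m => (Function.update x.1 p x.2, x.1 p)) ?_) _ _ fun x => rfl
    rintro ⟨I, E⟩
    simp
  rw [Fintype.sum_prod_type, Fintype.sum_prod_type] at h
  rw [h]
  simp [Finset.smul_sum]

theorem ct_slotAct (u : ι → m → R) (A : Matrix m m ℝ) (p : ι) (T : Tens ι m) :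
    ct u (slotAct A p T) = ct (Function.update u p fun E => ∑ B, A B E • u p B) T := by
  rcases isEmpty_or_nonempty m with hm | hm
  · simp only [ct_apply]
    rw [Finset.sum_eq_zero, Finset.sum_eq_zero] <;> exact fun I _ => isEmptyElim (I p)
  have hcard : (Fintype.card m : ℝ) ≠ 0 := by exact_mod_cast Fintype.card_ne_zero
  -- A redundant sum over slot `p` is introduced on both sides, so that the old and the new index of
  -- that slot can be exchanged. The factor `card m` is cancelled at the end.
  have key : (Fintype.card m) • ct u (slotAct A p T) = (Fintype.card m) •
      ct (Function.update u p fun E => ∑ B, A B E • u p B) T := by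
    rw [ct_update, ← sum_sum_update _ p, ct_apply, ← sum_sum_update _ p]
    refine Finset.sum_congr rfl fun I _ => ?_
    have h1 : ∀ E, ∏ q ∈ Finset.univ.erase p, u q (Function.update I p E q) =
        ∏ q ∈ Finset.univ.erase p, u q (I q) := fun E =>
      Finset.prod_congr rfl fun q hq => by rw [Function.update_of_ne (Finset.ne_of_mem_erase hq)]
    simp only [slotAct, LinearMap.coe_mk, AddHom.coe_mk, Function.update_self,
      Function.update_idem, h1, Finset.sum_smul, Finset.sum_mul, Finset.smul_sum]
    rw [Finset.sum_comm]
    refine Finset.sum_congr rfl fun E _ => Finset.sum_congr rfl fun B _ => ?_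
    rw [← Finset.mul_prod_erase _ _ (Finset.mem_univ p), Function.update_self, h1, smul_mul_assoc,
      smul_smul, mul_comm]
  rw [← Nat.cast_smul_eq_nsmul ℝ, ← Nat.cast_smul_eq_nsmul ℝ] at key
  exact smul_right_injective R hcard key

theorem ct_tensAct (u : ι → m → R) (A : Matrix m m ℝ) (T : Tens ι m) :
    ct u (tensAct A T) = ∑ p, ct (Function.update u p fun E => ∑ B, A B E • u p B) T := by
  simp only [tensAct_apply, map_sum, ct_slotAct]

/-- The form in which trace-freeness is used below: the metric inserted in two slots of the
multilinear form gives zero, whatever covectors fill the others. -/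
theorem ct_contract [DecidableEq m] (u : ι → m → R) (g : Matrix m m ℝ) {p q : ι} (hpq : p ≠ q)
    {T : Tens ι m} (hT : contract g p q T = 0) :
    ∑ E, ∑ F, g E F •
      ct (Function.update (Function.update u p (Pi.single E 1)) q (Pi.single F 1)) T = 0 := by
  rcases isEmpty_or_nonempty m with hm | hm
  · simp
  have hcard : (Fintype.card m : ℝ) ≠ 0 := by exact_mod_cast Fintype.card_ne_zero
  let R' : (ι → m) → R := fun I => ∏ k ∈ (Finset.univ.erase q).erase p, u k (I k)
  have h1 : ∀ E F, ct (Function.update (Function.update u p (Pi.single E 1)) q (Pi.single F 1)) T =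
      ∑ I : ι → m, T I • ((Pi.single F 1 : m → R) (I q) * ((Pi.single E 1 : m → R) (I p) *
        R' I)) := by
    intro E F
    rw [ct_update]
    refine Finset.sum_congr rfl fun I _ => ?_
    rw [← Finset.mul_prod_erase (Finset.univ.erase q) _
      (Finset.mem_erase.2 ⟨hpq, Finset.mem_univ p⟩), Function.update_self]
    congr 3
    refine Finset.prod_congr rfl fun k hk => ?_
    rw [Function.update_of_ne (Finset.ne_of_mem_erase hk)]
  have h2 : ∑ E, ∑ F, g E F •
      ct (Function.update (Function.update u p (Pi.single E 1)) q (Pi.single F 1)) T =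
      ∑ I : ι → m, (g (I p) (I q) * T I) • R' I := by
    simp only [h1, Finset.smul_sum]
    rw [Finset.sum_comm_cycle, Finset.sum_comm_cycle]
    rw [Finset.sum_comm]
    refine Finset.sum_congr rfl fun I _ => ?_
    rw [Finset.sum_comm, Finset.sum_eq_single (I p), Finset.sum_eq_single (I q)]
    · simp [smul_smul]
    · intro F _ hF
      simp [hF.symm]
    · simp
    · intro E _ hE
      simp [Pi.single_apply, hE.symm]
    · simp
  rw [h2]
  have h3 : Fintype.card m • Fintype.card m • ∑ I : ι → m, (g (I p) (I q) * T I) • R' I = 0 := by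
    rw [← sum_sum_update (fun I : ι → m => (g (I p) (I q) * T I) • R' I) q,
      ← sum_sum_update (fun I : ι → m => ∑ F, (g (Function.update I q F p)
        (Function.update I q F q) * T (Function.update I q F)) • R' (Function.update I q F)) p]
    refine Finset.sum_eq_zero fun I _ => ?_
    have h4 : ∀ E F, R' (Function.update (Function.update I p E) q F) = R' I := fun E F =>
      Finset.prod_congr rfl fun k hk => by
        rw [Function.update_of_ne (Finset.ne_of_mem_erase (Finset.mem_of_mem_erase hk)),
          Function.update_of_ne (Finset.ne_of_mem_erase hk)]
    simp only [h4, Function.update_self, Function.update_of_ne hpq, ← Finset.sum_smul]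
    have h5 : ∑ E, ∑ F, g E F * T (Function.update (Function.update I p E) q F) = 0 :=
      congrFun hT I
    rw [h5, zero_smul]
  rw [← Nat.cast_smul_eq_nsmul ℝ, ← Nat.cast_smul_eq_nsmul ℝ, smul_smul] at h3
  exact (smul_eq_zero.1 h3).resolve_left (mul_ne_zero hcard hcard)

end Contraction

/-! ### Tensors with the symmetries of a two-row rectangular tableau -/

section Bianchi

variable {ι m : Type} [Fintype ι] [DecidableEq ι]

-- Two values determine a permutation supported on three points, so each of the six candidates is
-- recognised from its values at `p` and `q`.
omit [Fintype ι] in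
theorem perm_eq_of_fixes {p q r : ι} {σ τ : Equiv.Perm ι}
    (hσ : ∀ x, x ∉ ({p, q, r} : Finset ι) → σ x = x)
    (hτ : ∀ x, x ∉ ({p, q, r} : Finset ι) → τ x = x) (hp : σ p = τ p) (hq : σ q = τ q) :
    σ = τ := by
  have hr : ∀ ρ : Equiv.Perm ι, (∀ x, x ∉ ({p, q, r} : Finset ι) → ρ x = x) → ρ p = p → ρ q = q →
      ρ = 1 := by
    intro ρ hρ hp hq
    have h3 : ρ r = r := by
      by_contra h
      by_cases h4 : ρ r ∈ ({p, q, r} : Finset ι)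
      · simp only [Finset.mem_insert, Finset.mem_singleton] at h4
        rcases h4 with h4 | h4 | h4
        · rw [← hp] at h4
          have := ρ.injective h4
          rw [this] at h
          exact h hp
        · rw [← hq] at h4
          have := ρ.injective h4
          rw [this] at h
          exact h hq
        · exact h h4
      · exact h (ρ.injective (hρ _ h4))
    ext x
    by_cases hx : x ∈ ({p, q, r} : Finset ι)
    · simp only [Finset.mem_insert, Finset.mem_singleton] at hx
      rcases hx with rfl | rfl | rfl <;> simp_all
    · simp [hρ x hx]
  have h := hr (τ⁻¹ * σ) (fun x hx => by
      rw [Equiv.Perm.mul_apply, hσ x hx, Equiv.Perm.inv_eq_iff_eq, hτ x hx])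
    (by rw [Equiv.Perm.mul_apply, hp, Equiv.Perm.inv_eq_iff_eq])
    (by rw [Equiv.Perm.mul_apply, hq, Equiv.Perm.inv_eq_iff_eq])
  rw [inv_mul_eq_one] at h
  exact h.symm

theorem filter_fixes_triple {p q r : ι} (hpq : p ≠ q) (hpr : p ≠ r) (hqr : q ≠ r) :
    (Finset.univ.filter fun σ : Equiv.Perm ι => ∀ x, x ∉ ({p, q, r} : Finset ι) → σ x = x) =
      {1, Equiv.swap p q * Equiv.swap q r, Equiv.swap q r * Equiv.swap p q,
        Equiv.swap p q, Equiv.swap q r, Equiv.swap p r} := by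
  have hsw : ∀ a ∈ ({p, q, r} : Finset ι), ∀ b ∈ ({p, q, r} : Finset ι), ∀ x,
      x ∉ ({p, q, r} : Finset ι) → Equiv.swap a b x = x := by
    intro a ha b hb x hx
    exact Equiv.swap_apply_of_ne_of_ne (fun h => hx (h ▸ ha)) (fun h => hx (h ▸ hb))
  have hp : p ∈ ({p, q, r} : Finset ι) := by simp
  have hq : q ∈ ({p, q, r} : Finset ι) := by simp
  have hr : r ∈ ({p, q, r} : Finset ι) := by simp
  ext σ
  simp only [Finset.mem_filter, Finset.mem_univ, true_and, Finset.mem_insert (a := σ),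
    Finset.mem_singleton (b := σ)]
  constructor
  · intro h
    have hmem : ∀ y ∈ ({p, q, r} : Finset ι), σ y ∈ ({p, q, r} : Finset ι) := by
      intro y hy
      by_contra hc
      exact hc ((σ.injective (h _ hc)).symm ▸ hy)
    have h1 := hmem p hp
    have h2 := hmem q hq
    have h3 : σ p ≠ σ q := fun e => hpq (σ.injective e)
    simp only [Finset.mem_insert, Finset.mem_singleton] at h1 h2
    rcases h1 with h1 | h1 | h1 <;> rcases h2 with h2 | h2 | h2
    · exact absurd (h1.trans h2.symm) h3
    · exact .inl (perm_eq_of_fixes h (fun _ _ => rfl) h1 h2)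
    · refine .inr (.inr (.inr (.inr (.inl (perm_eq_of_fixes h (hsw q hq r hr) ?_ ?_)))))
      · rw [h1, Equiv.swap_apply_of_ne_of_ne hpq hpr]
      · rw [h2, Equiv.swap_apply_left]
    · refine .inr (.inr (.inr (.inl (perm_eq_of_fixes h (hsw p hp q hq) ?_ ?_))))
      · rw [h1, Equiv.swap_apply_left]
      · rw [h2, Equiv.swap_apply_right]
    · exact absurd (h1.trans h2.symm) h3
    · refine .inr (.inl (perm_eq_of_fixes h (fun x hx => ?_) ?_ ?_))
      · rw [Equiv.Perm.mul_apply, hsw q hq r hr x hx, hsw p hp q hq x hx]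
      · rw [h1, Equiv.Perm.mul_apply, Equiv.swap_apply_of_ne_of_ne hpq hpr, Equiv.swap_apply_left]
      · rw [h2, Equiv.Perm.mul_apply, Equiv.swap_apply_left,
          Equiv.swap_apply_of_ne_of_ne hpr.symm hqr.symm]
    · refine .inr (.inr (.inl (perm_eq_of_fixes h (fun x hx => ?_) ?_ ?_)))
      · rw [Equiv.Perm.mul_apply, hsw p hp q hq x hx, hsw q hq r hr x hx]
      · rw [h1, Equiv.Perm.mul_apply, Equiv.swap_apply_left, Equiv.swap_apply_left]
      · rw [h2, Equiv.Perm.mul_apply, Equiv.swap_apply_right,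
          Equiv.swap_apply_of_ne_of_ne hpq hpr]
    · refine .inr (.inr (.inr (.inr (.inr (perm_eq_of_fixes h (hsw p hp r hr) ?_ ?_)))))
      · rw [h1, Equiv.swap_apply_left]
      · rw [h2, Equiv.swap_apply_of_ne_of_ne hpq.symm hqr]
    · exact absurd (h1.trans h2.symm) h3
  · rintro (rfl | rfl | rfl | rfl | rfl | rfl) x hx
    · rfl
    · rw [Equiv.Perm.mul_apply, hsw q hq r hr x hx, hsw p hp q hq x hx]
    · rw [Equiv.Perm.mul_apply, hsw p hp q hq x hx, hsw q hq r hr x hx]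
    · exact hsw p hp q hq x hx
    · exact hsw q hq r hr x hx
    · exact hsw p hp r hr x hx

omit [Fintype ι] [DecidableEq ι] in
theorem permute_permute (σ τ : Equiv.Perm ι) (T : Tens ι m) :
    permute σ (permute τ T) = permute (σ * τ) T := rfl

omit [Fintype ι] [DecidableEq ι] in
theorem permute_one (T : Tens ι m) : permute 1 T = T := rfl

/-- The first Bianchi identity. -/
theorem bianchi_of_skewOver {p q r : ι} (hpq : p ≠ q) (hpr : p ≠ r) (hqr : q ≠ r)
    {T : Tens ι m} (hT : permute (Equiv.swap p q) T = -T) (h : skewOver {p, q, r} T = 0) :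
    T + permute (Equiv.swap p q * Equiv.swap q r) T +
      permute (Equiv.swap q r * Equiv.swap p q) T = 0 := by
  have e1 : Equiv.swap p q * Equiv.swap q r ≠ 1 := by
    intro h
    have := congrArg (fun σ : Equiv.Perm ι => σ p) h
    simp [Equiv.swap_apply_of_ne_of_ne hpq hpr] at this
    exact hpq this.symm
  have hs : ∀ a b : ι, a ≠ b → Equiv.Perm.sign (Equiv.swap a b) = -1 := fun a b hab =>
    Equiv.Perm.sign_swap hab
  have n1 : (1 : Equiv.Perm ι) ∉ ({Equiv.swap p q * Equiv.swap q r, Equiv.swap q r * Equiv.swap p q,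
        Equiv.swap p q, Equiv.swap q r, Equiv.swap p r} : Finset (Equiv.Perm ι)) := by
    simp only [Finset.mem_insert, Finset.mem_singleton, not_or]
    refine ⟨e1.symm, fun h => ?_, fun h => ?_, fun h => ?_, fun h => ?_⟩
    · have := congrArg (fun σ : Equiv.Perm ι => σ p) h
      simp at this
      exact hpr this
    · exact hpq (by simpa using congrArg (fun σ : Equiv.Perm ι => σ p) h)
    · exact hqr (by simpa using congrArg (fun σ : Equiv.Perm ι => σ q) h)
    · exact hpr (by simpa using congrArg (fun σ : Equiv.Perm ι => σ p) h)
  have n2 : Equiv.swap p q * Equiv.swap q r ∉ ({Equiv.swap q r * Equiv.swap p q,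
        Equiv.swap p q, Equiv.swap q r, Equiv.swap p r} : Finset (Equiv.Perm ι)) := by
    simp only [Finset.mem_insert, Finset.mem_singleton, not_or]
    refine ⟨fun h => ?_, fun h => ?_, fun h => ?_, fun h => ?_⟩
    · have := congrArg (fun σ : Equiv.Perm ι => σ p) h
      simp [Equiv.swap_apply_of_ne_of_ne hpq hpr] at this
      exact hqr this
    all_goals
      have := congrArg Equiv.Perm.sign h
      rw [map_mul, hs p q hpq, hs q r hqr] at this
    · exact absurd this (by decide)
    · exact absurd this (by decide)
    · rw [hs p r hpr] at this
      exact absurd this (by decide)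
  have n3 : Equiv.swap q r * Equiv.swap p q ∉ ({
        Equiv.swap p q, Equiv.swap q r, Equiv.swap p r} : Finset (Equiv.Perm ι)) := by
    simp only [Finset.mem_insert, Finset.mem_singleton, not_or]
    refine ⟨fun h => ?_, fun h => ?_, fun h => ?_⟩
    all_goals
      have := congrArg Equiv.Perm.sign h
      rw [map_mul, hs p q hpq, hs q r hqr] at this
    · exact absurd this (by decide)
    · exact absurd this (by decide)
    · rw [hs p r hpr] at this
      exact absurd this (by decide)
  have n4 : Equiv.swap p q ∉ ({Equiv.swap q r, Equiv.swap p r} : Finset (Equiv.Perm ι)) := by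
    simp only [Finset.mem_insert, Finset.mem_singleton, not_or]
    refine ⟨fun h => ?_, fun h => ?_⟩
    · have := congrArg (fun σ : Equiv.Perm ι => σ p) h
      simp [Equiv.swap_apply_of_ne_of_ne hpq hpr] at this
      exact hpq this.symm
    · exact hqr (by simpa using congrArg (fun σ : Equiv.Perm ι => σ p) h)
  have n5 : Equiv.swap q r ∉ ({Equiv.swap p r} : Finset (Equiv.Perm ι)) := by
    simp only [Finset.mem_singleton]
    intro h
    have := congrArg (fun σ : Equiv.Perm ι => σ p) h
    simp [Equiv.swap_apply_of_ne_of_ne hpq hpr] at this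
    exact hpr this
  rw [skewOver, filter_fixes_triple hpq hpr hqr, Finset.sum_insert n1, Finset.sum_insert n2,
    Finset.sum_insert n3, Finset.sum_insert n4, Finset.sum_insert n5, Finset.sum_singleton] at h
  simp only [map_mul, map_one, hs p q hpq, hs q r hqr, hs p r hpr, LinearMap.add_apply,
    LinearMap.smul_apply] at h
  -- Skewness in `p`, `q` turns the three odd terms into the three cyclic ones, so the alternating
  -- sum is twice the cyclic sum.
  have c1 : permute (Equiv.swap q r) T =
      -permute (Equiv.swap q r * Equiv.swap p q) T := by
    rw [← permute_permute, hT, map_neg, neg_neg]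
  have c2 : permute (Equiv.swap p r) T = -permute (Equiv.swap p q * Equiv.swap q r) T := by
    have h1 : Equiv.swap p q * Equiv.swap q r = Equiv.swap p r * Equiv.swap p q := by
      rw [Equiv.mul_swap_eq_swap_mul, Equiv.swap_apply_right,
        Equiv.swap_apply_of_ne_of_ne hpr.symm hqr.symm]
    rw [h1, ← permute_permute, hT, map_neg, neg_neg]
  rw [c1, c2, hT, permute_one] at h
  funext i
  have h2 := congrFun h i
  simp only [Pi.add_apply, Pi.smul_apply, Pi.neg_apply, Pi.zero_apply, smul_eq_mul] at h2 ⊢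
  norm_num at h2
  linarith

end Bianchi

/-- The symmetries of the two-row rectangular tableau: skewness in every pair, and skewing over any
three indices gives zero. -/
structure IsCurvatureLike {s : ℕ} {m : Type} (T : Tens (Fin s × Fin 2) m) : Prop where
  skew : ∀ k : Fin s, permute (Equiv.swap (k, 0) (k, 1)) T = -T
  bianchi : ∀ S : Finset (Fin s × Fin 2), S.card = 3 → skewOver S T = 0

section CurvatureLike

variable {s : ℕ} {m R : Type} [Fintype m] [CommRing R] [Algebra ℝ R]
  {T : Tens (Fin s × Fin 2) m}

/-- Covectors for the four slots in the columns `k` and `l`, and those of `u` elsewhere. -/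
def quad (u : Fin s × Fin 2 → m → R) (k l : Fin s) (a b c d : m → R) :
    Fin s × Fin 2 → m → R := fun q =>
  if q = (k, 0) then a else if q = (k, 1) then b else if q = (l, 0) then c
  else if q = (l, 1) then d else u q

omit [Fintype m] [CommRing R] [Algebra ℝ R] in
theorem quad_comp_swap_left (u : Fin s × Fin 2 → m → R) {k l : Fin s}
    (a b c d : m → R) :
    quad u k l a b c d ∘ Equiv.swap (k, 0) (k, 1) = quad u k l b a c d := by
  funext q
  simp only [quad, Function.comp_apply, Equiv.swap_apply_def]
  split_ifs <;> simp_all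

omit [Fintype m] [CommRing R] [Algebra ℝ R] in
theorem quad_comp_swap_right (u : Fin s × Fin 2 → m → R) {k l : Fin s} (hkl : k ≠ l)
    (a b c d : m → R) :
    quad u k l a b c d ∘ Equiv.swap (l, 0) (l, 1) = quad u k l a b d c := by
  funext q
  simp only [quad, Function.comp_apply, Equiv.swap_apply_def]
  split_ifs <;> simp_all

omit [Fintype m] [CommRing R] [Algebra ℝ R] in
theorem quad_comp_swap_mid (u : Fin s × Fin 2 → m → R) {k l : Fin s} (hkl : k ≠ l)
    (a b c d : m → R) :
    quad u k l a b c d ∘ Equiv.swap (k, 1) (l, 0) = quad u k l a c b d := by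
  funext q
  simp only [quad, Function.comp_apply, Equiv.swap_apply_def]
  split_ifs <;> simp_all

theorem real_smul_eq_zero {c : ℝ} (hc : c ≠ 0) {x : R} (h : c • x = 0) : x = 0 :=
  (smul_eq_zero.1 h).resolve_left hc

theorem IsCurvatureLike.ct_swap (hT : IsCurvatureLike T) (u : Fin s × Fin 2 → m → R)
    (k : Fin s) : ct (u ∘ Equiv.swap (k, 0) (k, 1)) T = -ct u T := by
  rw [← ct_permute, hT.skew, map_neg]

theorem IsCurvatureLike.ct_eq_zero (hT : IsCurvatureLike T) (u : Fin s × Fin 2 → m → R)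
    (k : Fin s) (h : u (k, 0) = u (k, 1)) : ct u T = 0 := by
  have h1 : u ∘ Equiv.swap (k, 0) (k, 1) = u := by
    funext q
    simp only [Function.comp_apply, Equiv.swap_apply_def]
    split_ifs <;> simp_all
  have h2 := hT.ct_swap u k
  rw [h1] at h2
  refine real_smul_eq_zero (two_ne_zero (α := ℝ)) ?_
  rw [two_smul]
  linear_combination h2

theorem IsCurvatureLike.quad_left (hT : IsCurvatureLike T) (u : Fin s × Fin 2 → m → R)
    {k l : Fin s} (a b c d : m → R) :
    ct (quad u k l b a c d) T = -ct (quad u k l a b c d) T := by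
  rw [← hT.ct_swap _ k, quad_comp_swap_left u]

theorem IsCurvatureLike.quad_right (hT : IsCurvatureLike T) (u : Fin s × Fin 2 → m → R)
    {k l : Fin s} (hkl : k ≠ l) (a b c d : m → R) :
    ct (quad u k l a b d c) T = -ct (quad u k l a b c d) T := by
  rw [← hT.ct_swap _ l, quad_comp_swap_right u hkl]

theorem IsCurvatureLike.quad_cyclic (hT : IsCurvatureLike T) (u : Fin s × Fin 2 → m → R)
    {k l : Fin s} (hkl : k ≠ l) (a b c d : m → R) :
    ct (quad u k l a b c d) T + ct (quad u k l b c a d) T + ct (quad u k l c a b d) T = 0 := by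
  have h1 : ((k, 0) : Fin s × Fin 2) ≠ (k, 1) := by simp
  have h2 : ((k, 0) : Fin s × Fin 2) ≠ (l, 0) := by simp [hkl]
  have h3 : ((k, 1) : Fin s × Fin 2) ≠ (l, 0) := by simp
  have h := bianchi_of_skewOver h1 h2 h3 (hT.skew k) (hT.bianchi _ (by
    rw [Finset.card_eq_three]
    exact ⟨_, _, _, h1, h2, h3, rfl⟩))
  have h4 := congrArg (ct (quad u k l a b c d)) h
  rw [map_add, map_add, ct_permute, ct_permute, map_zero, Equiv.Perm.coe_mul, Equiv.Perm.coe_mul,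
    ← Function.comp_assoc, ← Function.comp_assoc, quad_comp_swap_left u,
    quad_comp_swap_mid u hkl, quad_comp_swap_mid u hkl, quad_comp_swap_left u] at h4
  exact h4

/-- Tensors with the symmetries of the tableau are symmetric under exchange of two columns. -/
theorem IsCurvatureLike.quad_pair (hT : IsCurvatureLike T) (u : Fin s × Fin 2 → m → R)
    {k l : Fin s} (hkl : k ≠ l) (a b c d : m → R) :
    ct (quad u k l c d a b) T = ct (quad u k l a b c d) T := by
  -- The classical argument for the Riemann tensor: the four cyclic identities, combined with signs
  -- and reduced by skewness, leave twice the difference of the two sides.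
  have S1 := hT.quad_cyclic u hkl a b c d
  have S2 := hT.quad_cyclic u hkl b c d a
  have S3 := hT.quad_cyclic u hkl c d a b
  have S4 := hT.quad_cyclic u hkl d a b c
  have L := fun a b c d => hT.quad_left (k := k) (l := l) u a b c d
  have Rr := fun a b c d => hT.quad_right u hkl a b c d
  rw [← sub_eq_zero]
  refine real_smul_eq_zero (two_ne_zero (α := ℝ)) ?_
  rw [two_smul]
  linear_combination (-1) * S1 + (-1) * S2 + (1) * S3 + (1) * S4 + (-1) * Rr a b c d +
    (1) * L a c b d + (-1) * Rr a c b d + (-1) * L a d b c + (1) * Rr a d b c +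
    (-1) * L a d c b + (1) * Rr b c a d + (-1) * Rr b d a c + (1) * L b d c a + (1) * Rr c d a b

/-- The covectors `X` and `P` in the columns in `B`, and constants elsewhere. -/
noncomputable def partialGeneric (B : Finset (Fin s)) (u : Fin s × Fin 2 → m → ℝ) :
    Fin s × Fin 2 → m → MvPolynomial (Fin 2 × m) ℝ :=
  fun q A => if q.1 ∈ B then X (q.2, A) else C (u q A)

/-- The derivation that replaces the variables of the row `r` by the constants `c`. -/
noncomputable def polarization (r : Fin 2) (c : m → ℝ) :
    Derivation ℝ (MvPolynomial (Fin 2 × m) ℝ) (MvPolynomial (Fin 2 × m) ℝ) :=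
  mkDerivation ℝ fun q => if q.1 = r then C (c q.2) else 0

omit [Fintype m] in
theorem polarization_partialGeneric (B : Finset (Fin s)) (u : Fin s × Fin 2 → m → ℝ) (r : Fin 2)
    (c : m → ℝ) (q : Fin s × Fin 2) :
    (fun A => polarization r c (partialGeneric B u q A)) =
      if q.1 ∈ B ∧ q.2 = r then (fun A => C (c A)) else 0 := by
  funext A
  by_cases h1 : q.1 ∈ B
  · by_cases h2 : q.2 = r
    · simp [partialGeneric, polarization, h1, h2, mkDerivation_X]
    · simp [partialGeneric, polarization, h1, h2, mkDerivation_X]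
  · simp [partialGeneric, h1]

theorem polarization_ct (r : Fin 2) (c : m → ℝ) (B : Finset (Fin s))
    (v : Fin s × Fin 2 → m → MvPolynomial (Fin 2 × m) ℝ)
    (hv : ∀ q, (fun A => polarization r c (v q A)) =
      if q.1 ∈ B ∧ q.2 = r then (fun A => C (c A)) else 0) :
    polarization r c (ct v T) = ∑ j ∈ B, ct (Function.update v (j, r) fun A => C (c A)) T := by
  rw [ct_derivation]
  simp only [hv]
  rw [Fintype.sum_prod_type, ← Finset.sum_subset (Finset.subset_univ B)]
  · refine Finset.sum_congr rfl fun j hj => ?_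
    rw [Finset.sum_eq_single r]
    · simp [hj]
    · intro r' _ hr
      simp [hr, ct_update_zero]
    · simp
  · intro j _ hj
    simp [hj, ct_update_zero]

/-- One generic column is traded for constants. The identity is polarised once in X and once in P.
With `f` the term having both constants in column `k`, and `g j` the term having the second one in
column `j`, this gives `f + ∑ g j = 0`. Since `f` is skew and the cyclic identity says that the skew
part of each `g j` is governed by `f`, antisymmetrising leaves `(2 + card B) f = 0`. -/
theorem IsCurvatureLike.partialGeneric_step (hT : IsCurvatureLike T) {k : Fin s}
    {B : Finset (Fin s)} (hk : k ∉ B)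
    (h : ∀ u, ct (partialGeneric (insert k B) u) T = 0) (u : Fin s × Fin 2 → m → ℝ) :
    ct (partialGeneric B u) T = 0 := by
  set w := partialGeneric (insert k B) u with hw
  let x : m → MvPolynomial (Fin 2 × m) ℝ := fun A => X (0, A)
  let p : m → MvPolynomial (Fin 2 × m) ℝ := fun A => X (1, A)
  let κ : (m → ℝ) → m → MvPolynomial (Fin 2 × m) ℝ := fun c A => C (c A)
  have hx : ∀ j ∈ insert k B, w (j, 0) = x := fun j hj => by
    funext A; simp only [hw, partialGeneric, if_pos hj, x]
  have hp : ∀ j ∈ insert k B, w (j, 1) = p := fun j hj => by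
    funext A; simp only [hw, partialGeneric, if_pos hj, p]
  have hkB : k ∈ insert k B := Finset.mem_insert_self k B
  have hjk : ∀ j ∈ B, j ≠ k := fun j hj e => hk (e ▸ hj)
  have first : ∀ c, ct (Function.update w (k, 0) (κ c)) T = 0 := by
    intro c
    have h1 := polarization_ct (T := T) 0 c (insert k B) w
      (fun q => polarization_partialGeneric _ _ _ _ _)
    rw [h u, map_zero] at h1
    -- All generic columns carry the same pair (X, P), so exchanging columns identifies the terms of
    -- the polarisation, and their sum is a positive multiple of the one for column `k`.
    have h2 : ∀ j ∈ insert k B, ct (Function.update w (j, 0) (κ c)) T =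
        ct (Function.update w (k, 0) (κ c)) T := by
      intro j hj
      rcases eq_or_ne j k with rfl | hne
      · rfl
      have e1 : Function.update w (j, 0) (κ c) = quad w j k (κ c) p x p := by
        rw [← hx k hkB, ← hp k hkB]
        nth_rewrite 2 [hp k hkB]
        rw [← hp j hj]
        funext q
        simp only [quad, Function.update_apply]
        split_ifs <;> simp_all
      have e2 : Function.update w (k, 0) (κ c) = quad w j k x p (κ c) p := by
        rw [← hx j hj, ← hp k hkB]
        nth_rewrite 2 [hp k hkB]
        rw [← hp j hj]
        funext q
        simp only [quad, Function.update_apply]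
        split_ifs <;> simp_all
      rw [e1, e2, hT.quad_pair w hne]
    rw [Finset.sum_congr rfl h2, Finset.sum_const, ← Nat.cast_smul_eq_nsmul ℝ] at h1
    exact real_smul_eq_zero (by rw [Finset.card_insert_of_notMem hk]; positivity) h1.symm
  let f : (m → ℝ) → (m → ℝ) → MvPolynomial (Fin 2 × m) ℝ := fun c r =>
    ct (Function.update (Function.update w (k, 0) (κ c)) (k, 1) (κ r)) T
  let g : Fin s → (m → ℝ) → (m → ℝ) → MvPolynomial (Fin 2 × m) ℝ := fun j c r =>
    ct (Function.update (Function.update w (k, 0) (κ c)) (j, 1) (κ r)) T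
  have second : ∀ c r, f c r + ∑ j ∈ B, g j c r = 0 := by
    intro c r
    have h1 := polarization_ct (T := T) 1 r (insert k B) (Function.update w (k, 0) (κ c)) (by
      intro q
      rcases eq_or_ne q (k, 0) with rfl | hq
      · funext A
        simp [κ]
      · rw [Function.update_of_ne hq]
        exact polarization_partialGeneric _ _ _ _ _)
    rw [first c, map_zero, Finset.sum_insert hk] at h1
    exact h1.symm
  have fskew : ∀ c r, f c r = -f r c := by
    intro c r
    have := hT.ct_swap (Function.update (Function.update w (k, 0) (κ c)) (k, 1) (κ r)) k
    have e : Function.update (Function.update w (k, 0) (κ c)) (k, 1) (κ r) ∘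
        Equiv.swap (k, 0) (k, 1) =
        Function.update (Function.update w (k, 0) (κ r)) (k, 1) (κ c) := by
      funext q
      simp only [Function.comp_apply, Function.update_apply, Equiv.swap_apply_def]
      split_ifs <;> simp_all
    rw [e] at this
    simp only [f, this, neg_neg]
  have gf : ∀ j ∈ B, ∀ c r, g j c r - g j r c = f c r := by
    intro j hj c r
    have hne := hjk j hj
    have hj' : j ∈ insert k B := Finset.mem_insert_of_mem hj
    have eg : ∀ c r, g j c r = ct (quad w j k x (κ r) (κ c) p) T := by
      intro c r
      simp only [g]
      refine congrArg (fun v => ct v T) ?_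
      clear fskew
      rw [← hx j hj', ← hp k hkB]
      funext q
      simp only [quad, Function.update_apply]
      split_ifs <;> simp_all
    have ef : ∀ c r, f c r = ct (quad w j k x p (κ c) (κ r)) T := by
      intro c r
      simp only [f]
      refine congrArg (fun v => ct v T) ?_
      clear fskew
      rw [← hx j hj', ← hp j hj']
      funext q
      simp only [quad, Function.update_apply]
      split_ifs <;> simp_all
    -- Of the three terms of the cyclic identity, two are `g j c r` and `-g j r c`; the third has
    -- both constants in one column and is `f` after exchange of columns.
    have h1 := hT.quad_cyclic w hne x (κ r) (κ c) p
    have h2 := hT.quad_pair w hne x p (κ r) (κ c)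
    have h3 := hT.quad_left w (k := j) (l := k) x (κ c) (κ r) p
    rw [← eg] at h1
    rw [← ef, fskew r c] at h2
    rw [← eg] at h3
    rw [h2, h3] at h1
    linear_combination h1
  have hf : f (u (k, 0)) (u (k, 1)) = 0 := by
    set c := u (k, 0)
    set r := u (k, 1)
    have h1 := second c r
    have h2 := second r c
    have h3 : ∑ j ∈ B, g j c r - ∑ j ∈ B, g j r c = (B.card : ℝ) • f c r := by
      rw [← Finset.sum_sub_distrib, Finset.sum_congr rfl fun j hj => gf j hj c r,
        Finset.sum_const, Nat.cast_smul_eq_nsmul]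
    have h4 : (2 + (B.card : ℝ)) ≠ 0 := by
      clear fskew gf
      positivity
    refine real_smul_eq_zero h4 ?_
    rw [add_smul, two_smul, ← h3]
    linear_combination h1 - h2 + fskew c r
  have hlast : partialGeneric B u =
      Function.update (Function.update w (k, 0) (κ (u (k, 0)))) (k, 1) (κ (u (k, 1))) := by
    funext ⟨j, i⟩ A
    rcases eq_or_ne j k with rfl | hj
    · fin_cases i <;> simp [partialGeneric, hk, κ]
    · simp [partialGeneric, hj, hw]
  rw [hlast]
  exact hf

/-- The polynomial of a tensor, with one copy of the variables for every row. -/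
noncomputable def toPoly (T : Tens (Fin s × Fin 2) m) : MvPolynomial (Fin 2 × m) ℝ :=
  ct (fun q A => X (q.2, A)) T

/-- A tensor with the symmetries of the tableau is determined by its polynomial. -/
theorem IsCurvatureLike.eq_zero_of_toPoly (hT : IsCurvatureLike T) (h : toPoly T = 0) : T = 0 := by
  -- Starting from all columns generic, they are replaced by constants one at a time until the full
  -- multilinear form is known to vanish.
  have key : ∀ B : Finset (Fin s), ∀ u, ct (partialGeneric Bᶜ u) T = 0 := by
    intro B
    induction B using Finset.induction_on with
    | empty =>
      intro u
      rw [← h, toPoly]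
      refine congrArg (fun v => ct v T) ?_
      funext q A
      simp [partialGeneric]
    | insert k B hk ih =>
      refine fun u => hT.partialGeneric_step (k := k) (by simp) (fun u => ?_) u
      rw [← ih u]
      refine congrArg (fun B => ct (partialGeneric B u) T) ?_
      ext j
      by_cases hj : j = k
      · simp [hj, hk]
      · simp [hj]
  classical
  funext I
  have h1 := key Finset.univ fun q => Pi.single (I q) 1
  rw [ct_apply, Finset.sum_eq_single I] at h1
  · simpa [partialGeneric] using h1
  · intro J _ hJ
    obtain ⟨q, hq⟩ := Function.ne_iff.1 hJ
    rw [Finset.prod_eq_zero (Finset.mem_univ q), smul_zero]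
    simp [partialGeneric, hq]
  · simp

end CurvatureLike

/-! ### The image of the Young symmetriser -/

section Young

variable {s : ℕ} {m : Type}

/-- Symmetrization over the rows, without normalization. -/
noncomputable def rowSym : Tens (Fin s × Fin 2) m →ₗ[ℝ] Tens (Fin s × Fin 2) m :=
  ∑ σ : Equiv.Perm (Fin s × Fin 2) with (∀ p, (σ p).2 = p.2), permute σ

/-- Skewing over the columns, without normalization. -/
noncomputable def colSkew : Tens (Fin s × Fin 2) m →ₗ[ℝ] Tens (Fin s × Fin 2) m :=
  ∑ τ : Equiv.Perm (Fin s × Fin 2) with (∀ p, (τ p).1 = p.1),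
    ((Equiv.Perm.sign τ : ℤ) : ℝ) • permute τ

theorem youngSymmetrizer_apply (T : Tens (Fin s × Fin 2) m) :
    youngSymmetrizer s m T = colSkew (rowSym T) := rfl

/-- Invariance under permutations that preserve the rows. -/
def RowSymmetric (T : Tens (Fin s × Fin 2) m) : Prop :=
  ∀ σ : Equiv.Perm (Fin s × Fin 2), (∀ p, (σ p).2 = p.2) → permute σ T = T

theorem rowSymmetric_rowSym (T : Tens (Fin s × Fin 2) m) : RowSymmetric (rowSym T) := by
  intro σ hσ
  simp only [rowSym, LinearMap.sum_apply, map_sum, permute_permute]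
  refine Finset.sum_bij (fun τ _ => σ * τ) ?_ (fun _ _ _ _ h => mul_left_cancel h) ?_
    (fun _ _ => rfl)
  · intro τ hτ
    simp only [Finset.mem_filter, Finset.mem_univ, true_and] at hτ ⊢
    intro p
    rw [Equiv.Perm.mul_apply, hσ, hτ]
  · intro τ hτ
    simp only [Finset.mem_filter, Finset.mem_univ, true_and] at hτ
    refine ⟨σ⁻¹ * τ, ?_, by simp⟩
    simp only [Finset.mem_filter, Finset.mem_univ, true_and]
    intro p
    rw [← hσ, ← Equiv.Perm.mul_apply, mul_inv_cancel_left, hτ]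

theorem RowSymmetric.rowSym_eq {T : Tens (Fin s × Fin 2) m} (hT : RowSymmetric T) :
    rowSym T = ((Finset.univ.filter fun σ : Equiv.Perm (Fin s × Fin 2) =>
      ∀ p, (σ p).2 = p.2).card : ℝ) • T := by
  rw [rowSym, LinearMap.sum_apply, Nat.cast_smul_eq_nsmul, ← Finset.sum_const]
  refine Finset.sum_congr rfl fun σ hσ => hT σ ?_
  simpa using hσ

theorem skewOver_eq_zero_of_swap {ι : Type} [Fintype ι] [DecidableEq ι] {S : Finset ι} {p q : ι}
    (hp : p ∈ S) (hq : q ∈ S) (hpq : p ≠ q) {T : Tens ι m}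
    (hT : permute (Equiv.swap p q) T = T) : skewOver S T = 0 := by
  have hfix : ∀ x, x ∉ S → Equiv.swap p q x = x := fun x hx =>
    Equiv.swap_apply_of_ne_of_ne (fun h => hx (h ▸ hp)) (fun h => hx (h ▸ hq))
  have h : skewOver S T = -skewOver S T := by
    simp only [skewOver, LinearMap.sum_apply, LinearMap.smul_apply]
    rw [← Finset.sum_neg_distrib]
    refine Finset.sum_bij' (fun σ _ => σ * Equiv.swap p q) (fun σ _ => σ * Equiv.swap p q)
      ?_ ?_ ?_ ?_ ?_
    · intro σ hσ
      simp only [Finset.mem_filter, Finset.mem_univ, true_and] at hσ ⊢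
      intro x hx
      rw [Equiv.Perm.mul_apply, hfix x hx, hσ x hx]
    · intro σ hσ
      simp only [Finset.mem_filter, Finset.mem_univ, true_and] at hσ ⊢
      intro x hx
      rw [Equiv.Perm.mul_apply, hfix x hx, hσ x hx]
    · intro σ _
      simp [mul_assoc]
    · intro σ _
      simp [mul_assoc]
    · intro σ _
      rw [map_mul, Equiv.Perm.sign_swap hpq, ← permute_permute, hT]
      simp
  exact self_eq_neg.1 h

/-- Pigeonhole gives the three-index condition: there are two rows, so for every column permutation
two of the three skewed slots come from the same row, where the tensor is symmetric. -/
theorem isCurvatureLike_colSkew {T : Tens (Fin s × Fin 2) m} (hT : RowSymmetric T) :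
    IsCurvatureLike (colSkew T) where
  skew k := by
    have hc : ∀ p, (Equiv.swap ((k, 0) : Fin s × Fin 2) (k, 1) p).1 = p.1 := by
      intro p
      rw [Equiv.swap_apply_def]
      split_ifs with h1 h2
      · rw [h1]
      · rw [h2]
      · rfl
    simp only [colSkew, LinearMap.sum_apply, LinearMap.smul_apply, map_sum, map_smul,
      permute_permute]
    rw [← Finset.sum_neg_distrib]
    refine Finset.sum_bij' (fun σ _ => Equiv.swap (k, 0) (k, 1) * σ)
      (fun σ _ => Equiv.swap (k, 0) (k, 1) * σ) ?_ ?_ ?_ ?_ ?_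
    · intro σ hσ
      simp only [Finset.mem_filter, Finset.mem_univ, true_and] at hσ ⊢
      intro p
      rw [Equiv.Perm.mul_apply, hc, hσ]
    · intro σ hσ
      simp only [Finset.mem_filter, Finset.mem_univ, true_and] at hσ ⊢
      intro p
      rw [Equiv.Perm.mul_apply, hc, hσ]
    · intro σ _
      simp
    · intro σ _
      simp
    · intro σ _
      rw [map_mul, Equiv.Perm.sign_swap (by simp)]
      simp
  bianchi S hS := by
    simp only [colSkew, LinearMap.sum_apply, LinearMap.smul_apply, map_sum, map_smul]
    refine Finset.sum_eq_zero fun τ _ => ?_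
    obtain ⟨p, hp, q, hq, hpq, hrow⟩ : ∃ p ∈ S, ∃ q ∈ S, p ≠ q ∧ (τ⁻¹ p).2 = (τ⁻¹ q).2 :=
      Finset.exists_ne_map_eq_of_card_lt_of_maps_to (t := Finset.univ) (by rw [hS]; decide)
        (fun _ _ => Finset.mem_coe.2 (Finset.mem_univ _))
    rw [skewOver_eq_zero_of_swap hp hq hpq, smul_zero]
    have h1 : Equiv.swap p q * τ = τ * Equiv.swap (τ⁻¹ p) (τ⁻¹ q) := by
      simp [Equiv.mul_swap_eq_swap_mul]
    rw [permute_permute, h1, ← permute_permute, hT]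
    intro x
    rw [Equiv.swap_apply_def]
    split_ifs with h2 h3
    · rw [h2, hrow]
    · rw [h3, hrow]
    · rfl

theorem contract_permute {ι : Type} [DecidableEq ι] [Fintype m] (g : Matrix m m ℝ) (p q : ι)
    (τ : Equiv.Perm ι) (T : Tens ι m) :
    contract g p q (permute τ T) = permute τ (contract g (τ⁻¹ p) (τ⁻¹ q) T) := by
  funext i
  simp only [contract, permute, LinearMap.coe_mk, AddHom.coe_mk]
  refine Finset.sum_congr rfl fun E _ => Finset.sum_congr rfl fun F _ => ?_
  rw [Function.update_comp_equiv, Function.update_comp_equiv]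
  rfl

theorem contract_colSkew [Fintype m] (g : Matrix m m ℝ) {T : Tens (Fin s × Fin 2) m}
    (hT : T ∈ traceFree (Fin s × Fin 2) g) : colSkew T ∈ traceFree (Fin s × Fin 2) g := by
  simp only [traceFree, Submodule.mem_iInf, LinearMap.mem_ker] at hT ⊢
  intro p q hpq
  simp only [colSkew, LinearMap.sum_apply, LinearMap.smul_apply, map_sum, map_smul]
  refine Finset.sum_eq_zero fun τ _ => ?_
  rw [contract_permute, hT _ _ (fun h => hpq (τ⁻¹.injective h)), map_zero, smul_zero]

end Young

/-! ### Polarization -/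

section Polarization

variable {s : ℕ} {m : Type}

/-- The bidegree of polynomials in two rows of variables. -/
def rowWeight (m : Type) (q : Fin 2 × m) : ℕ × ℕ := if q.1 = 0 then (1, 0) else (0, 1)

/-- The product of the variables with indices `J` in the rows given by the slots. -/
noncomputable def slotMonomial (J : Fin s × Fin 2 → m) : MvPolynomial (Fin 2 × m) ℝ :=
  ∏ q, X (q.2, J q)

/-- The multilinear form of a polynomial, up to normalization. -/
noncomputable def polar (s : ℕ) (F : MvPolynomial (Fin 2 × m) ℝ) : Tens (Fin s × Fin 2) m :=
  fun J => fischer (slotMonomial J) F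

theorem rowSymmetric_polar (F : MvPolynomial (Fin 2 × m) ℝ) : RowSymmetric (polar s F) := by
  intro σ hσ
  funext J
  simp only [permute, LinearMap.coe_mk, AddHom.coe_mk, polar, slotMonomial]
  congr 2
  conv_rhs => rw [← Equiv.prod_comp σ]
  exact Finset.prod_congr rfl fun q _ => by rw [hσ]; rfl

theorem derivation_sum_apply {R κ : Type} [CommRing R] [Algebra ℝ R] (t : Finset κ)
    (D : κ → Derivation ℝ R R) (x : R) : (∑ k ∈ t, D k) x = ∑ k ∈ t, D k x := by
  classical
  induction t using Finset.induction_on with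
  | empty => simp
  | insert k t hk ih => rw [Finset.sum_insert hk, Finset.sum_insert hk, Derivation.add_apply, ih]

/-- The derivation `∑ X_(r, A) ∂ / ∂ X_(r', A)`. -/
noncomputable def rowDer [Fintype m] (r r' : Fin 2) :
    Derivation ℝ (MvPolynomial (Fin 2 × m) ℝ) (MvPolynomial (Fin 2 × m) ℝ) :=
  mkDerivation ℝ fun q => if q.1 = r' then X (r, q.2) else 0

theorem rowDer_apply [Fintype m] (r r' : Fin 2) (F : MvPolynomial (Fin 2 × m) ℝ) :
    rowDer r r' F = ∑ A, X (r, A) * pderiv (r', A) F := by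
  classical
  have h : rowDer (m := m) r r' =
      ∑ A, (X (r, A) : MvPolynomial (Fin 2 × m) ℝ) • pderiv (R := ℝ) (r', A) := by
    refine derivation_ext fun q => ?_
    rw [rowDer, mkDerivation_X, derivation_sum_apply]
    simp only [Derivation.smul_apply, pderiv_X, smul_eq_mul]
    by_cases hq : q.1 = r'
    · rw [if_pos hq, Finset.sum_eq_single q.2]
      · simp [← hq]
      · intro A _ hA
        have : q ≠ (r', A) := fun e => hA (by rw [e])
        simp [this]
      · simp
    · rw [if_neg hq]
      symm
      refine Finset.sum_eq_zero fun A _ => ?_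
      have : q ≠ (r', A) := fun e => hq (by rw [e])
      simp [this]
  rw [h, derivation_sum_apply]
  simp only [Derivation.smul_apply, smul_eq_mul]

/-- The raising and lowering operators of 𝔤𝔩(2) are adjoint. This yields the Garnir relation, and
later shows that X·∂/∂P respects harmonic representatives. -/
theorem fischer_rowDer [Fintype m] (r r' : Fin 2) (F G : MvPolynomial (Fin 2 × m) ℝ) :
    fischer F (rowDer r r' G) = fischer (rowDer r' r F) G := by
  rw [rowDer_apply, rowDer_apply, map_sum, map_sum, LinearMap.sum_apply]
  refine Finset.sum_congr rfl fun A _ => ?_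
  rw [fischer_comm, fischer_X_mul, fischer_comm, fischer_X_mul]

/-- The Garnir relation for polynomials annihilated by `X · ∂ / ∂ P`. -/
theorem polar_garnir [Fintype m] {F : MvPolynomial (Fin 2 × m) ℝ} (hF : rowDer 0 1 F = 0)
    (k : Fin s) :
    polar s F + ∑ j, permute (Equiv.swap (j, 0) (k, 1)) (polar s F) = 0 := by
  funext J
  -- The monomial of `J` with the factor of slot `(k, 1)` moved to row 0. The lowering operator
  -- moves one of its s + 1 factors of row 0 to row 1, which produces exactly the terms of the
  -- relation; adjointness and `hF` make their sum pair to zero with `F`.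
  let y : Fin s × Fin 2 → MvPolynomial (Fin 2 × m) ℝ := fun q =>
    if q.2 = 0 ∨ q = (k, 1) then X (0, J q) else X (1, J q)
  have h := fischer_rowDer 0 1 (∏ q, y q) F
  rw [hF, map_zero, derivation_prod, Fintype.sum_prod_type, map_sum, LinearMap.sum_apply] at h
  simp only [Fin.sum_univ_two, map_add, LinearMap.add_apply] at h
  rw [Finset.sum_add_distrib] at h
  have hy0 : ∀ j : Fin s, rowDer 1 0 (y (j, 0)) = X (1, J (j, 0)) := fun j => by
    simp [y, rowDer, mkDerivation_X]
  have hy1 : ∀ j : Fin s, j ≠ k → rowDer 1 0 (y (j, 1)) = 0 := fun j hj => by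
    simp [y, rowDer, mkDerivation_X, hj]
  have hyk : rowDer 1 0 (y (k, 1)) = X (1, J (k, 1)) := by
    simp [y, rowDer, mkDerivation_X]
  rw [add_comm, Finset.sum_eq_single k] at h
  · have e1 : rowDer 1 0 (y (k, 1)) * ∏ q ∈ Finset.univ.erase (k, 1), y q = slotMonomial J := by
      rw [hyk, slotMonomial, ← Finset.mul_prod_erase _ _ (Finset.mem_univ (k, (1 : Fin 2)))]
      congr 1
      refine Finset.prod_congr rfl fun q hq => ?_
      have hq' := Finset.ne_of_mem_erase hq
      obtain ⟨a, i⟩ := q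
      fin_cases i
      · simp [y]
      · simp_all [y]
    have e2 : ∀ j : Fin s, rowDer 1 0 (y (j, 0)) * ∏ q ∈ Finset.univ.erase (j, 0), y q =
        slotMonomial (J ∘ Equiv.swap (j, 0) (k, 1)) := by
      intro j
      rw [hy0, slotMonomial, ← Equiv.prod_comp (Equiv.swap ((j, 0) : Fin s × Fin 2) (k, 1)),
        ← Finset.mul_prod_erase _ _ (Finset.mem_univ (j, (0 : Fin 2)))]
      congr 1
      · simp
      refine Finset.prod_congr rfl fun q hq => ?_
      have hq' := Finset.ne_of_mem_erase hq
      rw [Function.comp_apply, Equiv.swap_apply_self]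
      by_cases hqk : q = (k, 1)
      · simp [y, hqk]
      · rw [Equiv.swap_apply_of_ne_of_ne hq' hqk]
        obtain ⟨a, i⟩ := q
        fin_cases i
        · simp [y]
        · simp_all [y]
    rw [e1] at h
    simp only [e2] at h
    simpa [polar, permute, Finset.sum_apply] using h.symm
  · intro j _ hj
    rw [hy1 j hj]
    simp
  · simp

/-- The second order operator adjoint to multiplication by `∑ g_EF X_(r, E) X_(r', F)`. -/
noncomputable def laplace [Fintype m] (g : Matrix m m ℝ) (r r' : Fin 2)
    (F : MvPolynomial (Fin 2 × m) ℝ) : MvPolynomial (Fin 2 × m) ℝ :=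
  ∑ A, ∑ B, g A B • pderiv (r, A) (pderiv (r', B) F)

/-- By adjointness the two factors of the slot monomial being contracted become second derivatives
of `F`, so the trace is a pairing with `laplace g _ _ F`. -/
theorem contract_polar [Fintype m] (g : Matrix m m ℝ) {F : MvPolynomial (Fin 2 × m) ℝ}
    (hF : ∀ r r', laplace g r r' F = 0) : polar s F ∈ traceFree (Fin s × Fin 2) g := by
  simp only [traceFree, Submodule.mem_iInf, LinearMap.mem_ker]
  intro p q hpq
  funext J
  let M : MvPolynomial (Fin 2 × m) ℝ := ∏ k ∈ (Finset.univ.erase q).erase p, X (k.2, J k)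
  have h : ∀ A B, polar s F (Function.update (Function.update J p A) q B) =
      fischer M (pderiv (p.2, A) (pderiv (q.2, B) F)) := by
    intro A B
    rw [← fischer_X_mul_X_mul, polar, slotMonomial,
      ← Finset.mul_prod_erase _ _ (Finset.mem_univ q),
      ← Finset.mul_prod_erase _ _ (Finset.mem_erase.2 ⟨hpq, Finset.mem_univ p⟩)]
    congr 2
    rw [Function.update_self, Function.update_of_ne hpq, Function.update_self, ← mul_assoc,
      mul_comm (X (q.2, B))]
    congr 1
    refine Finset.prod_congr rfl fun k hk => ?_
    rw [Function.update_of_ne (Finset.ne_of_mem_erase (Finset.mem_of_mem_erase hk)),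
      Function.update_of_ne (Finset.ne_of_mem_erase hk)]
  have h2 : fischer M (laplace g p.2 q.2 F) = 0 := by rw [hF, map_zero]
  simp only [contract, LinearMap.coe_mk, AddHom.coe_mk, h, Pi.zero_apply]
  rw [laplace] at h2
  simpa [map_sum] using h2

end Polarization

/-! ### Recovering a polynomial from its polarisation -/

section Counting

/-- Functions with fibers of equal cardinality differ by a permutation. -/
theorem exists_perm_comp_eq {α β : Type} [Fintype α] [DecidableEq β] {f g : α → β}
    (h : ∀ b, Fintype.card {a // f a = b} = Fintype.card {a // g a = b}) :
    ∃ σ : Equiv.Perm α, f ∘ σ = g := by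
  let e : ∀ b, {a // g a = b} ≃ {a // f a = b} := fun b => Fintype.equivOfCardEq (h b).symm
  refine ⟨(Equiv.sigmaFiberEquiv g).symm.trans
    ((Equiv.sigmaCongrRight e).trans (Equiv.sigmaFiberEquiv f)), ?_⟩
  funext a
  simp only [Function.comp_apply, Equiv.trans_apply, Equiv.sigmaFiberEquiv,
    Equiv.coe_fn_mk, Equiv.coe_fn_symm_mk, Equiv.sigmaCongrRight_apply]
  exact (e (g a) ⟨a, rfl⟩).2

/-- A function with prescribed fiber cardinalities. -/
theorem exists_card_fiber_eq {β : Type} [Fintype β] [DecidableEq β] {s : ℕ} (γ : β → ℕ)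
    (h : ∑ b, γ b = s) : ∃ f : Fin s → β, ∀ b, Fintype.card {k // f k = b} = γ b := by
  have hc : Fintype.card (Fin s) = Fintype.card (Σ b, Fin (γ b)) := by simp [h]
  let e := Fintype.equivOfCardEq hc
  refine ⟨fun k => (e k).1, fun b => ?_⟩
  have e2 : {k // (e k).1 = b} ≃ {x : Σ b, Fin (γ b) // x.1 = b} :=
    e.subtypeEquiv fun _ => Iff.rfl
  rw [Fintype.card_congr (e2.trans (Equiv.sigmaSubtype b)), Fintype.card_fin]

variable {s : ℕ} {m : Type}

/-- The exponent of `slotMonomial J`. -/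
noncomputable def slotExponent (J : Fin s × Fin 2 → m) : Fin 2 × m →₀ ℕ :=
  ∑ q, Finsupp.single (q.2, J q) 1

theorem slotMonomial_eq (J : Fin s × Fin 2 → m) : slotMonomial J = monomial (slotExponent J) 1 := by
  rw [slotMonomial, slotExponent, monomial_sum_one]
  rfl

theorem slotExponent_apply [DecidableEq m] (J : Fin s × Fin 2 → m) (b : Fin 2 × m) :
    slotExponent J b = Fintype.card {q : Fin s × Fin 2 // (q.2, J q) = b} := by
  rw [slotExponent, Finsupp.finsetSum_apply, Fintype.card_subtype, Finset.card_filter]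
  exact Finset.sum_congr rfl fun q _ => by rw [Finsupp.single_apply]

theorem exists_slotExponent_eq [Fintype m] {β : Fin 2 × m →₀ ℕ}
    (hβ : Finsupp.weight (rowWeight m) β = (s, s)) :
    ∃ J : Fin s × Fin 2 → m, slotExponent J = β := by
  classical
  rw [Finsupp.weight_apply, Finsupp.sum_fintype _ _ (by simp), Fintype.sum_prod_type,
    Fin.sum_univ_two] at hβ
  simp only [rowWeight, Prod.smul_mk, smul_eq_mul, mul_one, mul_zero, if_true, one_ne_zero,
    if_false] at hβ
  have h1 := congrArg Prod.fst hβ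
  have h2 := congrArg Prod.snd hβ
  simp only [Prod.fst_add, Prod.fst_sum, Prod.snd_add, Prod.snd_sum, Finset.sum_const_zero,
    add_zero, zero_add] at h1 h2
  obtain ⟨f0, hf0⟩ := exists_card_fiber_eq (fun A => β (0, A)) h1
  obtain ⟨f1, hf1⟩ := exists_card_fiber_eq (fun A => β (1, A)) h2
  refine ⟨fun q => if q.2 = 0 then f0 q.1 else f1 q.1, ?_⟩
  ext ⟨r, A⟩
  rw [slotExponent_apply]
  fin_cases r
  · change _ = β (0, A)
    rw [← hf0 A]
    refine Fintype.card_congr ⟨fun q => ⟨q.1.1, ?_⟩, fun k => ⟨(k.1, 0), ?_⟩, ?_, ?_⟩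
    · have := q.2; simp only [Prod.mk.injEq] at this; simpa [this.1] using this.2
    · simp [k.2]
    · rintro ⟨⟨a, i⟩, h⟩
      simp only [Prod.mk.injEq] at h
      simpa using h.1.symm
    · intro k; rfl
  · change _ = β (1, A)
    rw [← hf1 A]
    refine Fintype.card_congr ⟨fun q => ⟨q.1.1, ?_⟩, fun k => ⟨(k.1, 1), ?_⟩, ?_, ?_⟩
    · have := q.2; simp only [Prod.mk.injEq] at this; simpa [this.1] using this.2
    · simp [k.2]
    · rintro ⟨⟨a, i⟩, h⟩
      simp only [Prod.mk.injEq] at h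
      simpa using h.1.symm
    · intro k; rfl

/-- The number of permutations that preserve the rows. -/
noncomputable def rowPermCard (s : ℕ) : ℝ := (Finset.univ.filter fun σ : Equiv.Perm (Fin s × Fin 2) =>
  ∀ p, (σ p).2 = p.2).card

theorem rowPermCard_ne_zero (s : ℕ) : rowPermCard s ≠ 0 := by
  rw [rowPermCard, Nat.cast_ne_zero]
  exact Finset.card_ne_zero_of_mem (a := 1) (by simp)

theorem multiFactorial_eq_prod {σ : Type} [Fintype σ] (β : σ →₀ ℕ) :
    multiFactorial β = ∏ b, ((β b).factorial : ℝ) :=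
  Finsupp.prod_fintype _ _ (by simp)

/-- Orbit and stabiliser: the index functions with the same exponent form the orbit of `J₀` under
the row-preserving permutations, and the stabiliser of `J₀` has order the product of the factorials.
-/
theorem card_slotExponent_eq [Fintype m] [DecidableEq m] (J₀ : Fin s × Fin 2 → m) :
    ((Finset.univ.filter fun J : Fin s × Fin 2 → m => slotExponent J = slotExponent J₀).card : ℝ) *
      multiFactorial (slotExponent J₀) = rowPermCard s := by
  have h := Finset.card_eq_sum_card_fiberwise (f := fun σ : Equiv.Perm (Fin s × Fin 2) => J₀ ∘ σ)
    (s := Finset.univ.filter fun σ : Equiv.Perm (Fin s × Fin 2) => ∀ p, (σ p).2 = p.2)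
    (t := Finset.univ.filter fun J : Fin s × Fin 2 → m => slotExponent J = slotExponent J₀) (by
      intro σ hσ
      simp only [Finset.coe_filter, Finset.mem_univ, true_and, Set.mem_ofPred_eq] at hσ ⊢
      rw [slotExponent, slotExponent, ← Equiv.sum_comp σ fun q => Finsupp.single (q.2, J₀ q) 1]
      exact Finset.sum_congr rfl fun q _ => by rw [hσ]; rfl)
  rw [rowPermCard, h, Nat.cast_sum, ← nsmul_eq_mul, ← Finset.sum_const]
  refine Finset.sum_congr rfl fun J hJ => ?_
  simp only [Finset.mem_filter, Finset.mem_univ, true_and] at hJ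
  obtain ⟨σ₀, hσ₀⟩ : ∃ σ : Equiv.Perm (Fin s × Fin 2),
      (fun q => (q.2, J₀ q)) ∘ σ = fun q => (q.2, J q) :=
    exists_perm_comp_eq fun b => by rw [← slotExponent_apply, ← slotExponent_apply, hJ]
  have hσ₁ : ∀ q, (σ₀ q).2 = q.2 := fun q => congrArg Prod.fst (congrFun hσ₀ q)
  have hσ₂ : J₀ ∘ σ₀ = J := funext fun q => congrArg Prod.snd (congrFun hσ₀ q)
  rw [multiFactorial_eq_prod]
  simp only [slotExponent_apply]
  rw [← Nat.cast_prod, ← DomMulAct.stabilizer_card (fun q : Fin s × Fin 2 => (q.2, J₀ q)),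
    Nat.cast_inj, Finset.filter_filter, Fintype.card_subtype]
  refine Finset.card_bij' (fun g _ => g * σ₀) (fun σ _ => σ * σ₀⁻¹) ?_ ?_ ?_ ?_
  · intro g hg
    simp only [Finset.mem_filter, Finset.mem_univ, true_and] at hg ⊢
    refine ⟨fun p => ?_, ?_⟩
    · rw [Equiv.Perm.mul_apply, ← hσ₁ p]
      exact congrArg Prod.fst (congrFun hg (σ₀ p))
    · rw [← hσ₂]
      funext p
      exact congrArg Prod.snd (congrFun hg (σ₀ p))
  · intro σ hσ
    simp only [Finset.mem_filter, Finset.mem_univ, true_and] at hσ ⊢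
    have h3 : ∀ p, (σ₀⁻¹ p).2 = p.2 := fun p => by rw [← hσ₁ (σ₀⁻¹ p)]; simp
    funext p
    refine Prod.ext ?_ ?_
    · exact (hσ.1 _).trans (h3 p)
    · have h4 := congrFun (hσ.2.trans hσ₂.symm) (σ₀⁻¹ p)
      simpa using h4
  · intro g _
    simp
  · intro g _
    simp

/-- A polynomial of bidegree `(s, s)` is recovered from its polarization. -/
theorem toPoly_polar [Fintype m] {F : MvPolynomial (Fin 2 × m) ℝ}
    (hF : IsWeightedHomogeneous (rowWeight m) F (s, s)) :
    toPoly (polar s F) = rowPermCard s • F := by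
  classical
  ext β
  rw [toPoly, ct_apply, coeff_smul, coeff_sum]
  have h1 : ∀ J : Fin s × Fin 2 → m, coeff β (polar s F J • ∏ q, X (q.2, J q)) =
      if slotExponent J = β then multiFactorial β * coeff β F else 0 := by
    intro J
    have h2 : (∏ q, X (q.2, J q) : MvPolynomial (Fin 2 × m) ℝ) = slotMonomial J := rfl
    rw [h2, polar, slotMonomial_eq, fischer_monomial, coeff_smul, coeff_monomial]
    split_ifs with h
    · rw [h]; simp
    · simp
  simp only [h1]
  rw [← Finset.sum_filter, Finset.sum_const, nsmul_eq_mul, smul_eq_mul]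
  by_cases hc : coeff β F = 0
  · rw [hc]; simp
  · obtain ⟨J₀, rfl⟩ := exists_slotExponent_eq (hF hc)
    rw [← mul_assoc, card_slotExponent_eq]

end Counting

/-! ### The effect of column skewing on polynomials -/

section ColumnSkewing

variable {s : ℕ} {m : Type} [Fintype m]

/-- The generic covectors, with the rows exchanged in the columns in `A`. -/
noncomputable def flipVar (A : Finset (Fin s)) :
    Fin s × Fin 2 → m → MvPolynomial (Fin 2 × m) ℝ :=
  fun q B => X (if q.1 ∈ A then Equiv.swap 0 1 q.2 else q.2, B)

theorem toPoly_eq_flipVar (T : Tens (Fin s × Fin 2) m) : toPoly T = ct (flipVar ∅) T := by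
  refine congrArg (fun v => ct v T) ?_
  funext q B
  simp [flipVar]

/-- In the Garnir relation for column `k`, a term with `j ∈ A` exchanges two equal covectors and
changes nothing. A term with `j ∉ A` has the effect of flipping column `k`, up to a permutation
within row 0. Counting the two kinds gives the coefficients. -/
theorem ct_flipVar_insert {S : Tens (Fin s × Fin 2) m} (hS : RowSymmetric S)
    (hG : ∀ k : Fin s, S + ∑ j, permute (Equiv.swap (j, 0) (k, 1)) S = 0)
    {A : Finset (Fin s)} {k : Fin s} (hk : k ∉ A) :
    ((1 : ℝ) + A.card) • ct (flipVar A) S +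
      ((s : ℝ) - A.card) • ct (flipVar (insert k A)) S = 0 := by
  have h := congrArg (ct (flipVar A)) (hG k)
  rw [map_zero, map_add, map_sum] at h
  have h1 : ∀ j ∈ A, ct (flipVar A) (permute (Equiv.swap (j, 0) (k, 1)) S) =
      ct (flipVar A) S := by
    intro j hj
    have e : flipVar (m := m) A ∘ Equiv.swap (j, 0) (k, 1) = flipVar A := by
      funext q B
      simp only [Function.comp_apply, Equiv.swap_apply_def]
      split_ifs with h2 h3
      · simp [flipVar, h2, hj, hk]
      · simp [flipVar, h3, hj, hk]
      · rfl
    rw [ct_permute, e]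
  have h2 : ∀ j ∈ Aᶜ, ct (flipVar A) (permute (Equiv.swap (j, 0) (k, 1)) S) =
      ct (flipVar (insert k A)) S := by
    intro j hj
    rw [Finset.mem_compl] at hj
    have e : flipVar (m := m) A ∘ Equiv.swap (j, 0) (k, 1) =
        flipVar (insert k A) ∘ Equiv.swap (j, 0) (k, 0) := by
      funext ⟨a, i⟩ B
      simp only [Function.comp_apply, Equiv.swap_apply_def, Prod.mk.injEq]
      by_cases haj : a = j
      · subst haj
        by_cases hak : a = k
        · subst hak
          fin_cases i <;> simp [flipVar, hj]
        · fin_cases i <;> simp [flipVar, hj, hk, hak]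
      · by_cases hak : a = k
        · subst hak
          have : j ≠ a := fun e => haj e.symm
          fin_cases i <;> simp [flipVar, hj, hk, haj, this]
        · fin_cases i <;> simp [flipVar, hak, haj]
    have hrow := hS (Equiv.swap (j, 0) (k, 0)) (by
      intro p
      rw [Equiv.swap_apply_def]
      split_ifs with h2 h3
      · rw [h2]
      · rw [h3]
      · rfl)
    conv_rhs => rw [← hrow]
    rw [ct_permute, ct_permute, e]
  rw [← Finset.sum_add_sum_compl A, Finset.sum_congr rfl h1, Finset.sum_congr rfl h2,
    Finset.sum_const, Finset.sum_const, Finset.card_compl, Fintype.card_fin,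
    ← Nat.cast_smul_eq_nsmul ℝ, ← Nat.cast_smul_eq_nsmul ℝ,
    Nat.cast_sub (by simpa using Finset.card_le_univ A)] at h
  rw [← h, add_smul, one_smul, add_assoc]

/-- Each further flip multiplies by the negative number -(1 + |A|)/(s - |A|). This sign cancels the
sign of the column permutation, so the terms of `colSkew` add up without cancellation. -/
theorem exists_ct_flipVar {S : Tens (Fin s × Fin 2) m} (hS : RowSymmetric S)
    (hG : ∀ k : Fin s, S + ∑ j, permute (Equiv.swap (j, 0) (k, 1)) S = 0)
    (A : Finset (Fin s)) :
    ∃ c : ℝ, 0 < c ∧ ((-1 : ℝ) ^ A.card) • ct (flipVar A) S = c • toPoly S := by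
  induction A using Finset.induction_on with
  | empty => exact ⟨1, one_pos, by simp [toPoly_eq_flipVar]⟩
  | insert k A hk ih =>
    obtain ⟨c, hc, h⟩ := ih
    have h1 := ct_flipVar_insert hS hG hk
    have hlt : A.card < s := by
      have := Finset.card_lt_univ_of_notMem hk
      simpa using this
    have h2 : (0 : ℝ) < (s : ℝ) - A.card := by
      rw [sub_pos]
      exact_mod_cast hlt
    refine ⟨((s : ℝ) - A.card)⁻¹ * (1 + A.card) * c, by positivity, ?_⟩
    have h3 : ct (flipVar (insert k A)) S =
        -((((s : ℝ) - A.card)⁻¹ * (1 + A.card)) • ct (flipVar A) S) := by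
      have h4 : ((s : ℝ) - A.card) • ct (flipVar (insert k A)) S =
          -(((1 : ℝ) + A.card) • ct (flipVar A) S) := by
        rw [eq_neg_iff_add_eq_zero, add_comm, h1]
      rw [mul_smul, ← smul_neg, ← h4, smul_smul, inv_mul_cancel₀ h2.ne', one_smul]
    rw [Finset.card_insert_of_notMem hk, h3, pow_succ, mul_neg_one, neg_smul, smul_neg, neg_neg,
      smul_comm, h, smul_smul]

omit [Fintype m] in
theorem sign_of_fixes_columns {τ : Equiv.Perm (Fin s × Fin 2)} (hτ : ∀ p, (τ p).1 = p.1) :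
    ((Equiv.Perm.sign τ : ℤ) : ℝ) =
      (-1) ^ (Finset.univ.filter fun k : Fin s => (τ (k, 0)).2 = 1).card ∧
    flipVar (m := m) ∅ ∘ τ =
      flipVar (Finset.univ.filter fun k : Fin s => (τ (k, 0)).2 = 1) := by
  set A := Finset.univ.filter fun k : Fin s => (τ (k, 0)).2 = 1 with hA
  have hmem : ∀ k, k ∈ A ↔ (τ (k, 0)).2 = 1 := fun k => by simp [hA]
  -- A column-preserving permutation is the product of the swaps in the columns that it flips.
  have h1 : τ = Equiv.prodCongrRight fun k => if k ∈ A then Equiv.swap (0 : Fin 2) 1 else 1 := by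
    have hne : ∀ k, (τ (k, 0)).2 ≠ (τ (k, 1)).2 := by
      intro k h
      have h2 : τ (k, 0) = τ (k, 1) := Prod.ext (by rw [hτ, hτ]) h
      simpa using τ.injective h2
    ext ⟨k, i⟩ : 1
    refine Prod.ext (by simp [hτ, Equiv.prodCongrRight]) ?_
    have h2 := hne k
    by_cases hk : k ∈ A
    · have h3 := (hmem k).1 hk
      rw [h3] at h2
      fin_cases i
      · simp [Equiv.prodCongrRight, hk, h3]
      · simp [Equiv.prodCongrRight, hk]
        omega
    · have h3 : (τ (k, 0)).2 ≠ 1 := fun e => hk ((hmem k).2 e)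
      fin_cases i
      · simp [Equiv.prodCongrRight, hk]
        omega
      · simp [Equiv.prodCongrRight, hk]
        omega
  constructor
  · conv_lhs => rw [h1]
    rw [Equiv.Perm.sign_prodCongrRight]
    have h2 : ∀ k : Fin s, Equiv.Perm.sign (if k ∈ A then Equiv.swap (0 : Fin 2) 1 else 1) =
        if k ∈ A then -1 else 1 := by
      intro k
      split_ifs
      · exact Equiv.Perm.sign_swap (by decide)
      · simp
    simp only [h2]
    rw [Finset.prod_ite]
    simp
  · funext ⟨k, i⟩ B
    rw [Function.comp_apply]
    conv_lhs => rw [h1]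
    by_cases hk : k ∈ A <;> simp [flipVar, Equiv.prodCongrRight, hk]

/-- Skewing over the columns multiplies the polynomial by a positive constant. -/
theorem toPoly_colSkew {S : Tens (Fin s × Fin 2) m} (hS : RowSymmetric S)
    (hG : ∀ k : Fin s, S + ∑ j, permute (Equiv.swap (j, 0) (k, 1)) S = 0) :
    ∃ c : ℝ, 0 < c ∧ toPoly (colSkew S) = c • toPoly S := by
  choose c hc h using exists_ct_flipVar hS hG
  refine ⟨∑ τ : Equiv.Perm (Fin s × Fin 2) with (∀ p, (τ p).1 = p.1),
    c (Finset.univ.filter fun k : Fin s => (τ (k, 0)).2 = 1),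
    Finset.sum_pos (fun _ _ => hc _) ⟨1, by simp⟩, ?_⟩
  rw [toPoly_eq_flipVar, colSkew, LinearMap.sum_apply, map_sum, Finset.sum_smul]
  refine Finset.sum_congr rfl fun τ hτ => ?_
  simp only [Finset.mem_filter, Finset.mem_univ, true_and] at hτ
  obtain ⟨h1, h2⟩ := sign_of_fixes_columns (m := m) hτ
  rw [LinearMap.smul_apply, map_smul, ct_permute, h2, h1, h]

end ColumnSkewing

/-! ### Tableau symmetries and traces in terms of polynomials -/

section Realization

variable {s : ℕ} {m : Type} [Fintype m]

theorem isWeightedHomogeneous_toPoly (T : Tens (Fin s × Fin 2) m) :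
    IsWeightedHomogeneous (rowWeight m) (toPoly T) (s, s) := by
  rw [toPoly, ct_apply]
  refine IsWeightedHomogeneous.sum _ _ _ fun I _ => ?_
  have h : IsWeightedHomogeneous (rowWeight m)
      (∏ q : Fin s × Fin 2, (X (q.2, I q) : MvPolynomial (Fin 2 × m) ℝ))
      (∑ q : Fin s × Fin 2, rowWeight m (q.2, I q)) :=
    IsWeightedHomogeneous.prod _ _ _ fun q _ => isWeightedHomogeneous_X _ _ _
  have h2 : ∑ q : Fin s × Fin 2, rowWeight m (q.2, I q) = (s, s) := by
    rw [Fintype.sum_prod_type]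
    simp [rowWeight, Fin.sum_univ_two]
  rw [h2] at h
  rw [smul_eq_C_mul]
  exact h.C_mul _

/-- Replacing P by X in one column puts X into both slots of a skew pair. -/
theorem rowDer_toPoly {T : Tens (Fin s × Fin 2) m} (hT : IsCurvatureLike T) :
    rowDer 0 1 (toPoly T) = 0 := by
  rw [toPoly, ct_derivation]
  refine Finset.sum_eq_zero fun q _ => ?_
  obtain ⟨k, i⟩ := q
  fin_cases i
  · have h : (fun A => rowDer (m := m) 0 1 (X (((k, 0) : Fin s × Fin 2).2, A))) = 0 := by
      funext A
      simp [rowDer, mkDerivation_X]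
    exact (congrArg (fun v => ct (Function.update _ _ v) T) h).trans (ct_update_zero _ _ _)
  · refine hT.ct_eq_zero _ k ?_
    funext A
    simp [rowDer, mkDerivation_X]

/-- Every polynomial of bidegree `(s, s)` annihilated by `X · ∂ / ∂ P` comes from a tensor with the
symmetries of the tableau, which lies in the image of the Young symmetrizer. -/
theorem exists_isCurvatureLike {F : MvPolynomial (Fin 2 × m) ℝ}
    (hF : IsWeightedHomogeneous (rowWeight m) F (s, s)) (he : rowDer 0 1 F = 0) :
    ∃ c : ℝ, IsCurvatureLike (c • youngSymmetrizer s m (polar s F)) ∧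
      toPoly (c • youngSymmetrizer s m (polar s F)) = F := by
  have hS := rowSymmetric_polar (s := s) F
  obtain ⟨c, hc, h⟩ := toPoly_colSkew hS (polar_garnir he)
  have hr := rowPermCard_ne_zero s
  have h1 := isCurvatureLike_colSkew hS
  have hy : youngSymmetrizer s m (polar s F) = rowPermCard s • colSkew (polar s F) := by
    rw [youngSymmetrizer_apply, hS.rowSym_eq, map_smul]
    rfl
  -- The factor c⁻¹ undoes the column skewing, one inverse of `rowPermCard s` undoes the row
  -- symmetrisation, and the other normalises the polarisation.
  refine ⟨(rowPermCard s)⁻¹ * (c⁻¹ * (rowPermCard s)⁻¹), ⟨fun k => ?_, fun S hS' => ?_⟩, ?_⟩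
  · rw [hy, map_smul, map_smul, h1.skew, smul_neg, smul_neg]
  · rw [hy, map_smul, map_smul, h1.bianchi S hS', smul_zero, smul_zero]
  · rw [hy, toPoly, map_smul, map_smul, ← toPoly, h, toPoly_polar hF, smul_smul, smul_smul,
      smul_smul]
    convert one_smul ℝ F
    field_simp

omit [Fintype m] in
theorem IsCurvatureLike.sub {T U : Tens (Fin s × Fin 2) m} (hT : IsCurvatureLike T)
    (hU : IsCurvatureLike U) : IsCurvatureLike (T - U) where
  skew k := by rw [map_sub, hT.skew, hU.skew]; abel
  bianchi S hS := by rw [map_sub, hT.bianchi S hS, hU.bianchi S hS, sub_zero]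

/-- Tensors with the symmetries of the tableau are in the image of the Young symmetrizer. -/
theorem IsCurvatureLike.mem_range {T : Tens (Fin s × Fin 2) m} (hT : IsCurvatureLike T) :
    T ∈ LinearMap.range (youngSymmetrizer s m) := by
  obtain ⟨c, h1, h2⟩ := exists_isCurvatureLike (isWeightedHomogeneous_toPoly T) (rowDer_toPoly hT)
  have h3 := (hT.sub h1).eq_zero_of_toPoly (by
    rw [toPoly, map_sub]
    exact sub_eq_zero.2 h2.symm)
  rw [sub_eq_zero.1 h3]
  exact Submodule.smul_mem _ _ ⟨_, rfl⟩

theorem mem_range_youngSymmetrizer_iff {T : Tens (Fin s × Fin 2) m} :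
    T ∈ LinearMap.range (youngSymmetrizer s m) ↔ IsCurvatureLike T := by
  refine ⟨?_, IsCurvatureLike.mem_range⟩
  rintro ⟨U, rfl⟩
  exact isCurvatureLike_colSkew (rowSymmetric_rowSym U)

theorem mem_ambientKilling {n s : ℕ} {T : AmbTensor n s} :
    T ∈ ambientKilling n s ↔
      IsCurvatureLike T ∧ T ∈ traceFree (Fin s × Fin 2) (ambientMetric n) :=
  ⟨fun h => ⟨⟨h.1, h.2.2⟩, h.2.1⟩, fun h => ⟨h.1.skew, h.2, h.1.bianchi⟩⟩

theorem ambientKilling_eq_traceFreeTableau (n s : ℕ) :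
    (ambientKilling n s : Submodule ℝ (AmbTensor n s)) = traceFreeTableau n s := by
  ext T
  rw [LieSubmodule.mem_toSubmodule, mem_ambientKilling, traceFreeTableau, Submodule.mem_inf,
    mem_range_youngSymmetrizer_iff]

/-- Harmonic polynomials of bidegree `(s, s)` annihilated by `X · ∂ / ∂ P` come from trace-free
tensors. -/
theorem exists_mem_ambientKilling {n s : ℕ} {F : MvPolynomial (Fin 2 × AmbIndex n) ℝ}
    (hF : IsWeightedHomogeneous (rowWeight (AmbIndex n)) F (s, s)) (he : rowDer 0 1 F = 0)
    (hL : ∀ r r', laplace (ambientMetric n) r r' F = 0) :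
    ∃ T ∈ ambientKilling n s, toPoly T = F := by
  obtain ⟨c, h1, h2⟩ := exists_isCurvatureLike hF he
  refine ⟨_, mem_ambientKilling.2 ⟨h1, ?_⟩, h2⟩
  refine Submodule.smul_mem _ _ ?_
  rw [youngSymmetrizer_apply, (rowSymmetric_polar F).rowSym_eq, map_smul]
  exact Submodule.smul_mem _ _ (contract_colSkew _ (contract_polar _ hL))

/-- The polynomials of trace-free tensors are harmonic. -/
theorem laplace_toPoly [DecidableEq m] (g : Matrix m m ℝ) {T : Tens (Fin s × Fin 2) m}
    (hT : T ∈ traceFree (Fin s × Fin 2) g) (r r' : Fin 2) : laplace g r r' (toPoly T) = 0 := by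
  simp only [traceFree, Submodule.mem_iInf, LinearMap.mem_ker] at hT
  have h1 : ∀ (r : Fin 2) (A : m) (q : Fin s × Fin 2),
      (fun B => pderiv (r, A) (X (q.2, B) : MvPolynomial (Fin 2 × m) ℝ)) =
        if q.2 = r then Pi.single A 1 else 0 := by
    intro r A q
    funext B
    rw [pderiv_X]
    by_cases hq : q.2 = r
    · by_cases hB : B = A
      · simp [hq, hB]
      · have : (q.2, B) ≠ (r, A) := by simp [hB]
        simp [hq, hB]
    · have : (q.2, B) ≠ (r, A) := by simp [hq]
      simp [hq]
  -- A second derivative selects an ordered pair of distinct slots in the rows `r'` and `r`;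
  -- contracted with the metric, each pair is a trace of `T`.
  have h2 : ∀ A B, pderiv (r, A) (pderiv (r', B) (toPoly T)) =
      ∑ q : Fin s × Fin 2, ∑ p : Fin s × Fin 2, if q.2 = r' ∧ p.2 = r ∧ p ≠ q then
        ct (Function.update (Function.update (fun q B => (X (q.2, B) : MvPolynomial (Fin 2 × m) ℝ))
          p (Pi.single A 1)) q (Pi.single B 1)) T else 0 := by
    intro A B
    rw [toPoly, ct_derivation, map_sum]
    refine Finset.sum_congr rfl fun q _ => ?_
    rw [h1, ct_derivation]
    refine Finset.sum_congr rfl fun p _ => ?_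
    by_cases hq : q.2 = r'
    · rw [if_pos hq]
      rcases eq_or_ne p q with rfl | hpq
      · have : (fun C => pderiv (r, A) (Function.update
            (fun q B => (X (q.2, B) : MvPolynomial (Fin 2 × m) ℝ)) p (Pi.single B 1) p C)) = 0 := by
          funext C
          rw [Function.update_self]
          by_cases hC : C = B
          · subst hC; simp
          · simp [hC]
        rw [this, ct_update_zero]
        simp
      · rw [Function.update_of_ne hpq, h1, Function.update_comm hpq.symm]
        by_cases hp : p.2 = r
        · rw [if_pos hp, if_pos ⟨hq, hp, hpq⟩]
        · rw [if_neg hp, if_neg (by tauto), Function.update_comm hpq, ct_update_zero]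
    · rw [if_neg hq, if_neg (by tauto)]
      rcases eq_or_ne p q with rfl | hpq
      · rw [Function.update_self, Function.update_idem]
        have : (fun C => pderiv (r, A) ((0 : m → MvPolynomial (Fin 2 × m) ℝ) C)) = 0 := by
          funext C; simp
        rw [this, ct_update_zero]
      · rw [Function.update_comm hpq.symm, ct_update_zero]
  simp only [laplace, h2, Finset.smul_sum]
  rw [Finset.sum_comm_cycle]
  refine Finset.sum_eq_zero fun q _ => ?_
  rw [Finset.sum_comm_cycle]
  refine Finset.sum_eq_zero fun p _ => ?_
  by_cases h : q.2 = r' ∧ p.2 = r ∧ p ≠ q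
  · simp only [if_pos h]
    exact ct_contract _ g h.2.2 (hT p q h.2.2)
  · simp [if_neg h]

end Realization

/-! ### Syzygies of the invariants of two vectors -/

section Syzygies

variable {σ : Type}

/-- The polynomials in which the variable `τ` does not occur. -/
noncomputable abbrev freeOf (τ : σ) : Subalgebra ℝ (MvPolynomial σ ℝ) := supported ℝ {τ}ᶜ

theorem X_mem_freeOf {τ i : σ} (h : i ≠ τ) : (X i : MvPolynomial σ ℝ) ∈ freeOf τ :=
  X_mem_supported.2 h

theorem C_mem_freeOf {τ : σ} (c : ℝ) : (C c : MvPolynomial σ ℝ) ∈ freeOf τ :=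
  (freeOf τ).algebraMap_mem c

theorem degreeOf_eq_zero_of_mem_freeOf {τ : σ} {f : MvPolynomial σ ℝ} (h : f ∈ freeOf τ) :
    degreeOf τ f = 0 := by
  classical
  rw [mem_supported] at h
  refine Nat.le_zero.1 (degreeOf_le_iff.2 fun α hα => ?_)
  by_contra hc
  have : τ ∈ f.vars := (mem_vars_iff_mem_support _).2 ⟨α, hα, Finsupp.mem_support_iff.2 (by omega)⟩
  exact h this rfl

/-- Division by a monic quadratic polynomial in the variable `τ`. -/
theorem exists_quadratic_remainder {τ : σ} {r : MvPolynomial σ ℝ} (hr : r ∈ freeOf τ)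
    (f : MvPolynomial σ ℝ) :
    ∃ k, ∃ f₀ ∈ freeOf τ, ∃ f₁ ∈ freeOf τ, f = (X τ ^ 2 + r) * k + f₁ * X τ + f₀ := by
  induction f using MvPolynomial.induction_on with
  | C a => exact ⟨0, C a, C_mem_freeOf a, 0, zero_mem _, by ring⟩
  | add f g hf hg =>
    obtain ⟨k, f₀, h0, f₁, h1, rfl⟩ := hf
    obtain ⟨l, g₀, h0', g₁, h1', rfl⟩ := hg
    exact ⟨k + l, f₀ + g₀, add_mem h0 h0', f₁ + g₁, add_mem h1 h1', by ring⟩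
  | mul_X f i hf =>
    obtain ⟨k, f₀, h0, f₁, h1, hf⟩ := hf
    by_cases hi : i = τ
    · subst hi
      exact ⟨k * X i + f₁, -(r * f₁), neg_mem (mul_mem hr h1), f₀, h0, by
        conv_lhs => rw [hf]
        ring⟩
    · exact ⟨k * X i, f₀ * X i, mul_mem h0 (X_mem_freeOf hi), f₁ * X i,
        mul_mem h1 (X_mem_freeOf hi), by
        conv_lhs => rw [hf]
        ring⟩

/-- Modulo the monic quadratic, `f` has a remainder of degree at most one in `τ`. Multiplying by
`g`, which is free of `τ`, does not raise that degree, so divisibility forces the remainder to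
vanish. -/
theorem quadratic_dvd_of_dvd_mul {τ : σ} {r g f : MvPolynomial σ ℝ} (hr : r ∈ freeOf τ)
    (hg : g ∈ freeOf τ) (hg0 : g ≠ 0) (h : X τ ^ 2 + r ∣ g * f) : X τ ^ 2 + r ∣ f := by
  classical
  obtain ⟨k, f₀, h0, f₁, h1, hf⟩ := exists_quadratic_remainder hr f
  have h2 : X τ ^ 2 + r ∣ g * (f₁ * X τ + f₀) := by
    have : g * (f₁ * X τ + f₀) = g * f - (X τ ^ 2 + r) * (g * k) := by
      conv_rhs => rw [hf]
      ring
    rw [this]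
    exact dvd_sub h (dvd_mul_right _ _)
  obtain ⟨l, hl⟩ := h2
  have hD : 2 ≤ degreeOf τ (X τ ^ 2 + r) := by
    by_contra hc
    have h3 : degreeOf τ (X τ ^ 2 : MvPolynomial σ ℝ) ≤ 1 := by
      have : (X τ ^ 2 : MvPolynomial σ ℝ) = (X τ ^ 2 + r) + (-r) := by ring
      rw [this]
      refine (degreeOf_add_le _ _ _).trans (max_le (by omega) ?_)
      rw [degreeOf_eq_zero_of_mem_freeOf (neg_mem hr)]
      exact Nat.zero_le _
    rw [X_pow_eq_monomial, degreeOf_monomial_eq _ _ one_ne_zero] at h3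
    simp at h3
  have hl0 : l = 0 := by
    by_contra hne
    have hD0 : (X τ ^ 2 + r) ≠ 0 := by
      intro e
      rw [e] at hD
      simp at hD
    have h3 := congrArg (degreeOf τ) hl
    rw [degreeOf_mul_eq hD0 hne] at h3
    have h4 : degreeOf τ (g * (f₁ * X τ + f₀)) ≤ 1 := by
      refine (degreeOf_mul_le _ _ _).trans ?_
      rw [degreeOf_eq_zero_of_mem_freeOf hg, zero_add]
      refine (degreeOf_add_le _ _ _).trans (max_le ?_ ?_)
      · refine (degreeOf_mul_le _ _ _).trans ?_
        rw [degreeOf_eq_zero_of_mem_freeOf h1, degreeOf_X]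
        simp
      · rw [degreeOf_eq_zero_of_mem_freeOf h0]
        exact Nat.zero_le _
    omega
  rw [hl0, mul_zero] at hl
  have h5 := (mul_eq_zero.1 hl).resolve_left hg0
  refine ⟨k, ?_⟩
  rw [hf, add_assoc, h5, add_zero]

theorem eq_zero_of_linear_dvd {τ : σ} {l r f : MvPolynomial σ ℝ} (hl0 : l ≠ 0)
    (hr : r ∈ freeOf τ) (hf : f ∈ freeOf τ) (h : l * X τ + r ∣ f) : f = 0 := by
  classical
  obtain ⟨k, hk⟩ := h
  by_contra hne
  have hD : 1 ≤ degreeOf τ (l * X τ + r) := by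
    by_contra hc
    have h3 : degreeOf τ (l * X τ) ≤ 0 := by
      have : l * X τ = (l * X τ + r) + (-r) := by ring
      rw [this]
      refine (degreeOf_add_le _ _ _).trans (max_le (by omega) ?_)
      rw [degreeOf_eq_zero_of_mem_freeOf (neg_mem hr)]
    rw [degreeOf_mul_eq hl0 (X_ne_zero τ), degreeOf_X] at h3
    simp at h3
  have hD0 : l * X τ + r ≠ 0 := fun e => hne (by rw [hk, e, zero_mul])
  have hk0 : k ≠ 0 := fun e => hne (by rw [hk, e, mul_zero])
  have h3 := congrArg (degreeOf τ) hk
  rw [degreeOf_mul_eq hD0 hk0, degreeOf_eq_zero_of_mem_freeOf hf] at h3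
  omega

/-- Setting the variable `τ` to zero. -/
noncomputable def killVar [DecidableEq σ] (τ : σ) : MvPolynomial σ ℝ →ₐ[ℝ] MvPolynomial σ ℝ :=
  aeval fun i => if i = τ then 0 else X i

theorem X_dvd_sub_killVar [DecidableEq σ] (τ : σ) (f : MvPolynomial σ ℝ) :
    X τ ∣ f - killVar τ f := by
  induction f using MvPolynomial.induction_on with
  | C a => simp [killVar]
  | add f g hf hg =>
    rw [map_add, add_sub_add_comm]
    exact dvd_add hf hg
  | mul_X f i hf =>
    by_cases hi : i = τ
    · subst hi
      simp [killVar]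
    · have : killVar τ (X i) = X i := by simp [killVar, hi]
      rw [map_mul, this, ← sub_mul]
      exact Dvd.dvd.mul_right hf _

theorem killVar_of_mem_freeOf [DecidableEq σ] {τ : σ} {f : MvPolynomial σ ℝ} (hf : f ∈ freeOf τ) :
    killVar τ f = f := by
  have h : (freeOf τ : Subalgebra ℝ _) ≤ AlgHom.equalizer (killVar τ) (AlgHom.id ℝ _) := by
    rw [freeOf, supported_eq_adjoin_X, Algebra.adjoin_le_iff]
    rintro _ ⟨i, hi, rfl⟩
    have : i ≠ τ := hi
    simp [killVar, this]
  exact h hf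

variable {κ : Type} [DecidableEq κ] {x p : κ → σ}

/-- The invariant `∑ x_b y_b`. -/
noncomputable def dot (x y : κ → σ) (t : Finset κ) : MvPolynomial σ ℝ := ∑ b ∈ t, X (x b) * X (y b)

omit [DecidableEq κ] in
theorem dot_mem_freeOf {x y : κ → σ} {t : Finset κ} {τ : σ} (hx : ∀ b ∈ t, x b ≠ τ)
    (hy : ∀ b ∈ t, y b ≠ τ) : dot x y t ∈ freeOf τ :=
  sum_mem fun b hb => mul_mem (X_mem_freeOf (hx b hb)) (X_mem_freeOf (hy b hb))

theorem dot_insert {x y : κ → σ} {t : Finset κ} {b : κ} (hb : b ∈ t) :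
    dot x y t = X (x b) * X (y b) + dot x y (t.erase b) := by
  rw [dot, dot, Finset.add_sum_erase _ (fun b => X (x b) * X (y b)) hb]

/-- In two or more dimensions x·p is a nonzerodivisor modulo x·x. The proof takes a norm:
multiplying x·p = x_b p_b + μ by μ - x_b p_b and using x_b² ≡ -ρ gives μ² + ρ p_b², which is free of
x_b. -/
theorem dvd_of_dvd_dot_mul (hx : Function.Injective x) (hp : Function.Injective p)
    (hxp : ∀ i j, x i ≠ p j) {t : Finset κ} (ht : 2 ≤ t.card) {a : MvPolynomial σ ℝ}
    (h : dot x x t ∣ dot x p t * a) : dot x x t ∣ a := by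
  classical
  obtain ⟨b, hb⟩ : t.Nonempty := Finset.card_pos.1 (by omega)
  obtain ⟨c, hc⟩ : (t.erase b).Nonempty := Finset.card_pos.1 (by
    rw [Finset.card_erase_of_mem hb]; omega)
  have hcb : c ≠ b := Finset.ne_of_mem_erase hc
  set ρ := dot x x (t.erase b) with hρ
  set μ := dot x p (t.erase b) with hμ
  have hxb : ∀ i ∈ t.erase b, x i ≠ x b := fun i hi e => Finset.ne_of_mem_erase hi (hx e)
  have hρf : ρ ∈ freeOf (x b) := dot_mem_freeOf hxb hxb
  have hμf : μ ∈ freeOf (x b) := dot_mem_freeOf hxb fun i _ => (hxp b i).symm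
  have hq1 : dot x x t = X (x b) ^ 2 + ρ := by rw [dot_insert hb, pow_two]
  have hq2 : dot x p t = X (x b) * X (p b) + μ := dot_insert hb
  rw [hq1] at h ⊢
  rw [hq2] at h
  refine quadratic_dvd_of_dvd_mul (g := μ ^ 2 + ρ * X (p b) ^ 2) hρf ?_ ?_ ?_
  · exact add_mem (pow_mem hμf 2) (mul_mem hρf (pow_mem (X_mem_freeOf (hxp b b).symm) 2))
  · intro e
    -- At p_b = x_c = 1 and all other variables zero, μ vanishes and ρ is 1, so the norm is 1.
    have h1 := congrArg (eval fun i => if i = p b ∨ i = x c then (1 : ℝ) else 0) e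
    have e1 : ∀ i ∈ t.erase b, ¬ p i = p b := fun i hi e => Finset.ne_of_mem_erase hi (hp e)
    have e2 : eval (fun i => if i = p b ∨ i = x c then (1 : ℝ) else 0) μ = 0 := by
      rw [hμ, dot, map_sum]
      refine Finset.sum_eq_zero fun i hi => ?_
      simp [e1 i hi, (hxp c i).symm]
    have e3 : eval (fun i => if i = p b ∨ i = x c then (1 : ℝ) else 0) ρ = 1 := by
      rw [hρ, dot, map_sum, Finset.sum_eq_single c]
      · simp
      · intro i _ hic
        simp [hxp, hx.eq_iff, hic]
      · exact fun h => absurd hc h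
    rw [map_add, map_mul, map_pow, map_pow, e2, e3] at h1
    simp at h1
  · have h2 : (μ ^ 2 + ρ * X (p b) ^ 2) * a = (μ - X (x b) * X (p b)) *
        ((X (x b) * X (p b) + μ) * a) + (X (x b) ^ 2 + ρ) * (X (p b) ^ 2 * a) := by ring
    rw [h2]
    exact dvd_add (Dvd.dvd.mul_left h _) (dvd_mul_right _ _)

/-- Setting x_b = 0 leaves a syzygy of the two quadrics in one dimension less, which is Koszul by
`dvd_of_dvd_dot_mul`. Once it is subtracted, all coefficients are divisible by x_b. -/
theorem X_mul_mem_span_pair (hx : Function.Injective x) (hp : Function.Injective p)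
    (hxp : ∀ i j, x i ≠ p j) {t : Finset κ} (ht : 3 ≤ t.card) {b : κ} (hb : b ∈ t)
    {f : MvPolynomial σ ℝ} (h : X (x b) * f ∈ Ideal.span {dot x x t, dot x p t}) :
    f ∈ Ideal.span {dot x x t, dot x p t} := by
  classical
  rw [Ideal.mem_span_pair] at h ⊢
  obtain ⟨α, β, h⟩ := h
  set ρ := dot x x (t.erase b) with hρ
  set μ := dot x p (t.erase b) with hμ
  have hxb : ∀ i ∈ t.erase b, x i ≠ x b := fun i hi e => Finset.ne_of_mem_erase hi (hx e)
  have hρf : ρ ∈ freeOf (x b) := dot_mem_freeOf hxb hxb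
  have hμf : μ ∈ freeOf (x b) := dot_mem_freeOf hxb fun i _ => (hxp b i).symm
  have hq1 : dot x x t = X (x b) ^ 2 + ρ := by rw [dot_insert hb, pow_two]
  have hq2 : dot x p t = X (x b) * X (p b) + μ := dot_insert hb
  rw [hq1, hq2] at h
  have hX : killVar (x b) (X (x b)) = 0 := by simp [killVar]
  have h1 := congrArg (killVar (x b)) h
  simp only [map_add, map_mul, map_pow, hX, killVar_of_mem_freeOf hρf,
    killVar_of_mem_freeOf hμf] at h1
  have h2 : ρ ∣ μ * killVar (x b) β := ⟨-killVar (x b) α, by linear_combination h1⟩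
  have ht' : 2 ≤ (t.erase b).card := by rw [Finset.card_erase_of_mem hb]; omega
  obtain ⟨γ, hγ⟩ := dvd_of_dvd_dot_mul hx hp hxp ht' h2
  have hρ0 : ρ ≠ 0 := by
    intro e
    obtain ⟨c, hc⟩ : (t.erase b).Nonempty := Finset.card_pos.1 (by omega)
    have h3 := congrArg (eval fun i => if i = x c then (1 : ℝ) else 0) e
    rw [hρ, dot, map_sum, Finset.sum_eq_single c] at h3
    · simp at h3
    · intro i _ hic
      simp [hx.eq_iff, hic]
    · exact fun h => absurd hc h
  have hα : killVar (x b) α = -γ * μ := by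
    refine mul_left_cancel₀ hρ0 ?_
    rw [← hρ] at hγ
    rw [hγ] at h1
    linear_combination h1
  obtain ⟨α₁, hα₁⟩ := X_dvd_sub_killVar (x b) α
  obtain ⟨β₁, hβ₁⟩ := X_dvd_sub_killVar (x b) β
  -- The terms in γ lift the Koszul syzygy: γ(ρ x·p - μ x·x) equals x_b times γ(p_b x·x - x_b x·p).
  refine ⟨γ * X (p b) + α₁, -(γ * X (x b)) + β₁, ?_⟩
  refine mul_left_cancel₀ (X_ne_zero (x b)) ?_
  rw [hα] at hα₁
  rw [hγ, ← hρ] at hβ₁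
  rw [← h, hq1, hq2]
  linear_combination (-(X (x b) ^ 2 + ρ)) * hα₁ - (X (x b) * X (p b) + μ) * hβ₁

/-- Elimination of the variable π after inverting τ: modulo the relation, τπ may be replaced by -m.
-/
theorem exists_X_pow_mul_sub_mem {τ π : σ} {m : MvPolynomial σ ℝ} (hτ : τ ≠ π)
    (hm : m ∈ freeOf π) (f : MvPolynomial σ ℝ) :
    ∃ k : ℕ, ∃ g ∈ freeOf π, X τ * X π + m ∣ X τ ^ k * f - g := by
  induction f using MvPolynomial.induction_on with
  | C a => exact ⟨0, C a, C_mem_freeOf a, by simp⟩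
  | add f f' hf hf' =>
    obtain ⟨k, g, hg, u, hu⟩ := hf
    obtain ⟨k', g', hg', u', hu'⟩ := hf'
    have hX : (X τ : MvPolynomial σ ℝ) ∈ freeOf π := X_mem_freeOf hτ
    refine ⟨k + k', X τ ^ k' * g + X τ ^ k * g', add_mem (mul_mem (pow_mem hX _) hg)
      (mul_mem (pow_mem hX _) hg'), X τ ^ k' * u + X τ ^ k * u', ?_⟩
    rw [pow_add]
    linear_combination X τ ^ k' * hu + X τ ^ k * hu'
  | mul_X f i hf =>
    obtain ⟨k, g, hg, u, hu⟩ := hf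
    by_cases hi : i = π
    · subst hi
      refine ⟨k + 1, -(m * g), neg_mem (mul_mem hm hg), X τ ^ k * f - m * u, ?_⟩
      rw [pow_succ]
      linear_combination -m * hu
    · refine ⟨k, g * X i, mul_mem hg (X_mem_freeOf hi), u * X i, ?_⟩
      linear_combination X i * hu

/-- The last of the three quadrics is a nonzerodivisor modulo the other two. Modulo the ideal, x_b²
p·p ≡ N = μ² - ρη, a nonzero polynomial free of x_b and p_b. After inverting x_b, the variable p_b
can be eliminated and N cancelled against the monic quadratic x·x. The powers of x_b are then
removed by `X_mul_mem_span_pair`. -/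
theorem mem_span_pair_of_dot_mul_mem (hx : Function.Injective x) (hp : Function.Injective p)
    (hxp : ∀ i j, x i ≠ p j) {t : Finset κ} (ht : 3 ≤ t.card) {c : MvPolynomial σ ℝ}
    (h : dot p p t * c ∈ Ideal.span {dot x x t, dot x p t}) :
    c ∈ Ideal.span {dot x x t, dot x p t} := by
  classical
  obtain ⟨b, hb⟩ : t.Nonempty := Finset.card_pos.1 (by omega)
  obtain ⟨b₁, hb₁⟩ : (t.erase b).Nonempty := Finset.card_pos.1 (by
    rw [Finset.card_erase_of_mem hb]; omega)
  obtain ⟨b₂, hb₂⟩ : ((t.erase b).erase b₁).Nonempty := Finset.card_pos.1 (by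
    rw [Finset.card_erase_of_mem hb₁, Finset.card_erase_of_mem hb]; omega)
  have hb₂₁ : b₂ ≠ b₁ := Finset.ne_of_mem_erase hb₂
  have hb₂' : b₂ ∈ t.erase b := Finset.mem_of_mem_erase hb₂
  set I := Ideal.span {dot x x t, dot x p t} with hI
  have hq1I : dot x x t ∈ I := Ideal.subset_span (by simp)
  have hq2I : dot x p t ∈ I := Ideal.subset_span (by simp)
  set ρ := dot x x (t.erase b) with hρ
  set μ := dot x p (t.erase b) with hμ
  set η := dot p p (t.erase b) with hη
  have hxb : ∀ i ∈ t.erase b, x i ≠ x b := fun i hi e => Finset.ne_of_mem_erase hi (hx e)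
  have hpb : ∀ i ∈ t.erase b, p i ≠ p b := fun i hi e => Finset.ne_of_mem_erase hi (hp e)
  have hρτ : ρ ∈ freeOf (x b) := dot_mem_freeOf hxb hxb
  have hμτ : μ ∈ freeOf (x b) := dot_mem_freeOf hxb fun i _ => (hxp b i).symm
  have hητ : η ∈ freeOf (x b) :=
    dot_mem_freeOf (fun i _ => (hxp b i).symm) fun i _ => (hxp b i).symm
  have hρπ : ρ ∈ freeOf (p b) := dot_mem_freeOf (fun i _ => hxp i b) fun i _ => hxp i b
  have hμπ : μ ∈ freeOf (p b) := dot_mem_freeOf (fun i _ => hxp i b) hpb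
  have hηπ : η ∈ freeOf (p b) := dot_mem_freeOf hpb hpb
  have hq1 : dot x x t = X (x b) ^ 2 + ρ := by rw [dot_insert hb, pow_two]
  have hq2 : dot x p t = X (x b) * X (p b) + μ := dot_insert hb
  have hq3 : dot p p t = X (p b) ^ 2 + η := by rw [dot_insert hb, pow_two]
  set N := μ ^ 2 - ρ * η with hN
  have hNτ : N ∈ freeOf (x b) := sub_mem (pow_mem hμτ 2) (mul_mem hρτ hητ)
  have hNπ : N ∈ freeOf (p b) := sub_mem (pow_mem hμπ 2) (mul_mem hρπ hηπ)
  have hN0 : N ≠ 0 := by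
    intro e
    have h1 := congrArg (eval fun i => if i = x b₁ ∨ i = p b₂ then (1 : ℝ) else 0) e
    have e1 : eval (fun i => if i = x b₁ ∨ i = p b₂ then (1 : ℝ) else 0) μ = 0 := by
      rw [hμ, dot, map_sum]
      refine Finset.sum_eq_zero fun i hi => ?_
      by_cases hi1 : i = b₁
      · subst hi1
        simp [hp.eq_iff, hb₂₁.symm, (hxp i _).symm]
      · simp [hx.eq_iff, hi1, hxp]
    have e2 : eval (fun i => if i = x b₁ ∨ i = p b₂ then (1 : ℝ) else 0) ρ = 1 := by
      rw [hρ, dot, map_sum, Finset.sum_eq_single b₁]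
      · simp
      · intro i _ hic
        simp [hxp, hx.eq_iff, hic]
      · exact fun h => absurd hb₁ h
    have e3 : eval (fun i => if i = x b₁ ∨ i = p b₂ then (1 : ℝ) else 0) η = 1 := by
      rw [hη, dot, map_sum, Finset.sum_eq_single b₂]
      · simp
      · intro i _ hic
        simp [(hxp _ _).symm, hp.eq_iff, hic]
      · exact fun h => absurd hb₂' h
    rw [hN, map_sub, map_mul, map_pow, e1, e2, e3] at h1
    simp at h1
  have hNc : N * c ∈ I := by
    have : N * c = X (x b) ^ 2 * (dot p p t * c) - (X (p b) ^ 2 * X (x b) ^ 2 - μ ^ 2 + η *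
        (X (x b) ^ 2 + ρ)) * c := by rw [hN, hq3]; ring
    rw [this]
    refine I.sub_mem (I.mul_mem_left _ h) (I.mul_mem_right _ ?_)
    have : X (p b) ^ 2 * X (x b) ^ 2 - μ ^ 2 + η * (X (x b) ^ 2 + ρ) =
        (X (x b) * X (p b) - μ) * dot x p t + η * dot x x t := by rw [hq1, hq2]; ring
    rw [this]
    exact I.add_mem (I.mul_mem_left _ hq2I) (I.mul_mem_left _ hq1I)
  have hτπ : x b ≠ p b := hxp b b
  have hXπ : (X (x b) : MvPolynomial σ ℝ) ∈ freeOf (p b) := X_mem_freeOf hτπ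
  obtain ⟨k, c', hc', u, hu⟩ := exists_X_pow_mul_sub_mem hτπ hμπ c
  rw [← hq2] at hu
  have hNc' : N * c' ∈ I := by
    have : N * c' = X (x b) ^ k * (N * c) - N * u * dot x p t := by linear_combination -N * hu
    rw [this]
    exact I.sub_mem (I.mul_mem_left _ hNc) (I.mul_mem_left _ hq2I)
  obtain ⟨α, β, hαβ⟩ := Ideal.mem_span_pair.1 hNc'
  obtain ⟨l, α', hα', v, hv⟩ := exists_X_pow_mul_sub_mem hτπ hμπ α
  rw [← hq2] at hv
  -- The left side is free of p_b but divisible by x·p, which has degree one in p_b.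
  have hz : X (x b) ^ l * (N * c') - α' * dot x x t = 0 := by
    refine eq_zero_of_linear_dvd (X_ne_zero (x b)) hμπ (sub_mem (mul_mem (pow_mem hXπ _)
      (mul_mem hNπ hc')) (mul_mem hα' ?_)) ⟨v * dot x x t + X (x b) ^ l * β, ?_⟩
    · rw [hq1]
      exact add_mem (pow_mem hXπ 2) hρπ
    · rw [← hq2, ← hαβ]
      linear_combination dot x x t * hv
  have hd : dot x x t ∣ X (x b) ^ l * c' := by
    rw [hq1] at hz ⊢
    exact quadratic_dvd_of_dvd_mul hρτ hNτ hN0 ⟨α', by linear_combination hz⟩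
  have hmem : X (x b) ^ (l + k) * c ∈ I := by
    have : X (x b) ^ (l + k) * c = X (x b) ^ l * c' + X (x b) ^ l * u * dot x p t := by
      rw [pow_add]
      linear_combination X (x b) ^ l * hu
    rw [this]
    exact I.add_mem (I.mem_of_dvd hd hq1I) (I.mul_mem_left _ hq2I)
  generalize l + k = j at hmem
  induction j with
  | zero => simpa using hmem
  | succ j ih =>
    rw [pow_succ', mul_assoc] at hmem
    exact ih (X_mul_mem_span_pair hx hp hxp ht hb hmem)

omit [DecidableEq κ] in
theorem dot_self_ne_zero (hx : Function.Injective x) {t : Finset κ} (ht : t.Nonempty) :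
    dot x x t ≠ 0 := by
  classical
  intro e
  obtain ⟨c, hc⟩ := ht
  have h3 := congrArg (eval fun i => if i = x c then (1 : ℝ) else 0) e
  rw [dot, map_sum, Finset.sum_eq_single c] at h3
  · simp at h3
  · intro i _ hic
    simp [hx.eq_iff, hic]
  · exact fun h => absurd hc h

/-- The syzygies of the three invariants of two vectors in at least three dimensions are the
Koszul ones. -/
theorem koszul_of_syzygy (hx : Function.Injective x) (hp : Function.Injective p)
    (hxp : ∀ i j, x i ≠ p j) {t : Finset κ} (ht : 3 ≤ t.card) {a b c : MvPolynomial σ ℝ}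
    (h : a * dot x x t + b * dot x p t + c * dot p p t = 0) :
    ∃ u v w, a = u * dot x p t + v * dot p p t ∧ b = -(u * dot x x t) + w * dot p p t ∧
      c = -(v * dot x x t) - w * dot x p t := by
  have hc : c ∈ Ideal.span {dot x x t, dot x p t} := by
    refine mem_span_pair_of_dot_mul_mem hx hp hxp ht (Ideal.mem_span_pair.2 ⟨-a, -b, ?_⟩)
    linear_combination -h
  obtain ⟨v, w, hc⟩ := Ideal.mem_span_pair.1 hc
  -- With `c` written through the first two quadrics, what remains is a syzygy of those two alone.
  have h1 : dot x x t ∣ dot x p t * (b + w * dot p p t) := ⟨-(a + v * dot p p t), by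
    rw [← hc] at h
    linear_combination h⟩
  obtain ⟨u, hu⟩ := dvd_of_dvd_dot_mul hx hp hxp (by omega) h1
  refine ⟨-u, -v, -w, ?_, by linear_combination hu, by linear_combination -hc⟩
  have ht0 : t.Nonempty := Finset.card_pos.1 (by omega)
  refine mul_left_cancel₀ (dot_self_ne_zero hx ht0) ?_
  rw [← hc] at h
  linear_combination h - dot x p t * hu

end Syzygies

/-! ### Ideals in weighted polynomial rings -/

section Weighted

variable {σ M : Type} [AddCommMonoid M] [DecidableEq M] {w : σ → M}

theorem exists_weightedHomogeneousComponent_mul {q : MvPolynomial σ ℝ} {k : M}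
    (hq : IsWeightedHomogeneous w q k) (m : M) (a : MvPolynomial σ ℝ) :
    ∃ b, weightedHomogeneousComponent w m (q * a) = q * b := by
  induction a using MvPolynomial.induction_on' with
  | monomial c r =>
    have h1 := hq.mul (isWeightedHomogeneous_monomial w c r rfl)
    by_cases h : k + Finsupp.weight w c = m
    · subst h
      exact ⟨_, h1.weightedHomogeneousComponent_same⟩
    · exact ⟨0, by rw [h1.weightedHomogeneousComponent_ne m (Ne.symm h), mul_zero]⟩
  | add f g hf hg =>
    obtain ⟨b, hb⟩ := hf
    obtain ⟨c, hc⟩ := hg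
    exact ⟨b + c, by rw [mul_add, map_add, hb, hc, mul_add]⟩

theorem weightedHomogeneousComponent_mem_span {κ : Type} {q : κ → MvPolynomial σ ℝ} {k : κ → M}
    (hq : ∀ j, IsWeightedHomogeneous w (q j) (k j)) (m : M) {f : MvPolynomial σ ℝ}
    (hf : f ∈ Ideal.span (Set.range q)) :
    weightedHomogeneousComponent w m f ∈ Ideal.span (Set.range q) := by
  induction hf using Submodule.span_induction with
  | mem x hx =>
    obtain ⟨j, rfl⟩ := hx
    obtain ⟨b, hb⟩ := exists_weightedHomogeneousComponent_mul (hq j) m 1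
    rw [mul_one] at hb
    rw [hb]
    exact Ideal.mul_mem_right _ _ (Ideal.subset_span ⟨j, rfl⟩)
  | zero => rw [map_zero]; exact zero_mem _
  | add x y _ _ hx hy => rw [map_add]; exact add_mem hx hy
  | smul a x hx' hx =>
    clear hx
    revert a
    induction hx' using Submodule.span_induction with
    | mem x hx =>
      intro a
      obtain ⟨j, rfl⟩ := hx
      obtain ⟨b, hb⟩ := exists_weightedHomogeneousComponent_mul (hq j) m a
      rw [smul_eq_mul, mul_comm, hb]
      exact Ideal.mul_mem_right _ _ (Ideal.subset_span ⟨j, rfl⟩)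
    | zero => intro a; rw [smul_zero, map_zero]; exact zero_mem _
    | add x y _ _ hx hy => intro a; rw [smul_add, map_add]; exact add_mem (hx a) (hy a)
    | smul b x _ hx => intro a; rw [smul_smul]; exact hx _

/-- An element that agrees with multiples of arbitrarily high powers of a variable modulo a
homogeneous ideal belongs to it. -/
theorem mem_span_of_forall_X_pow {κ : Type} {q : κ → MvPolynomial σ ℝ} {k : κ → ℕ}
    (hq : ∀ j, IsHomogeneous (q j) (k j)) (i : σ) {f : MvPolynomial σ ℝ}
    (h : ∀ N, ∃ g, f - X i ^ N * g ∈ Ideal.span (Set.range q)) : f ∈ Ideal.span (Set.range q) := by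
  -- One power above the total degree suffices: the multiple of that power has no component in the
  -- degrees of `f`, so the components of `f` are components of an element of the ideal.
  obtain ⟨g, hg⟩ := h (f.totalDegree + 1)
  have h1 : f = ∑ j ∈ Finset.range (f.totalDegree + 1),
      homogeneousComponent j (f - X i ^ (f.totalDegree + 1) * g) := by
    simp only [map_sub, Finset.sum_sub_distrib]
    rw [sum_homogeneousComponent, Finset.sum_eq_zero, sub_zero]
    intro j hj
    obtain ⟨b, hb⟩ := exists_weightedHomogeneousComponent_mul (w := (1 : σ → ℕ))
      (isHomogeneous_X_pow (R := ℝ) i (f.totalDegree + 1)) j g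
    have h2 : IsHomogeneous (homogeneousComponent j (X i ^ (f.totalDegree + 1) * g)) j :=
      homogeneousComponent_isHomogeneous _ _
    by_contra hne
    have h3 := h2.totalDegree hne
    have hb' : homogeneousComponent j (X i ^ (f.totalDegree + 1) * g) =
      X i ^ (f.totalDegree + 1) * b := hb
    rw [hb'] at h3 hne
    have hb0 : b ≠ 0 := right_ne_zero_of_mul hne
    rw [totalDegree_mul_of_isDomain (pow_ne_zero _ (X_ne_zero i)) hb0, totalDegree_X_pow] at h3
    rw [Finset.mem_range] at hj
    omega
  rw [h1]
  exact sum_mem fun j _ => weightedHomogeneousComponent_mem_span hq j hg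

end Weighted

/-! ### Quadratic forms of a metric -/

section MetricForm

variable {m : Type} [Fintype m]

/-- The quadratic polynomial `g(x_r, x_{r'})` in two vectors `x_0`, `x_1`. -/
noncomputable def metricForm (g : Matrix m m ℝ) (r r' : Fin 2) : MvPolynomial (Fin 2 × m) ℝ :=
  ∑ A, ∑ B, g A B • (X (r, A) * X (r', B))

theorem fischer_metricForm_mul (g : Matrix m m ℝ) (r r' : Fin 2)
    (f h : MvPolynomial (Fin 2 × m) ℝ) :
    fischer (metricForm g r r' * f) h = fischer f (laplace g r r' h) := by
  simp only [metricForm, laplace, Finset.sum_mul, map_sum, LinearMap.sum_apply, smul_mul_assoc,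
    map_smul, LinearMap.smul_apply, fischer_X_mul_X_mul]

theorem isHomogeneous_metricForm (g : Matrix m m ℝ) (r r' : Fin 2) :
    IsHomogeneous (metricForm g r r') 2 := by
  refine IsHomogeneous.sum _ _ _ fun A _ => IsHomogeneous.sum _ _ _ fun B _ => ?_
  rw [smul_eq_C_mul]
  simpa using (isHomogeneous_C _ (g A B)).mul ((isHomogeneous_X ℝ (r, A)).mul
    (isHomogeneous_X ℝ (r', B)))

theorem isWeightedHomogeneous_metricForm (g : Matrix m m ℝ) (r r' : Fin 2) :
    IsWeightedHomogeneous (rowWeight m) (metricForm g r r')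
      ((if r = 0 then (1, 0) else (0, 1)) + if r' = 0 then (1, 0) else (0, 1)) := by
  refine IsWeightedHomogeneous.sum _ _ _ fun A _ => IsWeightedHomogeneous.sum _ _ _ fun B _ => ?_
  rw [smul_eq_C_mul]
  have h := (isWeightedHomogeneous_C (rowWeight m) (g A B)).mul
    ((isWeightedHomogeneous_X ℝ (rowWeight m) (r, A)).mul
      (isWeightedHomogeneous_X ℝ (rowWeight m) (r', B)))
  rw [zero_add] at h
  exact h

theorem totalDegree_laplace_le (g : Matrix m m ℝ) (r r' : Fin 2) {N : ℕ}
    {f : MvPolynomial (Fin 2 × m) ℝ} (hf : f.totalDegree ≤ N + 2) :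
    (laplace g r r' f).totalDegree ≤ N := by
  refine totalDegree_finsetSum_le fun A _ => totalDegree_finsetSum_le fun B _ => ?_
  exact (totalDegree_smul_le _ _).trans (totalDegree_pderiv_le (totalDegree_pderiv_le hf))

theorem metricForm_comm {g : Matrix m m ℝ} (hg : g.IsSymm) (r r' : Fin 2) :
    metricForm g r r' = metricForm g r' r := by
  rw [metricForm, Finset.sum_comm, metricForm]
  refine Finset.sum_congr rfl fun A _ => Finset.sum_congr rfl fun B _ => ?_
  rw [mul_comm, hg.apply]

theorem rowDer_metricForm (g : Matrix m m ℝ) (a b r r' : Fin 2) :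
    rowDer a b (metricForm g r r') =
      (if r = b then metricForm g a r' else 0) + if r' = b then metricForm g r a else 0 := by
  have h : ∀ r A, rowDer a b (X (r, A)) = if r = b then (X (a, A) : MvPolynomial (Fin 2 × m) ℝ)
      else 0 := fun r A => by
    simp [rowDer, mkDerivation_X]
  simp only [metricForm, map_sum, Derivation.map_smul, Derivation.leibniz, h]
  by_cases h1 : r = b <;> by_cases h2 : r' = b <;>
    simp [h1, h2, Finset.sum_add_distrib, smul_add, mul_comm, add_comm]

/-- The ideal of the pairs of vectors that span a totally null subspace. -/
noncomputable def nullIdeal (g : Matrix m m ℝ) : Ideal (MvPolynomial (Fin 2 × m) ℝ) :=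
  Ideal.span (Set.range fun j : Fin 2 × Fin 2 => metricForm g j.1 j.2)

theorem metricForm_mem_nullIdeal (g : Matrix m m ℝ) (r r' : Fin 2) :
    metricForm g r r' ∈ nullIdeal g := Ideal.subset_span ⟨(r, r'), rfl⟩

theorem fischer_eq_zero_of_mem_nullIdeal {g : Matrix m m ℝ} {h i : MvPolynomial (Fin 2 × m) ℝ}
    (hh : ∀ r r', laplace g r r' h = 0) (hi : i ∈ nullIdeal g) : fischer i h = 0 := by
  obtain ⟨c, rfl⟩ := (Ideal.mem_span_range_iff_exists_fun).1 hi
  simp only [map_sum, LinearMap.sum_apply]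
  refine Finset.sum_eq_zero fun j _ => ?_
  rw [mul_comm, fischer_metricForm_mul, hh, map_zero]

theorem laplace_eq_zero_of_fischer {g : Matrix m m ℝ} {h : MvPolynomial (Fin 2 × m) ℝ}
    (hh : ∀ i ∈ nullIdeal g, fischer i h = 0) (r r' : Fin 2) : laplace g r r' h = 0 := by
  refine eq_zero_of_fischer fun k => ?_
  rw [fischer_comm, ← fischer_metricForm_mul]
  exact hh _ (Ideal.mul_mem_right _ _ (metricForm_mem_nullIdeal g r r'))

theorem rowDer_mem_nullIdeal (g : Matrix m m ℝ) (a b : Fin 2) {f : MvPolynomial (Fin 2 × m) ℝ}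
    (hf : f ∈ nullIdeal g) : rowDer a b f ∈ nullIdeal g := by
  obtain ⟨c, rfl⟩ := (Ideal.mem_span_range_iff_exists_fun).1 hf
  rw [map_sum]
  refine sum_mem fun j _ => ?_
  rw [Derivation.leibniz, rowDer_metricForm]
  refine add_mem (Ideal.mul_mem_left _ _ (add_mem ?_ ?_)) ?_
  · split_ifs
    exacts [metricForm_mem_nullIdeal _ _ _, zero_mem _]
  · split_ifs
    exacts [metricForm_mem_nullIdeal _ _ _, zero_mem _]
  · rw [smul_eq_mul]
    exact Ideal.mul_mem_right _ _ (metricForm_mem_nullIdeal _ _ _)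

theorem weightedHomogeneousComponent_mem_nullIdeal (g : Matrix m m ℝ) (k : ℕ × ℕ)
    {f : MvPolynomial (Fin 2 × m) ℝ} (hf : f ∈ nullIdeal g) :
    weightedHomogeneousComponent (rowWeight m) k f ∈ nullIdeal g :=
  weightedHomogeneousComponent_mem_span
    (fun j : Fin 2 × Fin 2 => isWeightedHomogeneous_metricForm g j.1 j.2) k hf

theorem eq_zero_of_mem_nullIdeal {g : Matrix m m ℝ} {h : MvPolynomial (Fin 2 × m) ℝ}
    (hh : ∀ r r', laplace g r r' h = 0) (hi : h ∈ nullIdeal g) : h = 0 :=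
  fischer_self_eq_zero (fischer_eq_zero_of_mem_nullIdeal hh hi)

theorem exists_harmonic (g : Matrix m m ℝ) (f : MvPolynomial (Fin 2 × m) ℝ) :
    ∃ h, f - h ∈ nullIdeal g ∧ ∀ r r', laplace g r r' h = 0 := by
  obtain ⟨a, ha⟩ := fischer_decomposition (κ := Fin 2 × Fin 2)
    (fun j => metricForm g j.1 j.2) (fun j => laplace g j.1 j.2)
    (fun j => (isHomogeneous_metricForm g j.1 j.2).totalDegree_le)
    (fun j a h => fischer_metricForm_mul g j.1 j.2 a h)
    (fun j N h hN => totalDegree_laplace_le g j.1 j.2 hN) f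
  refine ⟨_, ?_, fun r r' => ha (r, r')⟩
  rw [sub_sub_cancel]
  exact sum_mem fun j _ => Ideal.mul_mem_right _ _ (metricForm_mem_nullIdeal g _ _)

end MetricForm

/-- The tensor comes from the bidegree (s, s) part of the harmonic representative of `F`. Applying
X·∂/∂P to that part keeps it harmonic, because the adjoint operator preserves the ideal, and the
result also lies in the ideal by `he`. Hence it is zero. -/
theorem exists_ambientKilling_sub_mem {n s : ℕ} {F : MvPolynomial (Fin 2 × AmbIndex n) ℝ}
    (hF : IsWeightedHomogeneous (rowWeight (AmbIndex n)) F (s, s))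
    (he : rowDer 0 1 F ∈ nullIdeal (ambientMetric n)) :
    ∃ T ∈ ambientKilling n s, F - toPoly T ∈ nullIdeal (ambientMetric n) := by
  obtain ⟨h, hFh, hh⟩ := exists_harmonic (ambientMetric n) F
  set h' := weightedHomogeneousComponent (rowWeight (AmbIndex n)) (s, s) h with hh'
  have hFh' : F - h' ∈ nullIdeal (ambientMetric n) := by
    have := weightedHomogeneousComponent_mem_nullIdeal _ (s, s) hFh
    rwa [map_sub, hF.weightedHomogeneousComponent_same] at this
  have h1 : ∀ i ∈ nullIdeal (ambientMetric n), fischer i h' = 0 := fun i hi => by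
    rw [hh', ← fischer_weightedHomogeneousComponent]
    exact fischer_eq_zero_of_mem_nullIdeal hh (weightedHomogeneousComponent_mem_nullIdeal _ _ hi)
  have h2 : ∀ i ∈ nullIdeal (ambientMetric n), fischer i (rowDer 0 1 h') = 0 := fun i hi => by
    rw [fischer_rowDer]
    exact h1 _ (rowDer_mem_nullIdeal _ _ _ hi)
  have h3 : rowDer 0 1 h' = 0 := by
    refine eq_zero_of_mem_nullIdeal (laplace_eq_zero_of_fischer h2) ?_
    have := rowDer_mem_nullIdeal _ 0 1 hFh'
    rw [map_sub] at this
    exact (Submodule.sub_mem_iff_right _ he).1 this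
  obtain ⟨T, hT, hT'⟩ := exists_mem_ambientKilling
    (weightedHomogeneousComponent_isWeightedHomogeneous (w := rowWeight (AmbIndex n)) (s, s) h)
    h3 (laplace_eq_zero_of_fischer h1)
  exact ⟨T, hT, by rw [hT']; exact hFh'⟩

/-! ### The null ideal of the ambient metric -/

section Ambient

variable {n : ℕ}

/-- The variables are components of lowered vectors. So `ambInf` is the coordinate x^0, equal to 1
on Φ and to 0 on Ψ, while `ambZero` is the coordinate x^∞. -/
abbrev ambZero (n : ℕ) (r : Fin 2) : Fin 2 × AmbIndex n := (r, .inl ())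

abbrev ambMid (r : Fin 2) (b : Fin n) : Fin 2 × AmbIndex n := (r, .inr (.inl b))

abbrev ambInf (n : ℕ) (r : Fin 2) : Fin 2 × AmbIndex n := (r, .inr (.inr ()))

theorem metricForm_ambientMetric (r r' : Fin 2) :
    metricForm (ambientMetric n) r r' = X (ambZero n r) * X (ambInf n r') +
      X (ambInf n r) * X (ambZero n r') + dot (ambMid r) (ambMid r') Finset.univ := by
  simp [metricForm, Fintype.sum_sum_type, ambientMetric, Matrix.one_apply, dot, ite_smul]
  ring

theorem ambientMetric_isSymm : (ambientMetric n).IsSymm := by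
  ext A B
  rcases A with _ | _ | _ <;> rcases B with _ | _ | _ <;>
    simp [ambientMetric, Matrix.transpose_apply, Matrix.one_apply, eq_comm]

theorem mem_nullIdeal_iff {f : MvPolynomial (Fin 2 × AmbIndex n) ℝ} :
    f ∈ nullIdeal (ambientMetric n) ↔ ∃ a b c, f = a * metricForm (ambientMetric n) 0 0 +
      b * metricForm (ambientMetric n) 0 1 + c * metricForm (ambientMetric n) 1 1 := by
  constructor
  · intro h
    obtain ⟨c, rfl⟩ := (Ideal.mem_span_range_iff_exists_fun).1 h
    refine ⟨c (0, 0), c (0, 1) + c (1, 0), c (1, 1), ?_⟩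
    simp only [Fintype.sum_prod_type, Fin.sum_univ_two]
    rw [metricForm_comm ambientMetric_isSymm 1 0]
    ring
  · rintro ⟨a, b, c, rfl⟩
    exact add_mem (add_mem (Ideal.mul_mem_left _ _ (metricForm_mem_nullIdeal _ _ _))
      (Ideal.mul_mem_left _ _ (metricForm_mem_nullIdeal _ _ _)))
      (Ideal.mul_mem_left _ _ (metricForm_mem_nullIdeal _ _ _))

/-- Setting the two coordinates `x^0` that are conjugate to infinity to zero. -/
noncomputable def killInf (n : ℕ) :
    MvPolynomial (Fin 2 × AmbIndex n) ℝ →ₐ[ℝ] MvPolynomial (Fin 2 × AmbIndex n) ℝ :=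
  (killVar (ambInf n 0)).comp (killVar (ambInf n 1))

theorem killInf_X (i : Fin 2 × AmbIndex n) :
    killInf n (X i) = if i = ambInf n 0 ∨ i = ambInf n 1 then 0 else X i := by
  simp only [killInf, killVar, AlgHom.comp_apply, aeval_X]
  by_cases h1 : i = ambInf n 1
  · simp [h1]
  · by_cases h0 : i = ambInf n 0 <;> simp [h0, h1]

theorem killInf_dot (r r' : Fin 2) :
    killInf n (dot (ambMid r) (ambMid r') Finset.univ) = dot (ambMid r) (ambMid r') Finset.univ := by
  simp [dot, killInf_X]

theorem killInf_metricForm (r r' : Fin 2) :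
    killInf n (metricForm (ambientMetric n) r r') = dot (ambMid r) (ambMid r') Finset.univ := by
  have h : ∀ r : Fin 2, killInf n (X (ambInf n r)) = 0 := fun r => by
    rw [killInf_X]
    fin_cases r <;> simp
  rw [metricForm_ambientMetric, map_add, map_add, map_mul, map_mul, h, h, killInf_dot]
  ring

theorem exists_of_killInf_eq_zero {f : MvPolynomial (Fin 2 × AmbIndex n) ℝ}
    (h : killInf n f = 0) : ∃ a b, f = X (ambInf n 0) * a + X (ambInf n 1) * b := by
  obtain ⟨b, hb⟩ := X_dvd_sub_killVar (ambInf n 1) f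
  obtain ⟨a, ha⟩ := X_dvd_sub_killVar (ambInf n 0) (killVar (ambInf n 1) f)
  have h' : killVar (ambInf n 0) (killVar (ambInf n 1) f) = 0 := h
  rw [h'] at ha
  exact ⟨a, b, by linear_combination hb + ha⟩

/-- Elements of the null ideal that vanish where both coordinates do are combinations of these
coordinates with coefficients in the ideal. -/
theorem exists_mem_of_killInf_eq_zero (hn : 3 ≤ n) {f : MvPolynomial (Fin 2 × AmbIndex n) ℝ}
    (hf : f ∈ nullIdeal (ambientMetric n)) (h : killInf n f = 0) :
    ∃ a ∈ nullIdeal (ambientMetric n), ∃ b ∈ nullIdeal (ambientMetric n),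
      f = X (ambInf n 0) * a + X (ambInf n 1) * b := by
  obtain ⟨a, b, c, rfl⟩ := mem_nullIdeal_iff.1 hf
  simp only [map_add, map_mul, killInf_metricForm] at h
  -- Where y = z = 0 the ambient quadrics become the Euclidean ones, whose syzygies are Koszul. The
  -- same Koszul combination of the ambient quadrics is identically zero, so it may be subtracted;
  -- the remaining coefficients vanish at y = z = 0.
  obtain ⟨u, v, w, hu, hv, hw⟩ := koszul_of_syzygy (x := ambMid (n := n) 0) (p := ambMid 1)
    (fun i j h => by simpa using h) (fun i j h => by simpa using h) (fun i j h => by simp at h)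
    (by simpa using hn) h
  have hkk : ∀ g : MvPolynomial (Fin 2 × AmbIndex n) ℝ, killInf n (killInf n g) = killInf n g := by
    intro g
    have : (killInf n).comp (killInf n) = killInf n := by
      ext i
      simp only [AlgHom.comp_apply, killInf_X]
      split_ifs with h
      · simp
      · rw [killInf_X, if_neg h]
    exact DFunLike.congr_fun this g
  have hu' := congrArg (killInf n) hu
  have hv' := congrArg (killInf n) hv
  have hw' := congrArg (killInf n) hw
  simp only [map_add, map_sub, map_neg, map_mul, hkk, killInf_dot] at hu' hv' hw'
  set Q₀ := metricForm (ambientMetric n) 0 0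
  set Q₁ := metricForm (ambientMetric n) 0 1
  set Q₂ := metricForm (ambientMetric n) 1 1
  obtain ⟨a₀, a₁, ha⟩ := exists_of_killInf_eq_zero (f := a - (u * Q₁ + v * Q₂)) (by
    simp only [map_add, map_sub, map_mul, Q₁, Q₂, killInf_metricForm]
    rw [hu', sub_self])
  obtain ⟨b₀, b₁, hb⟩ := exists_of_killInf_eq_zero (f := b - (-(u * Q₀) + w * Q₂)) (by
    simp only [map_add, map_sub, map_neg, map_mul, Q₀, Q₂, killInf_metricForm]
    rw [hv', sub_self])
  obtain ⟨c₀, c₁, hc⟩ := exists_of_killInf_eq_zero (f := c - (-(v * Q₀) - w * Q₁)) (by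
    simp only [map_sub, map_neg, map_mul, Q₀, Q₁, killInf_metricForm]
    rw [hw', sub_self])
  refine ⟨a₀ * Q₀ + b₀ * Q₁ + c₀ * Q₂, mem_nullIdeal_iff.2 ⟨_, _, _, rfl⟩,
    a₁ * Q₀ + b₁ * Q₁ + c₁ * Q₂, mem_nullIdeal_iff.2 ⟨_, _, _, rfl⟩, ?_⟩
  linear_combination Q₀ * ha + Q₁ * hb + Q₂ * hc

theorem killInf_X_inf_mul (r : Fin 2) (f : MvPolynomial (Fin 2 × AmbIndex n) ℝ) :
    killInf n (X (ambInf n r) * f) = 0 := by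
  rw [map_mul, killInf_X, if_pos, zero_mul]
  fin_cases r <;> simp

theorem X_inf_dvd_of_mul {r r' : Fin 2} (h : r ≠ r') {f g : MvPolynomial (Fin 2 × AmbIndex n) ℝ}
    (hfg : X (ambInf n r) * f = X (ambInf n r') * g) : X (ambInf n r') ∣ f := by
  have h1 : X (ambInf n r') ∣ X (ambInf n r) * f := ⟨g, hfg⟩
  refine ((X_prime (i := ambInf n r')).dvd_or_dvd h1).resolve_left fun h2 => h ?_
  have h3 : ambInf n r' = ambInf n r := by simpa [X_dvd_X] using h2
  exact (congrArg Prod.fst h3).symm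

/-- The coordinate at infinity is a nonzerodivisor modulo the null ideal. -/
theorem mem_nullIdeal_of_X_inf_mul (hn : 3 ≤ n) {f : MvPolynomial (Fin 2 × AmbIndex n) ℝ}
    (hf : X (ambInf n 0) * f ∈ nullIdeal (ambientMetric n)) : f ∈ nullIdeal (ambientMetric n) := by
  -- If y f = y a + z b with `a`, `b` in the ideal, then y(f - a) = z b, so b = y g and f ≡ z g,
  -- where y g is again in the ideal. Iteration makes f a multiple of z^N modulo the ideal for every
  -- N, which homogeneity allows only for elements of the ideal.
  have step : ∀ f, X (ambInf n 0) * f ∈ nullIdeal (ambientMetric n) →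
      ∃ g, X (ambInf n 0) * g ∈ nullIdeal (ambientMetric n) ∧
        f - X (ambInf n 1) * g ∈ nullIdeal (ambientMetric n) := by
    intro f hf
    obtain ⟨a, ha, b, hb, hab⟩ := exists_mem_of_killInf_eq_zero hn hf (killInf_X_inf_mul 0 f)
    have h1 : X (ambInf n 1) * b = X (ambInf n 0) * (f - a) := by linear_combination -hab
    obtain ⟨g, rfl⟩ := X_inf_dvd_of_mul (by decide) h1
    refine ⟨g, hb, ?_⟩
    have h2 : f - X (ambInf n 1) * g = a := by
      refine mul_left_cancel₀ (X_ne_zero (ambInf n 0)) ?_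
      linear_combination hab
    rwa [h2]
  refine mem_span_of_forall_X_pow
    (fun j : Fin 2 × Fin 2 => isHomogeneous_metricForm (ambientMetric n) j.1 j.2) (ambInf n 1)
    fun N => ?_
  suffices ∃ g, X (ambInf n 0) * g ∈ nullIdeal (ambientMetric n) ∧
      f - X (ambInf n 1) ^ N * g ∈ nullIdeal (ambientMetric n) from
    this.imp fun _ h => h.2
  induction N with
  | zero => exact ⟨f, hf, by simp⟩
  | succ N ih =>
    obtain ⟨g, hg, hfg⟩ := ih
    obtain ⟨g', hg', hgg⟩ := step g hg
    refine ⟨g', hg', ?_⟩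
    have : f - X (ambInf n 1) ^ (N + 1) * g' = f - X (ambInf n 1) ^ N * g +
        X (ambInf n 1) ^ N * (g - X (ambInf n 1) * g') := by ring
    rw [this]
    exact add_mem hfg (Ideal.mul_mem_left _ _ hgg)

theorem mem_nullIdeal_of_X_inf_pow_mul (hn : 3 ≤ n) (k : ℕ)
    {f : MvPolynomial (Fin 2 × AmbIndex n) ℝ}
    (hf : X (ambInf n 0) ^ k * f ∈ nullIdeal (ambientMetric n)) :
    f ∈ nullIdeal (ambientMetric n) := by
  induction k with
  | zero => simpa using hf
  | succ k ih =>
    rw [pow_succ', mul_assoc] at hf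
    exact ih (mem_nullIdeal_of_X_inf_mul hn hf)

/-- The second half of the regular sequence: z can be cancelled modulo the ideal and y, by the same
division of the coefficients. -/
theorem exists_of_X_inf_one_pow_mul (hn : 3 ≤ n) (N : ℕ)
    {f g : MvPolynomial (Fin 2 × AmbIndex n) ℝ}
    (hf : X (ambInf n 1) ^ N * f - X (ambInf n 0) * g ∈ nullIdeal (ambientMetric n)) :
    ∃ g', f - X (ambInf n 0) * g' ∈ nullIdeal (ambientMetric n) := by
  induction N generalizing g with
  | zero => exact ⟨g, by simpa using hf⟩
  | succ N ih =>
    have h0 : killInf n (X (ambInf n 1) ^ (N + 1) * f - X (ambInf n 0) * g) = 0 := by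
      rw [map_sub, pow_succ', mul_assoc, killInf_X_inf_mul, killInf_X_inf_mul, sub_zero]
    obtain ⟨a, ha, b, hb, hab⟩ := exists_mem_of_killInf_eq_zero hn hf h0
    have h1 : X (ambInf n 1) * (X (ambInf n 1) ^ N * f - b) = X (ambInf n 0) * (g + a) := by
      linear_combination hab
    obtain ⟨g', hg'⟩ := X_inf_dvd_of_mul (by decide) h1
    refine ih (g := g') ?_
    have : X (ambInf n 1) ^ N * f - X (ambInf n 0) * g' = b := by linear_combination hg'
    rwa [this]

/-- Powers of y are split off one at a time, with y cancelled modulo the ideal after each step. -/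
theorem exists_of_X_inf_pow_mul (hn : 3 ≤ n) (N M : ℕ)
    {f g : MvPolynomial (Fin 2 × AmbIndex n) ℝ}
    (hf : X (ambInf n 1) ^ N * f - X (ambInf n 0) ^ M * g ∈ nullIdeal (ambientMetric n)) :
    ∃ g', f - X (ambInf n 0) ^ M * g' ∈ nullIdeal (ambientMetric n) := by
  induction M generalizing f with
  | zero => exact ⟨f, by simp⟩
  | succ M ih =>
    have h1 : X (ambInf n 1) ^ N * f - X (ambInf n 0) * (X (ambInf n 0) ^ M * g) ∈
        nullIdeal (ambientMetric n) := by rwa [← mul_assoc, ← pow_succ']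
    obtain ⟨f', hf'⟩ := exists_of_X_inf_one_pow_mul hn N h1
    have h2 : X (ambInf n 0) * (X (ambInf n 1) ^ N * f' - X (ambInf n 0) ^ M * g) ∈
        nullIdeal (ambientMetric n) := by
      have : X (ambInf n 0) * (X (ambInf n 1) ^ N * f' - X (ambInf n 0) ^ M * g) =
          (X (ambInf n 1) ^ N * f - X (ambInf n 0) ^ (M + 1) * g) -
            X (ambInf n 1) ^ N * (f - X (ambInf n 0) * f') := by ring
      rw [this]
      exact sub_mem hf (Ideal.mul_mem_left _ _ hf')
    obtain ⟨g', hg'⟩ := ih (mem_nullIdeal_of_X_inf_mul hn h2)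
    refine ⟨g', ?_⟩
    have : f - X (ambInf n 0) ^ (M + 1) * g' = (f - X (ambInf n 0) * f') +
        X (ambInf n 0) * (f' - X (ambInf n 0) ^ M * g') := by ring
    rw [this]
    exact add_mem hf' (Ideal.mul_mem_left _ _ hg')

end Ambient

/-! ### Substitution in weighted homogeneous polynomials -/

section Substitution

variable {σ υ M M' S : Type} [CommRing S] [Algebra ℝ S]

theorem isWeightedHomogeneous_aeval [AddCommMonoid M] [AddCommMonoid M'] {w : σ → M} {w' : υ → M'}
    (φ : M →+ M') {u : σ → MvPolynomial υ ℝ} (hu : ∀ i, IsWeightedHomogeneous w' (u i) (φ (w i)))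
    {f : MvPolynomial σ ℝ} {m : M} (hf : IsWeightedHomogeneous w f m) :
    IsWeightedHomogeneous w' (aeval u f) (φ m) := by
  rw [aeval_def, eval₂_eq]
  refine IsWeightedHomogeneous.sum _ _ _ fun d hd => ?_
  rw [algebraMap_eq]
  refine IsWeightedHomogeneous.C_mul ?_ _
  have h1 : φ m = ∑ i ∈ d.support, d i • φ (w i) := by
    rw [← hf (mem_support_iff.1 hd), Finsupp.weight_apply, Finsupp.sum, map_sum]
    simp
  rw [h1]
  exact IsWeightedHomogeneous.prod _ _ _ fun i _ => (hu i).pow _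

theorem aeval_scale {w : σ → ℕ × ℕ} {f : MvPolynomial σ ℝ} {m : ℕ × ℕ}
    (hf : IsWeightedHomogeneous w f m) (t r : S) (u : σ → S) :
    aeval (fun i => t ^ (w i).1 * r ^ (w i).2 * u i) f = t ^ m.1 * r ^ m.2 * aeval u f := by
  rw [aeval_def, aeval_def, eval₂_eq, eval₂_eq, Finset.mul_sum]
  refine Finset.sum_congr rfl fun d hd => ?_
  have h1 : m = ∑ i ∈ d.support, d i • w i := by
    rw [← hf (mem_support_iff.1 hd), Finsupp.weight_apply, Finsupp.sum]
  have h2 : m.1 = ∑ i ∈ d.support, (w i).1 * d i := by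
    rw [h1, Prod.fst_sum]
    exact Finset.sum_congr rfl fun i _ => by simp [mul_comm]
  have h3 : m.2 = ∑ i ∈ d.support, (w i).2 * d i := by
    rw [h1, Prod.snd_sum]
    exact Finset.sum_congr rfl fun i _ => by simp [mul_comm]
  rw [h2, h3, ← Finset.prod_pow_eq_pow_sum, ← Finset.prod_pow_eq_pow_sum]
  simp only [mul_pow, Finset.prod_mul_distrib, pow_mul]
  ring

theorem derivation_aeval_eq_zero (D : Derivation ℝ S S) {u : σ → S} (hu : ∀ i, D (u i) = 0)
    (f : MvPolynomial σ ℝ) : D (aeval u f) = 0 := by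
  induction f using MvPolynomial.induction_on with
  | C a => simp
  | add f g hf hg => rw [map_add, map_add, hf, hg, add_zero]
  | mul_X f i hf => rw [map_mul, aeval_X, Derivation.leibniz, hf, hu, smul_zero, smul_zero, add_zero]

theorem aeval_sub_aeval_mem (I : Ideal S) {u v : σ → S} (h : ∀ i, u i - v i ∈ I)
    (f : MvPolynomial σ ℝ) : aeval u f - aeval v f ∈ I := by
  induction f using MvPolynomial.induction_on with
  | C a => simp
  | add f g hf hg =>
    rw [map_add, map_add, add_sub_add_comm]
    exact add_mem hf hg
  | mul_X f i hf =>
    rw [map_mul, map_mul, aeval_X, aeval_X]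
    have : aeval u f * u i - aeval v f * v i =
      u i * (aeval u f - aeval v f) + aeval v f * (u i - v i) := by ring
    rw [this]
    exact add_mem (Ideal.mul_mem_left _ _ hf) (Ideal.mul_mem_left _ _ (h i))

theorem weightedHomogeneousComponent_add_mul [AddCommMonoid M] [IsLeftCancelAdd M] {w : σ → M}
    {q : MvPolynomial σ ℝ} {k : M} (hq : IsWeightedHomogeneous w q k) (m : M)
    (a : MvPolynomial σ ℝ) :
    weightedHomogeneousComponent w (k + m) (q * a) = q * weightedHomogeneousComponent w m a := by
  classical
  induction a using MvPolynomial.induction_on' with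
  | monomial c r =>
    have h0 := isWeightedHomogeneous_monomial w c r rfl
    have h1 := hq.mul h0
    by_cases h : Finsupp.weight w c = m
    · rw [← h, h1.weightedHomogeneousComponent_same, h0.weightedHomogeneousComponent_same]
    · rw [h1.weightedHomogeneousComponent_ne _ fun e => h (add_left_cancel e).symm,
        h0.weightedHomogeneousComponent_ne _ (Ne.symm h), mul_zero]
  | add f g hf hg => rw [mul_add, map_add, hf, hg, map_add, mul_add]

end Substitution

/-- Over a real algebra the positive integers are invertible, so all nonconstant coefficients of `f`
are divisible by `r`. -/
theorem dvd_eval_sub_eval_zero {R : Type} [CommRing R] [Algebra ℝ R] {f g : Polynomial R} {r : R}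
    (h : Polynomial.derivative f = Polynomial.C r * g) (c : R) :
    r ∣ f.eval c - f.eval 0 := by
  have h1 : ∀ k, r ∣ f.coeff (k + 1) := by
    intro k
    have h2 := congrArg (fun p => Polynomial.coeff p k) h
    simp only [Polynomial.coeff_derivative, Polynomial.coeff_C_mul] at h2
    refine ⟨algebraMap ℝ R (((k : ℝ) + 1)⁻¹) * g.coeff k, ?_⟩
    have h3 : ((k : R) + 1) * algebraMap ℝ R (((k : ℝ) + 1)⁻¹) = 1 := by
      have : ((k : R) + 1) = algebraMap ℝ R ((k : ℝ) + 1) := by simp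
      rw [this, ← map_mul, mul_inv_cancel₀ (by positivity), map_one]
    linear_combination (algebraMap ℝ R (((k : ℝ) + 1)⁻¹)) * h2 - f.coeff (k + 1) * h3
  rw [Polynomial.eval_eq_sum_range, Finset.sum_range_succ', ← Polynomial.coeff_zero_eq_eval_zero,
    pow_zero, mul_one, add_sub_cancel_right]
  exact Finset.dvd_sum fun k _ => Dvd.dvd.mul_right (h1 k) _

/-! ### Polynomial conformal Killing tensors -/

section Poly

variable {n : ℕ}

/-- `x_r · x_{r'}`. -/
noncomputable abbrev euclid (n : ℕ) (r r' : Fin 2) : MvPolynomial (Fin 2 × Fin n) ℝ :=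
  metricForm (1 : Matrix (Fin n) (Fin n) ℝ) r r'

theorem euclid_eq (r r' : Fin 2) : euclid n r r' = ∑ b, X (r, b) * X (r', b) := by
  simp [euclid, metricForm, Matrix.one_apply, ite_smul]

/-- A function that is invariant along null lines up to multiples of `p²` is so for finite
displacements. -/
theorem euclid_dvd_shift_sub {V : MvPolynomial (Fin 2 × Fin n) ℝ}
    (hV : euclid n 1 1 ∣ rowDer 1 0 V) :
    euclid n 1 1 ∣ aeval (fun i => if i.1 = 0 then X i - X (1, i.2) else X i) V - V := by
  obtain ⟨W, hW⟩ := hV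
  -- The displacement x ↦ x + tp with a new variable t. Differentiating in t is applying p·∂/∂x, and
  -- p² does not depend on t; the values at t = -1 and t = 0 are then compared.
  let φ : MvPolynomial (Fin 2 × Fin n) ℝ →ₐ[ℝ] Polynomial (MvPolynomial (Fin 2 × Fin n) ℝ) :=
    aeval fun i => if i.1 = 0 then Polynomial.C (X i) + Polynomial.X * Polynomial.C (X (1, i.2))
      else Polynomial.C (X i)
  have hφX0 : ∀ b, φ (X (0, b)) = Polynomial.C (X (0, b)) + Polynomial.X * Polynomial.C (X (1, b)) :=
    fun b => by simp [φ]
  have hφX1 : ∀ b, φ (X (1, b)) = Polynomial.C (X (1, b)) := fun b => by simp [φ]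
  have hder : ∀ f, Polynomial.derivative (φ f) = φ (rowDer 1 0 f) := by
    intro f
    induction f using MvPolynomial.induction_on with
    | C a =>
      have : φ (C a) = Polynomial.C (C a) := by
        rw [← algebraMap_eq, AlgHom.commutes]
        rfl
      simp [this]
    | add f g hf hg => simp only [map_add, hf, hg]
    | mul_X f i hf =>
      obtain ⟨r, b⟩ := i
      rw [map_mul, Polynomial.derivative_mul, hf, Derivation.leibniz, map_add, smul_eq_mul,
        smul_eq_mul, map_mul, map_mul]
      have hX : rowDer 1 0 (X (r, b)) = if r = 0 then (X (1, b) : MvPolynomial (Fin 2 × Fin n) ℝ)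
          else 0 := by simp [rowDer, mkDerivation_X]
      rw [hX]
      fin_cases r
      · simp only [Fin.zero_eta, hφX0, hφX1, if_true, Polynomial.derivative_add,
          Polynomial.derivative_C, Polynomial.derivative_X, Polynomial.derivative_mul]
        ring
      · simp [hφX1]
        ring
  have hW' : Polynomial.derivative (φ V) = Polynomial.C (euclid n 1 1) * φ W := by
    rw [hder, hW, map_mul]
    congr 1
    rw [euclid_eq, map_sum, map_sum]
    exact Finset.sum_congr rfl fun b _ => by rw [map_mul, hφX1, ← Polynomial.C_mul]
  have hev : ∀ c : ℝ, ∀ f, (φ f).eval (C c) =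
      aeval (fun i => if i.1 = 0 then X i + C c * X (1, i.2) else X i) f := by
    intro c f
    induction f using MvPolynomial.induction_on with
    | C a =>
      have : φ (C a) = Polynomial.C (C a) := by
        rw [← algebraMap_eq, AlgHom.commutes]
        rfl
      rw [this, Polynomial.eval_C]
      simp
    | add f g hf hg => rw [map_add, Polynomial.eval_add, hf, hg, map_add]
    | mul_X f i hf =>
      rw [map_mul, Polynomial.eval_mul, hf, map_mul, aeval_X]
      obtain ⟨r, b⟩ := i
      fin_cases r
      · simp
        exact Or.inl (mul_comm _ _)
      · simp
  have h := dvd_eval_sub_eval_zero hW' (C (-1))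
  have h0 : (φ V).eval 0 = V := by
    rw [← C_0, hev]
    conv_rhs => rw [← AlgHom.id_apply (R := ℝ) V, ← aeval_X_left]
    congr 2
    funext i
    simp
  rw [h0, hev] at h
  convert h using 5 with i
  simp [sub_eq_add_neg]

/-- The restriction of functions of two ambient vectors to `Φ(x)` and `p_b Ψ^b(x)`. -/
noncomputable def restrict (n : ℕ) :
    MvPolynomial (Fin 2 × AmbIndex n) ℝ →ₐ[ℝ] MvPolynomial (Fin 2 × Fin n) ℝ :=
  aeval fun
    | (0, .inl _) => -(C (1 / 2) * euclid n 0 0)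
    | (0, .inr (.inl b)) => X (0, b)
    | (0, .inr (.inr _)) => 1
    | (1, .inl _) => -euclid n 0 1
    | (1, .inr (.inl b)) => X (1, b)
    | (1, .inr (.inr _)) => 0

theorem restrict_dot (r r' : Fin 2) :
    restrict n (dot (ambMid r) (ambMid r') Finset.univ) = euclid n r r' := by
  rw [euclid_eq, dot, map_sum]
  refine Finset.sum_congr rfl fun b _ => ?_
  rw [map_mul]
  congr 1
  · fin_cases r <;> simp [restrict]
  · fin_cases r' <;> simp [restrict]

/-- Φ is null and orthogonal to the Ψ^b, and p_b Ψ^b has square p², so two of the generators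
restrict to zero and the third to p². -/
theorem euclid_dvd_restrict {f : MvPolynomial (Fin 2 × AmbIndex n) ℝ}
    (hf : f ∈ nullIdeal (ambientMetric n)) : euclid n 1 1 ∣ restrict n f := by
  obtain ⟨a, b, c, rfl⟩ := mem_nullIdeal_iff.1 hf
  have h2 : (C (1 / 2) : MvPolynomial (Fin 2 × Fin n) ℝ) * 2 = 1 := by
    rw [← map_ofNat C 2, ← C_mul]
    norm_num
  have e0 : restrict n (metricForm (ambientMetric n) 0 0) = 0 := by
    rw [metricForm_ambientMetric, map_add, restrict_dot]
    simp only [restrict, map_add, map_mul, aeval_X]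
    linear_combination (-euclid n 0 0) * h2
  have e1 : restrict n (metricForm (ambientMetric n) 0 1) = 0 := by
    rw [metricForm_ambientMetric, map_add, restrict_dot]
    simp only [restrict, map_add, map_mul, aeval_X]
    ring
  have e2 : restrict n (metricForm (ambientMetric n) 1 1) = euclid n 1 1 := by
    rw [metricForm_ambientMetric, map_add, restrict_dot]
    simp only [restrict, map_add, map_mul, aeval_X]
    ring
  rw [map_add, map_add, map_mul, map_mul, map_mul, e0, e1, e2, mul_zero, mul_zero, zero_add,
    zero_add]
  exact dvd_mul_left _ _

/-- Every polynomial conformal Killing tensor comes from an ambient tensor, modulo traces. -/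
theorem exists_ambientKilling_of_poly (hn : 3 ≤ n) {d s : ℕ}
    {V : MvPolynomial (Fin 2 × Fin n) ℝ} (hV : IsWeightedHomogeneous (rowWeight (Fin n)) V (d, s))
    (hK : euclid n 1 1 ∣ rowDer 1 0 V) :
    ∃ T ∈ ambientKilling n s, euclid n 1 1 ∣ V - restrict n (toPoly T) := by
  let y : MvPolynomial (Fin 2 × AmbIndex n) ℝ := X (ambInf n 0)
  let z : MvPolynomial (Fin 2 × AmbIndex n) ℝ := X (ambInf n 1)
  let x : Fin n → MvPolynomial (Fin 2 × AmbIndex n) ℝ := fun b => X (ambMid 0 b)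
  let p : Fin n → MvPolynomial (Fin 2 × AmbIndex n) ℝ := fun b => X (ambMid 1 b)
  -- The vector yp - zx is null modulo the ideal, is annihilated by X·∂/∂P, and restricts to p
  -- because y becomes 1 and z becomes 0.
  let q : Fin n → MvPolynomial (Fin 2 × AmbIndex n) ℝ := fun b => y * p b - z * x b
  let G : MvPolynomial (Fin 2 × AmbIndex n) ℝ := aeval (fun i => if i.1 = 0 then x i.2 else q i.2) V
  let G' : MvPolynomial (Fin 2 × AmbIndex n) ℝ := aeval (fun i => if i.1 = 0 then p i.2 else q i.2) V
  have hscale : ∀ (t : MvPolynomial (Fin 2 × AmbIndex n) ℝ) (u v : Fin n → _),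
      aeval (fun i : Fin 2 × Fin n => if i.1 = 0 then t * u i.2 else v i.2) V =
        t ^ d * aeval (fun i : Fin 2 × Fin n => if i.1 = 0 then u i.2 else v i.2) V := by
    intro t u v
    have h := aeval_scale hV t 1 fun i : Fin 2 × Fin n => if i.1 = 0 then u i.2 else v i.2
    rw [one_pow, mul_one] at h
    rw [← h]
    congr 2
    funext i
    obtain ⟨r, b⟩ := i
    fin_cases r <;> simp [rowWeight]
  have hqq : ∑ b, q b * q b ∈ nullIdeal (ambientMetric n) := by
    have h : ∑ b, q b * q b = y ^ 2 * metricForm (ambientMetric n) 1 1 -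
        2 * y * z * metricForm (ambientMetric n) 0 1 +
        z ^ 2 * metricForm (ambientMetric n) 0 0 := by
      simp only [metricForm_ambientMetric, dot]
      have : ∑ b, q b * q b = y ^ 2 * ∑ b, p b * p b - 2 * y * z * ∑ b, x b * p b +
          z ^ 2 * ∑ b, x b * x b := by
        simp only [Finset.mul_sum, ← Finset.sum_add_distrib, ← Finset.sum_sub_distrib]
        exact Finset.sum_congr rfl fun b _ => by ring
      rw [this]
      simp only [x, p, y, z]
      ring
    rw [h]
    exact add_mem (sub_mem (Ideal.mul_mem_left _ _ (metricForm_mem_nullIdeal _ _ _))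
      (Ideal.mul_mem_left _ _ (metricForm_mem_nullIdeal _ _ _)))
      (Ideal.mul_mem_left _ _ (metricForm_mem_nullIdeal _ _ _))
  -- In V(x - p, p) ≡ V(x, p) modulo p², substitute yp for x and q for p: then x - p becomes zx, and
  -- homogeneity of degree d pulls out z^d and y^d.
  have hGG : z ^ d * G - y ^ d * G' ∈ nullIdeal (ambientMetric n) := by
    obtain ⟨W, hW⟩ := euclid_dvd_shift_sub hK
    let α : MvPolynomial (Fin 2 × Fin n) ℝ →ₐ[ℝ] MvPolynomial (Fin 2 × AmbIndex n) ℝ :=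
      aeval fun i => if i.1 = 0 then y * p i.2 else q i.2
    have h1 := congrArg α hW
    have e1 : α (euclid n 1 1) = ∑ b, q b * q b := by
      simp [euclid_eq, α]
    have e2 : α V = y ^ d * G' := hscale y p q
    have e3 : α (aeval (fun i => if i.1 = 0 then X i - X (1, i.2) else X i) V) = z ^ d * G := by
      rw [← hscale z x q, ← AlgHom.comp_apply, comp_aeval]
      congr 2
      funext i
      obtain ⟨r, b⟩ := i
      fin_cases r
      · simp [α, q]
      · simp [α]
    rw [map_sub, map_mul, e1, e2, e3] at h1
    rw [h1]
    exact Ideal.mul_mem_right _ _ hqq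
  obtain ⟨F', hF'⟩ := exists_of_X_inf_pow_mul hn d d hGG
  have hyw : IsWeightedHomogeneous (rowWeight (AmbIndex n)) y (1, 0) :=
    isWeightedHomogeneous_X ℝ (rowWeight (AmbIndex n)) (ambInf n 0)
  have hzw : IsWeightedHomogeneous (rowWeight (AmbIndex n)) z (0, 1) :=
    isWeightedHomogeneous_X ℝ (rowWeight (AmbIndex n)) (ambInf n 1)
  have hxw : ∀ b, IsWeightedHomogeneous (rowWeight (AmbIndex n)) (x b) (1, 0) := fun b =>
    isWeightedHomogeneous_X ℝ (rowWeight (AmbIndex n)) (ambMid 0 b)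
  have hpw : ∀ b, IsWeightedHomogeneous (rowWeight (AmbIndex n)) (p b) (0, 1) := fun b =>
    isWeightedHomogeneous_X ℝ (rowWeight (AmbIndex n)) (ambMid 1 b)
  have hGw : IsWeightedHomogeneous (rowWeight (AmbIndex n)) G (d + s, s) := by
    let φ : ℕ × ℕ →+ ℕ × ℕ :=
      { toFun := fun m => (m.1 + m.2, m.2)
        map_zero' := rfl
        map_add' := fun a b => by ext <;> simp; ring }
    refine isWeightedHomogeneous_aeval φ (fun i => ?_) hV
    obtain ⟨r, b⟩ := i
    fin_cases r
    · exact hxw b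
    · exact (hyw.mul (hpw b)).sub (hzw.mul (hxw b))
  -- G has bidegree (d + s, s) and y^d has (d, 0), so only this component of the quotient matters.
  set F := weightedHomogeneousComponent (rowWeight (AmbIndex n)) (s, s) F' with hF
  have hGF : G - y ^ d * F ∈ nullIdeal (ambientMetric n) := by
    have h := weightedHomogeneousComponent_mem_nullIdeal _ (d + s, s) hF'
    rw [map_sub, hGw.weightedHomogeneousComponent_same] at h
    have h2 := weightedHomogeneousComponent_add_mul (hyw.pow d) (s, s) F'
    have h3 : d • ((1, 0) : ℕ × ℕ) + (s, s) = (d + s, s) := by simp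
    rw [h3] at h2
    rwa [h2] at h
  have hX : ∀ r A, rowDer 0 1 (X (r, A)) =
      if r = 1 then (X (0, A) : MvPolynomial (Fin 2 × AmbIndex n) ℝ) else 0 := fun r A => by
    simp [rowDer, mkDerivation_X]
  have hG0 : rowDer 0 1 G = 0 := by
    refine derivation_aeval_eq_zero _ (fun i => ?_) V
    obtain ⟨r, b⟩ := i
    fin_cases r
    · simp [x, hX]
    · simp [x, p, q, y, z, hX]
      ring
  have hy0 : rowDer 0 1 y = 0 := by simp [y, hX]
  have heF : rowDer 0 1 F ∈ nullIdeal (ambientMetric n) := by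
    -- X·∂/∂P kills both G and y, so y^d times its value on F lies in the ideal, and y^d is
    -- cancelled.
    refine mem_nullIdeal_of_X_inf_pow_mul hn d ?_
    have h := rowDer_mem_nullIdeal _ 0 1 hGF
    rw [map_sub, hG0, Derivation.leibniz, Derivation.leibniz_pow, hy0, smul_zero, smul_zero,
      smul_zero, add_zero, zero_sub, neg_mem_iff, smul_eq_mul] at h
    exact h
  obtain ⟨T, hT, hFT⟩ := exists_ambientKilling_sub_mem
    (weightedHomogeneousComponent_isWeightedHomogeneous (w := rowWeight (AmbIndex n)) (s, s) F') heF
  refine ⟨T, hT, ?_⟩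
  have hVG : restrict n G = V := by
    rw [← AlgHom.comp_apply, comp_aeval]
    conv_rhs => rw [← AlgHom.id_apply (R := ℝ) V, ← aeval_X_left]
    congr 2
    funext i
    obtain ⟨r, b⟩ := i
    fin_cases r
    · simp [x, restrict]
    · simp [x, p, q, y, z, restrict]
  have hy1 : restrict n y = 1 := by simp [y, restrict]
  have h1 := euclid_dvd_restrict hGF
  have h2 := euclid_dvd_restrict hFT
  rw [map_sub, map_mul, map_pow, hy1, one_pow, one_mul, hVG] at h1
  rw [map_sub] at h2
  have := dvd_add h1 h2
  rwa [sub_add_sub_cancel] at this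

end Poly

/-! ### Symmetric tensors and homogeneous polynomials -/

section FormPoly

variable {ι m : Type} [Fintype ι] [DecidableEq ι] [Fintype m]

/-- The polynomial `W_{b⋯d} p^b ⋯ p^d`. -/
noncomputable def formPoly : Tens ι m →ₗ[ℝ] MvPolynomial m ℝ := ct fun _ a => X a

theorem formPoly_apply (W : Tens ι m) : formPoly W = ∑ i : ι → m, W i • ∏ q, X (i q) := rfl

theorem formPoly_permute (σ : Equiv.Perm ι) (W : Tens ι m) :
    formPoly (permute σ W) = formPoly W := by
  rw [formPoly, ct_permute]
  rfl

theorem formPoly_symmetrize (W : Tens ι m) : formPoly (symmetrize W) = formPoly W := by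
  have h : ((Fintype.card ι).factorial : ℝ) ≠ 0 := by exact_mod_cast Nat.factorial_ne_zero _
  simp only [symmetrize, LinearMap.smul_apply, LinearMap.sum_apply, map_smul, map_sum,
    formPoly_permute, Finset.sum_const, Finset.card_univ, Fintype.card_perm]
  rw [← Nat.cast_smul_eq_nsmul ℝ, smul_smul, inv_mul_cancel₀ h, one_smul]

omit [Fintype ι] [DecidableEq ι] [Fintype m] in
theorem mem_symmetric {W : Tens ι m} : W ∈ symmetric ι m ↔ ∀ σ, permute σ W = W := by
  simp [symmetric, Submodule.mem_iInf]

omit [Fintype m] in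
theorem symmetrize_mem_symmetric (W : Tens ι m) : symmetrize W ∈ symmetric ι m := by
  rw [mem_symmetric]
  intro σ
  simp only [symmetrize, LinearMap.smul_apply, LinearMap.sum_apply, map_smul, map_sum,
    permute_permute]
  congr 1
  exact Fintype.sum_equiv (Equiv.mulLeft σ) _ _ fun τ => rfl

/-- By symmetry all index functions with the same monomial have equal components, so each
coefficient is a positive multiple of a component. -/
theorem eq_zero_of_formPoly {W : Tens ι m} (hW : W ∈ symmetric ι m) (h : formPoly W = 0) :
    W = 0 := by
  classical
  rw [mem_symmetric] at hW
  funext i₀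
  let e : (ι → m) → m →₀ ℕ := fun i => ∑ q, Finsupp.single (i q) 1
  have he : ∀ i b, e i b = Fintype.card {q // i q = b} := by
    intro i b
    simp [e, Finsupp.single_apply, Fintype.card_subtype]
  have h1 := congrArg (coeff (e i₀)) h
  have h2 : ∀ i : ι → m, (∏ q, X (i q) : MvPolynomial m ℝ) = monomial (e i) 1 := by
    intro i
    simp only [e, X, monomial_sum_one]
  rw [formPoly_apply, coeff_sum, coeff_zero] at h1
  have h3 : ∀ i : ι → m, coeff (e i₀) (W i • ∏ q, X (i q)) = if e i = e i₀ then W i₀ else 0 := by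
    intro i
    rw [coeff_smul, h2, coeff_monomial]
    split_ifs with hi
    · obtain ⟨σ, hσ⟩ := exists_perm_comp_eq (f := i₀) (g := i) fun b => by
        rw [← he, ← he, hi]
      rw [smul_eq_mul, mul_one, ← hσ]
      exact congrFun (hW σ) i₀
    · simp
  rw [Finset.sum_congr rfl fun i _ => h3 i, ← Finset.sum_filter, Finset.sum_const,
    ← Nat.cast_smul_eq_nsmul ℝ, smul_eq_zero] at h1
  refine h1.resolve_left ?_
  have : 0 < (Finset.univ.filter fun i => e i = e i₀).card :=
    Finset.card_pos.2 ⟨i₀, by simp⟩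
  exact_mod_cast this.ne'

omit [DecidableEq ι] in
theorem isHomogeneous_formPoly [DecidableEq ι] (W : Tens ι m) :
    IsHomogeneous (formPoly W) (Fintype.card ι) := by
  rw [formPoly_apply]
  refine IsHomogeneous.sum _ _ _ fun i _ => ?_
  rw [smul_eq_C_mul]
  have := (isHomogeneous_C m (W i)).mul (IsHomogeneous.prod Finset.univ
    (fun q => (X (i q) : MvPolynomial m ℝ)) (fun _ => 1) fun q _ => isHomogeneous_X ℝ (i q))
  simpa using this

theorem exists_formPoly_eq [DecidableEq m] {k : ℕ} {F : MvPolynomial m ℝ} (hF : IsHomogeneous F k) :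
    ∃ W : Tens (Fin k) m, formPoly W = F := by
  have h1 : ∀ d ∈ F.support, ∃ j : Fin k → m, monomial d (1 : ℝ) = ∏ q, X (j q) := by
    intro d hd
    have h2 : ∑ b, d b = k := by
      have := hF (mem_support_iff.1 hd)
      rw [Finsupp.weight_apply, Finsupp.sum_fintype _ _ (by simp)] at this
      simpa using this
    obtain ⟨j, hj⟩ := exists_card_fiber_eq (fun b => d b) h2
    refine ⟨j, ?_⟩
    have : d = ∑ q, Finsupp.single (j q) 1 := by
      ext b
      rw [← hj b]
      simp [Finsupp.single_apply, Fintype.card_subtype]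
    conv_lhs => rw [this]
    simp only [X, monomial_sum_one]
  rcases isEmpty_or_nonempty (Fin k → m) with hE | hE
  · refine ⟨0, ?_⟩
    rw [map_zero, eq_comm, ← support_eq_empty, Finset.eq_empty_iff_forall_notMem]
    exact fun d hd => hE.elim (h1 d hd).choose
  choose! j hj using h1
  refine ⟨∑ d ∈ F.support, F.coeff d • Pi.single (j d) 1, ?_⟩
  rw [map_sum]
  conv_rhs => rw [F.as_sum]
  refine Finset.sum_congr rfl fun d hd => ?_
  rw [map_smul, formPoly_apply, Finset.sum_eq_single (j d)]
  · rw [Pi.single_eq_same, one_smul, ← hj d hd, smul_monomial, smul_eq_mul, mul_one]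
  · intro i _ hi
    rw [Pi.single_eq_of_ne hi, zero_smul]
  · simp

/-- `p_b p^b`. -/
noncomputable def normSq (m : Type) [Fintype m] : MvPolynomial m ℝ := ∑ b, X b * X b

/-- The Laplacian. -/
noncomputable def lap (F : MvPolynomial m ℝ) : MvPolynomial m ℝ := ∑ b, pderiv b (pderiv b F)

theorem fischer_normSq_mul (f h : MvPolynomial m ℝ) :
    fischer (normSq m * f) h = fischer f (lap h) := by
  simp only [normSq, lap, Finset.sum_mul, map_sum, LinearMap.sum_apply, fischer_X_mul_X_mul]

/-- If F = p² g, then ⟨F, F⟩ = ⟨g, ΔF⟩ = 0. Hence symmetric trace-free tensors may be compared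
modulo p². -/
theorem eq_zero_of_normSq_dvd {F : MvPolynomial m ℝ} (hF : lap F = 0) (h : normSq m ∣ F) :
    F = 0 := by
  refine fischer_self_eq_zero ?_
  obtain ⟨g, hg⟩ := h
  conv_lhs => rw [hg]
  rw [fischer_normSq_mul, ← hg, hF, map_zero]

theorem isHomogeneous_normSq : IsHomogeneous (normSq m) 2 :=
  IsHomogeneous.sum _ _ _ fun b _ => (isHomogeneous_X ℝ b).mul (isHomogeneous_X ℝ b)

theorem lap_formPoly [DecidableEq m] {W : Tens ι m} (hW : W ∈ traceFree ι (1 : Matrix m m ℝ)) :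
    lap (formPoly W) = 0 := by
  simp only [traceFree, Submodule.mem_iInf, LinearMap.mem_ker] at hW
  have hX : ∀ A : m, (fun B => pderiv A (X B : MvPolynomial m ℝ)) = Pi.single A 1 := by
    intro A
    funext B
    rw [pderiv_X]
  have h2 : ∀ A : m, pderiv A (pderiv A (formPoly W)) = ∑ q : ι, ∑ p : ι, if p ≠ q then
      ct (Function.update (Function.update (fun (_ : ι) B => (X B : MvPolynomial m ℝ))
          p (Pi.single A 1)) q (Pi.single A 1)) W else 0 := by
    intro A
    rw [formPoly, ct_derivation, map_sum]
    refine Finset.sum_congr rfl fun q _ => ?_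
    rw [hX, ct_derivation]
    refine Finset.sum_congr rfl fun p _ => ?_
    rcases eq_or_ne p q with rfl | hpq
    · have : (fun C => pderiv A (Function.update
          (fun (_ : ι) B => (X B : MvPolynomial m ℝ)) p (Pi.single A 1) p C)) = 0 := by
        funext C
        rw [Function.update_self]
        by_cases hC : C = A
        · subst hC; simp
        · simp [hC]
      rw [this, ct_update_zero]
      simp
    · rw [Function.update_of_ne hpq, hX, Function.update_comm hpq.symm, if_pos hpq]
  simp only [lap, h2]
  rw [Finset.sum_comm]
  refine Finset.sum_eq_zero fun q _ => ?_
  rw [Finset.sum_comm]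
  refine Finset.sum_eq_zero fun p _ => ?_
  by_cases hpq : p = q
  · simp [hpq]
  · have := ct_contract (fun (_ : ι) B => (X B : MvPolynomial m ℝ)) 1 hpq (hW p q hpq)
    simp only [Matrix.one_apply, ite_smul, one_smul, zero_smul, Finset.sum_ite_eq,
      Finset.mem_univ, if_true] at this
    simp [hpq, this]

theorem eq_of_normSq_dvd_sub [DecidableEq m] {W U : Tens ι m} (hW : W ∈ symmetric ι m)
    (hW' : W ∈ traceFree ι (1 : Matrix m m ℝ)) (hU : U ∈ symmetric ι m)
    (hU' : U ∈ traceFree ι (1 : Matrix m m ℝ)) (h : normSq m ∣ formPoly W - formPoly U) :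
    W = U := by
  rw [← sub_eq_zero]
  refine eq_zero_of_formPoly (sub_mem hW hU) ?_
  refine eq_zero_of_normSq_dvd (lap_formPoly (sub_mem hW' hU')) ?_
  rwa [map_sub]

end FormPoly

theorem sum_fin_cons {M : Type} [AddCommMonoid M] {k : ℕ} {m : Type} [Fintype m]
    (f : (Fin (k + 1) → m) → M) : ∑ j, f j = ∑ a, ∑ i : Fin k → m, f (Fin.cons a i) := by
  rw [← Fintype.sum_prod_type']
  exact (Fintype.sum_equiv (Fin.consEquiv fun _ => m) _ _ fun x => rfl).symm

/-! ### Pure traces and divisibility by p² -/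

section

variable {n : ℕ}

theorem formPoly_metricTensor {k : ℕ} (l : Tens (Fin k) (Fin n)) :
    formPoly (metricTensor l) = normSq (Fin n) * formPoly l := by
  rw [formPoly_apply, sum_fin_cons]
  simp only [sum_fin_cons, metricTensor, LinearMap.coe_mk, AddHom.coe_mk, Fin.cons_zero,
    Fin.cons_one, Fin.tail_cons, Fin.prod_univ_succ, Fin.cons_succ, Matrix.one_apply, ite_mul,
    one_mul, zero_mul, ite_smul, zero_smul]
  rw [normSq, formPoly_apply, Finset.sum_mul]
  refine Finset.sum_congr rfl fun a _ => ?_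
  rw [Finset.sum_eq_single a, Finset.mul_sum]
  · refine Finset.sum_congr rfl fun i _ => ?_
    rw [if_pos rfl, mul_smul_comm]
    congr 1
    ring
  · intro b _ hb
    simp [hb.symm]
  · simp

/-- A tensor is pure trace after symmetrisation if and only if its polynomial is divisible by
`p²`. -/
theorem symmetrize_mem_pureTrace_iff {k : ℕ} (W : Tens (Fin k) (Fin n)) :
    symmetrize W ∈ pureTrace n k ↔ normSq (Fin n) ∣ formPoly W := by
  -- With fewer than two indices a nonzero multiple of p² has too large a degree, in agreement with
  -- `pureTrace` being trivial there.
  have hlow : k < 2 → (symmetrize W = 0 ↔ normSq (Fin n) ∣ formPoly W) := by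
    intro hk
    constructor
    · intro h
      rw [← formPoly_symmetrize, h, map_zero]
      exact dvd_zero _
    · rintro ⟨g, hg⟩
      refine eq_zero_of_formPoly (symmetrize_mem_symmetric W) ?_
      rw [formPoly_symmetrize]
      by_contra hne
      have h1 := (isHomogeneous_formPoly W).totalDegree hne
      rw [hg] at h1 hne
      have hs := left_ne_zero_of_mul hne
      rw [totalDegree_mul_of_isDomain hs (right_ne_zero_of_mul hne),
        isHomogeneous_normSq.totalDegree hs, Fintype.card_fin] at h1
      omega
  match k, W, hlow with
  | 0, W, hlow => exact Iff.trans (Submodule.mem_bot ℝ) (hlow (by omega))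
  | 1, W, hlow => exact Iff.trans (Submodule.mem_bot ℝ) (hlow (by omega))
  | k + 2, W, _ =>
    change symmetrize W ∈ LinearMap.range (symmetrize ∘ₗ metricTensor) ↔ _
    constructor
    · rintro ⟨l, hl⟩
      rw [← formPoly_symmetrize, ← hl, LinearMap.comp_apply, formPoly_symmetrize,
        formPoly_metricTensor]
      exact dvd_mul_right _ _
    · rintro ⟨g, hg⟩
      have h1 : formPoly W = normSq (Fin n) * homogeneousComponent k g := by
        have h2 := weightedHomogeneousComponent_add_mul (w := (1 : Fin n → ℕ))
          (isHomogeneous_normSq (m := Fin n)) k g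
        have h3 : IsWeightedHomogeneous (1 : Fin n → ℕ) (formPoly W) (2 + k) := by
          have h4 : Fintype.card (Fin (k + 2)) = 2 + k := by rw [Fintype.card_fin, add_comm]
          exact h4 ▸ isHomogeneous_formPoly W
        rw [← hg, h3.weightedHomogeneousComponent_same] at h2
        exact h2
      obtain ⟨l, hl⟩ := exists_formPoly_eq (homogeneousComponent_isHomogeneous k g)
      refine ⟨l, ?_⟩
      rw [← sub_eq_zero]
      refine eq_zero_of_formPoly (sub_mem (symmetrize_mem_symmetric _)
        (symmetrize_mem_symmetric _)) ?_
      rw [map_sub, LinearMap.comp_apply, formPoly_symmetrize, formPoly_symmetrize,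
        formPoly_metricTensor, hl, h1, sub_self]

/-! ### Polynomial tensor fields -/

theorem hasFDerivAt_eval (f : MvPolynomial (Fin n) ℝ) (x : EuclideanSpace ℝ (Fin n)) :
    HasFDerivAt (fun y : EuclideanSpace ℝ (Fin n) => eval y.ofLp f)
      (∑ a, eval x.ofLp (pderiv a f) • (EuclideanSpace.proj a : EuclideanSpace ℝ (Fin n) →L[ℝ] ℝ))
      x := by
  induction f using MvPolynomial.induction_on with
  | C a =>
    simp only [eval_C, pderiv_C, map_zero, zero_smul, Finset.sum_const_zero]
    exact hasFDerivAt_const _ _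
  | add f g hf hg =>
    simp only [map_add, add_smul, Finset.sum_add_distrib]
    exact hf.add hg
  | mul_X f i hf =>
    have hX : HasFDerivAt (fun y : EuclideanSpace ℝ (Fin n) => y.ofLp i)
        (EuclideanSpace.proj i : EuclideanSpace ℝ (Fin n) →L[ℝ] ℝ) x :=
      (EuclideanSpace.proj i : EuclideanSpace ℝ (Fin n) →L[ℝ] ℝ).hasFDerivAt
    have h := hf.mul hX
    simp only [map_mul, eval_X]
    refine h.congr_fderiv ?_
    simp only [Derivation.leibniz, smul_eq_mul, map_add, map_mul, eval_X, pderiv_X, add_smul,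
      Finset.sum_add_distrib, Finset.smul_sum, smul_smul]
    congr 1
    rw [Finset.sum_eq_single i]
    · simp
    · intro b _ hb
      simp [hb.symm]
    · simp

theorem partialDeriv_eval (a : Fin n) (f : MvPolynomial (Fin n) ℝ) (x : EuclideanSpace ℝ (Fin n)) :
    partialDeriv a (fun y => eval y.ofLp f) x = eval x.ofLp (pderiv a f) := by
  rw [partialDeriv, (hasFDerivAt_eval f x).fderiv]
  simp

theorem contDiff_eval (f : MvPolynomial (Fin n) ℝ) :
    ContDiff ℝ ∞ fun y : EuclideanSpace ℝ (Fin n) => eval y.ofLp f := by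
  induction f using MvPolynomial.induction_on with
  | C a => simpa using contDiff_const
  | add f g hf hg => simpa using hf.add hg
  | mul_X f i hf =>
    simp only [map_mul, eval_X]
    exact hf.mul (EuclideanSpace.proj i : EuclideanSpace ℝ (Fin n) →L[ℝ] ℝ).contDiff

variable {s : ℕ}

/-- The tensor field with polynomial components `v`. -/
noncomputable def polyField (v : (Fin s → Fin n) → MvPolynomial (Fin n) ℝ) : TensorField n s :=
  fun x i => eval x.ofLp (v i)

/-- The function `v_{b⋯d}(x) p^b ⋯ p^d` of two vectors. -/
noncomputable def genPoly (v : (Fin s → Fin n) → MvPolynomial (Fin n) ℝ) :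
    MvPolynomial (Fin 2 × Fin n) ℝ := ∑ i, rename (Prod.mk 0) (v i) * ∏ k, X (1, i k)

/-- Evaluation at a point `x`, as a polynomial in `p`. -/
noncomputable def evalAt (x : EuclideanSpace ℝ (Fin n)) :
    MvPolynomial (Fin 2 × Fin n) ℝ →ₐ[ℝ] MvPolynomial (Fin n) ℝ :=
  aeval fun q => if q.1 = 0 then C (x.ofLp q.2) else X q.2

theorem evalAt_X_zero (x : EuclideanSpace ℝ (Fin n)) (b : Fin n) :
    evalAt x (X (0, b)) = C (x.ofLp b) := by simp [evalAt]

theorem evalAt_X_one (x : EuclideanSpace ℝ (Fin n)) (b : Fin n) :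
    evalAt x (X (1, b)) = X b := by simp [evalAt]

theorem evalAt_rename (x : EuclideanSpace ℝ (Fin n)) (f : MvPolynomial (Fin n) ℝ) :
    evalAt x (rename (Prod.mk 0) f) = C (eval x.ofLp f) := by
  induction f using MvPolynomial.induction_on with
  | C a => simp [evalAt]
  | add f g hf hg => simp only [map_add, hf, hg]
  | mul_X f i hf => rw [map_mul, map_mul, hf, rename_X, evalAt_X_zero, map_mul, eval_X, C_mul]

theorem evalAt_genPoly (v : (Fin s → Fin n) → MvPolynomial (Fin n) ℝ)
    (x : EuclideanSpace ℝ (Fin n)) : evalAt x (genPoly v) = formPoly (polyField v x) := by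
  rw [genPoly, map_sum, formPoly_apply]
  refine Finset.sum_congr rfl fun i _ => ?_
  rw [map_mul, map_prod, evalAt_rename, smul_eq_C_mul]
  simp only [evalAt_X_one]
  rfl

theorem rowDer_rename (f : MvPolynomial (Fin n) ℝ) :
    rowDer 1 0 (rename (Prod.mk 0) f) = ∑ a, X (1, a) * rename (Prod.mk (0 : Fin 2)) (pderiv a f) := by
  induction f using MvPolynomial.induction_on with
  | C a => simp
  | add f g hf hg => simp only [map_add, hf, hg, mul_add, Finset.sum_add_distrib]
  | mul_X f i hf =>
    have hX : rowDer 1 0 (X ((0 : Fin 2), i)) = (X (1, i) : MvPolynomial (Fin 2 × Fin n) ℝ) := by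
      simp [rowDer, mkDerivation_X]
    rw [map_mul, rename_X, Derivation.leibniz, hX, hf]
    simp only [Derivation.leibniz, smul_eq_mul, map_add, map_mul, rename_X, pderiv_X, mul_add,
      Finset.sum_add_distrib, Finset.mul_sum]
    congr 1
    · rw [Finset.sum_eq_single i]
      · simp [mul_comm]
      · intro b _ hb
        simp [hb.symm]
      · simp
    · exact Finset.sum_congr rfl fun a _ => by ring

theorem evalAt_rowDer_genPoly (v : (Fin s → Fin n) → MvPolynomial (Fin n) ℝ)
    (x : EuclideanSpace ℝ (Fin n)) :
    evalAt x (rowDer 1 0 (genPoly v)) = formPoly (grad (polyField v) x) := by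
  have hX : ∀ b, rowDer 1 0 (X ((1 : Fin 2), b)) = (0 : MvPolynomial (Fin 2 × Fin n) ℝ) := by
    intro b
    simp [rowDer, mkDerivation_X]
  rw [genPoly, map_sum, map_sum, formPoly_apply, sum_fin_cons, Finset.sum_comm]
  refine Finset.sum_congr rfl fun i _ => ?_
  rw [Derivation.leibniz, derivation_prod, Finset.sum_eq_zero fun q _ => by rw [hX, zero_mul],
    smul_zero, zero_add, smul_eq_mul, map_mul, rowDer_rename, map_sum, map_prod, Finset.mul_sum]
  simp only [map_mul, evalAt_X_one, evalAt_rename]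
  refine Finset.sum_congr rfl fun a _ => ?_
  simp only [grad, polyField, Fin.cons_zero, Fin.tail_cons, Fin.prod_univ_succ, Fin.cons_succ,
    smul_eq_C_mul, partialDeriv_eval]
  ring

theorem evalAt_laplace (x : EuclideanSpace ℝ (Fin n)) (f : MvPolynomial (Fin 2 × Fin n) ℝ) :
    evalAt x (laplace 1 1 1 f) = lap (evalAt x f) := by
  have h1 : ∀ (a : Fin n) (f : MvPolynomial (Fin 2 × Fin n) ℝ),
      evalAt x (pderiv (1, a) f) = pderiv a (evalAt x f) := by
    intro a f
    induction f using MvPolynomial.induction_on with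
    | C a => simp [evalAt]
    | add f g hf hg => simp only [map_add, hf, hg]
    | mul_X f i hf =>
      obtain ⟨r, b⟩ := i
      rw [Derivation.leibniz, map_mul, Derivation.leibniz, map_add, smul_eq_mul, smul_eq_mul,
        smul_eq_mul, smul_eq_mul, map_mul, map_mul, hf]
      congr 2
      fin_cases r
      · simp [evalAt, pderiv_X]
      · simp [evalAt, pderiv_X, Pi.single_apply, Prod.ext_iff]
  simp only [laplace, lap, map_sum, h1, Matrix.one_apply, ite_smul, one_smul, zero_smul,
    Finset.sum_ite_eq, Finset.mem_univ, if_true]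

theorem eval_evalAt (y : Fin 2 × Fin n → ℝ) (f : MvPolynomial (Fin 2 × Fin n) ℝ) :
    eval (fun b => y (1, b)) (evalAt (WithLp.toLp 2 fun b => y (0, b)) f) = eval y f := by
  induction f using MvPolynomial.induction_on with
  | C a => simp [evalAt]
  | add f g hf hg => simp only [map_add, hf, hg]
  | mul_X f i hf =>
    obtain ⟨r, b⟩ := i
    rw [map_mul, map_mul, hf, map_mul]
    fin_cases r <;> simp [evalAt]

theorem eq_zero_of_evalAt {f : MvPolynomial (Fin 2 × Fin n) ℝ} (h : ∀ x, evalAt x f = 0) :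
    f = 0 := by
  refine MvPolynomial.funext fun y => ?_
  rw [← eval_evalAt, h, map_zero, map_zero]

theorem evalAt_euclid (x : EuclideanSpace ℝ (Fin n)) :
    evalAt x (euclid n 1 1) = normSq (Fin n) := by
  simp [euclid_eq, normSq, evalAt_X_one]

/-- Divisibility by `p²` may be checked pointwise. -/
theorem euclid_dvd_iff {f : MvPolynomial (Fin 2 × Fin n) ℝ} :
    euclid n 1 1 ∣ f ↔ ∀ x, normSq (Fin n) ∣ evalAt x f := by
  constructor
  · rintro ⟨g, rfl⟩ x
    rw [map_mul, evalAt_euclid]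
    exact dvd_mul_right _ _
  · intro h
    -- The pointwise quotients need not a priori depend polynomially on x. The remainder of the
    -- Fischer decomposition in p is used instead: at every x it is harmonic and divisible by p²,
    -- hence zero.
    obtain ⟨a, ha⟩ := fischer_decomposition (κ := Unit)
      (fun _ => euclid n 1 1) (fun _ => laplace 1 1 1)
      (fun _ => (isHomogeneous_metricForm _ 1 1).totalDegree_le)
      (fun _ a h => fischer_metricForm_mul _ 1 1 a h)
      (fun _ N h hN => totalDegree_laplace_le _ 1 1 hN) f
    have h0 := ha ()
    rw [Fintype.sum_unique] at h0
    refine ⟨a default, ?_⟩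
    rw [← sub_eq_zero]
    refine eq_zero_of_evalAt fun x => eq_zero_of_normSq_dvd ?_ ?_
    · rw [← evalAt_laplace, h0, map_zero]
    · rw [map_sub, map_mul, evalAt_euclid]
      exact dvd_sub (h x) (dvd_mul_right _ _)

end

/-! ### The tensor fields that come from ambient tensors -/

section Frame

variable {n : ℕ}

/-- `Φ^B` with polynomial entries. -/
noncomputable def phiUp (n : ℕ) : AmbIndex n → MvPolynomial (Fin n) ℝ
  | .inl _ => 1
  | .inr (.inl b) => X b
  | .inr (.inr _) => -(C (1 / 2) * ∑ b, X b * X b)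

/-- `Ψ^{bQ}` with polynomial entries. -/
noncomputable def psiUp (b : Fin n) : AmbIndex n → MvPolynomial (Fin n) ℝ
  | .inl _ => 0
  | .inr (.inl q) => if b = q then 1 else 0
  | .inr (.inr _) => -X b

/-- The constant null vector at infinity. -/
noncomputable def iotaUp (n : ℕ) : AmbIndex n → MvPolynomial (Fin n) ℝ
  | .inl _ => 0
  | .inr (.inl _) => 0
  | .inr (.inr _) => 1

/-- Lowering an index. -/
def lowP {R : Type} (v : AmbIndex n → R) : AmbIndex n → R
  | .inl _ => v (.inr (.inr ()))
  | .inr (.inl b) => v (.inr (.inl b))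
  | .inr (.inr _) => v (.inl ())

theorem lower_eq_lowP (v : AmbIndex n → ℝ) : lower v = lowP v := by
  funext B
  rcases B with _ | _ | _ <;>
    simp [lower, lowP, ambientMetric, Fintype.sum_sum_type, Matrix.one_apply]

theorem eval_phiUp (x : EuclideanSpace ℝ (Fin n)) (B : AmbIndex n) :
    eval x.ofLp (phiUp n B) = Phi x B := by
  rcases B with _ | _ | _ <;> simp [phiUp, Phi]
  ring

theorem eval_psiUp (x : EuclideanSpace ℝ (Fin n)) (b : Fin n) (B : AmbIndex n) :
    eval x.ofLp (psiUp b B) = Psi x b B := by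
  rcases B with _ | q | _ <;> simp [psiUp, Psi, Matrix.one_apply]

theorem eval_lowP (x : EuclideanSpace ℝ (Fin n)) (v : AmbIndex n → MvPolynomial (Fin n) ℝ)
    (B : AmbIndex n) : eval x.ofLp (lowP v B) = lower (fun A => eval x.ofLp (v A)) B := by
  rw [lower_eq_lowP]
  rcases B with _ | _ | _ <;> rfl

theorem pderiv_phiUp (a : Fin n) (B : AmbIndex n) : pderiv a (phiUp n B) = psiUp a B := by
  have h2 : (C (1 / 2) : MvPolynomial (Fin n) ℝ) * 2 = 1 := by
    rw [← map_ofNat C 2, ← C_mul]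
    norm_num
  rcases B with _ | b | _
  · simp [phiUp, psiUp]
  · simp [phiUp, psiUp, pderiv_X, Pi.single_apply, eq_comm]
  · simp only [phiUp, psiUp, map_neg, Derivation.leibniz, pderiv_C, map_sum,
      pderiv_X, smul_eq_mul, Finset.sum_add_distrib]
    rw [Finset.sum_eq_single a]
    · simp only [Pi.single_eq_same]
      linear_combination (-X a) * h2
    · intro b _ hb
      simp [hb.symm]
    · simp

theorem pderiv_psiUp (a b : Fin n) (B : AmbIndex n) :
    pderiv a (psiUp b B) = -((if a = b then 1 else 0) * iotaUp n B) := by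
  rcases B with _ | q | _
  · simp [psiUp, iotaUp]
  · simp only [psiUp, iotaUp, mul_zero, neg_zero]
    split_ifs <;> simp
  · simp [psiUp, iotaUp, pderiv_X, Pi.single_apply, eq_comm]

/-- The expansion of a covector in the frame `Φ_B`, `Ψ_{aB}`, `I_B`. -/
theorem frame_expansion (v : AmbIndex n → MvPolynomial (Fin n) ℝ) :
    v = ∑ a, (∑ Q, v Q * psiUp a Q) • lowP (psiUp a) + (∑ Q, v Q * iotaUp n Q) • lowP (phiUp n) +
      (∑ Q, v Q * phiUp n Q) • lowP (iotaUp n) := by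
  have h2 : (C (1 / 2) : MvPolynomial (Fin n) ℝ) * 2 = 1 := by
    rw [← map_ofNat C 2, ← C_mul]
    norm_num
  funext E
  simp only [Pi.add_apply, Finset.sum_apply, Pi.smul_apply, smul_eq_mul]
  rcases E with _ | b | _
  · simp only [Fintype.sum_sum_type, lowP, psiUp, phiUp, iotaUp, Fintype.sum_unique, mul_zero,
      mul_ite, mul_one, Finset.sum_ite_eq, Finset.mem_univ, if_true, zero_add, Finset.sum_const_zero]
    have : ∑ a, (v (.inr (.inl a)) + v (.inr (.inr default)) * -X a) * -X a =
        -∑ a, v (.inr (.inl a)) * X a + v (.inr (.inr default)) * ∑ a, X a * X a := by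
      rw [Finset.mul_sum, ← Finset.sum_neg_distrib, ← Finset.sum_add_distrib]
      exact Finset.sum_congr rfl fun a _ => by ring
    rw [this]
    change v (.inl ()) = _
    change _ = -∑ a, v (.inr (.inl a)) * X a + v (.inr (.inr ())) * ∑ a, X a * X a +
      v (.inr (.inr ())) * -(C (1 / 2) * ∑ b, X b * X b) + (v (.inl ()) + (_ +
        v (.inr (.inr ())) * -(C (1 / 2) * ∑ b, X b * X b)))
    linear_combination (v (.inr (.inr ())) * ∑ b, X b * X b) * h2
  · simp only [Fintype.sum_sum_type, lowP, psiUp, phiUp, iotaUp, Fintype.sum_unique, mul_zero,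
      mul_ite, mul_one, Finset.sum_ite_eq, Finset.sum_ite_eq', Finset.mem_univ, if_true, zero_add,
      Finset.sum_const_zero]
    ring
  · simp only [Fintype.sum_sum_type, lowP, psiUp, phiUp, iotaUp, Fintype.sum_unique, mul_zero,
      mul_one, zero_add, Finset.sum_const_zero, add_zero]

/-- Completeness of the frame, in which Φ and the constant vector I form a null pair; it splits an
ambient trace into a Euclidean one and two mixed terms. -/
theorem sum_psi_psi (A B : AmbIndex n) :
    ∑ a, lowP (psiUp a) A * lowP (psiUp a) B + lowP (phiUp n) A * lowP (iotaUp n) B +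
      lowP (iotaUp n) A * lowP (phiUp n) B = C (ambientMetric n A B) := by
  have h2 : (C 2⁻¹ : MvPolynomial (Fin n) ℝ) * 2 = 1 := by
    rw [← map_ofNat C 2, ← C_mul]
    norm_num
  rcases A with _ | a | _ <;> rcases B with _ | b | _ <;>
    simp [lowP, psiUp, phiUp, iotaUp, ambientMetric, Matrix.one_apply]
  · linear_combination (-∑ b : Fin n, (X b : MvPolynomial (Fin n) ℝ) * X b) * h2
  · split_ifs <;> simp_all

variable {s : ℕ}

/-- The covectors that are contracted with an ambient tensor. -/
noncomputable def covec (i : Fin s → Fin n) (q : Fin s × Fin 2) :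
    AmbIndex n → MvPolynomial (Fin n) ℝ :=
  if q.2 = 0 then lowP (phiUp n) else lowP (psiUp (i q.1))

/-- The components of the tensor field that comes from an ambient tensor. -/
noncomputable def fieldPoly (T : AmbTensor n s) (i : Fin s → Fin n) : MvPolynomial (Fin n) ℝ :=
  ct (covec i) T

theorem ambientToField_eq (T : AmbTensor n s) : ambientToField T = polyField (fieldPoly T) := by
  funext x i
  have h1 : ∀ A, eval x.ofLp (lowP (phiUp n) A) = lower (Phi x) A := fun A => by
    rw [eval_lowP]
    simp only [eval_phiUp]
  have h2 : ∀ b A, eval x.ofLp (lowP (psiUp b) A) = lower (Psi x b) A := fun b A => by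
    rw [eval_lowP]
    simp only [eval_psiUp]
  simp only [polyField, fieldPoly, ct_apply, map_sum, smul_eval, map_prod, ambientToField]
  refine Finset.sum_congr rfl fun I _ => ?_
  rw [Fintype.prod_prod_type]
  congr 1
  refine Finset.prod_congr rfl fun k _ => ?_
  rw [Fin.prod_univ_two]
  simp [covec, h1, h2]

theorem restrict_X_zero (A : AmbIndex n) :
    restrict n (X (0, A)) = rename (Prod.mk 0) (lowP (phiUp n) A) := by
  rcases A with _ | _ | _ <;> simp [restrict, lowP, phiUp, euclid_eq]

theorem restrict_X_one (A : AmbIndex n) :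
    restrict n (X (1, A)) = ∑ b, rename (Prod.mk 0) (lowP (psiUp b) A) * X (1, b) := by
  rcases A with _ | _ | _
  · simp [restrict, lowP, psiUp, euclid_eq]
  · simp only [restrict, aeval_X, lowP, psiUp]
    rw [Finset.sum_eq_single]
    · rw [if_pos rfl, map_one, one_mul]
    · intro b _ hb
      rw [if_neg hb, map_zero, zero_mul]
    · simp
  · simp [restrict, lowP, psiUp]

theorem genPoly_fieldPoly (T : AmbTensor n s) : genPoly (fieldPoly T) = restrict n (toPoly T) := by
  rw [toPoly, ct_map]
  simp only [genPoly, fieldPoly, ct_apply, map_sum, map_smul, map_prod, Finset.sum_mul]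
  rw [Finset.sum_comm]
  refine Finset.sum_congr rfl fun I _ => ?_
  simp only [smul_mul_assoc, ← Finset.smul_sum]
  congr 1
  simp only [Fintype.prod_prod_type, Fin.prod_univ_two, Finset.prod_mul_distrib, restrict_X_zero,
    restrict_X_one, covec, if_true, one_ne_zero, if_false]
  rw [Finset.prod_univ_sum, Finset.mul_sum, Fintype.piFinset_univ]
  refine Finset.sum_congr rfl fun i _ => ?_
  rw [Finset.prod_mul_distrib]
  ring

/-! ### They are conformal Killing tensors -/

theorem covec_update (i : Fin s → Fin n) (p : Fin s) (a : Fin n) :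
    covec (Function.update i p a) = Function.update (covec i) (p, 1) (lowP (psiUp a)) := by
  funext q
  obtain ⟨k, r⟩ := q
  by_cases h : (k, r) = (p, 1)
  · rw [h, Function.update_self]
    simp [covec]
  · rw [Function.update_of_ne h]
    fin_cases r
    · simp [covec]
    · have : k ≠ p := fun e => h (by rw [e]; rfl)
      simp [covec, this]

theorem fieldPoly_comp_swap {T : AmbTensor n s} (hT : IsCurvatureLike T) (i : Fin s → Fin n)
    {k l : Fin s} (hkl : k ≠ l) : fieldPoly T (i ∘ Equiv.swap k l) = fieldPoly T i := by
  have h := hT.quad_pair (covec i) hkl (lowP (phiUp n)) (lowP (psiUp (i k))) (lowP (phiUp n))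
    (lowP (psiUp (i l)))
  have h1 : quad (covec i) k l (lowP (phiUp n)) (lowP (psiUp (i k))) (lowP (phiUp n))
      (lowP (psiUp (i l))) = covec i := by
    funext q
    simp only [quad]
    split_ifs with h1 h2 h3 h4 <;> first | rfl | simp_all [covec]
  have h2 : quad (covec i) k l (lowP (phiUp n)) (lowP (psiUp (i l))) (lowP (phiUp n))
      (lowP (psiUp (i k))) = covec (i ∘ Equiv.swap k l) := by
    funext q
    obtain ⟨j, r⟩ := q
    fin_cases r
    · simp [quad, covec]
    · by_cases hjk : j = k
      · subst hjk
        simp [quad, covec]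
      · by_cases hjl : j = l
        · subst hjl
          simp [quad, covec, hjk]
        · simp [quad, covec, hjk, hjl, Equiv.swap_apply_of_ne_of_ne hjk hjl]
  rw [h1, h2] at h
  exact h

theorem fieldPoly_comp_perm {T : AmbTensor n s} (hT : IsCurvatureLike T) (σ : Equiv.Perm (Fin s)) :
    ∀ i : Fin s → Fin n, fieldPoly T (i ∘ σ) = fieldPoly T i := by
  induction σ using Equiv.Perm.swap_induction_on with
  | one => exact fun i => rfl
  | swap_mul f x y hxy ih =>
    intro i
    rw [Equiv.Perm.coe_mul, ← Function.comp_assoc, ih, fieldPoly_comp_swap hT i hxy]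

theorem ct_pair_expand {ι m R : Type} [Fintype ι] [DecidableEq ι] [Fintype m] [DecidableEq m]
    [CommRing R] [Algebra ℝ R] (u : ι → m → R) (p q : ι) (a b : m → R) (T : Tens ι m) (hpq : p ≠ q) :
    ct (Function.update (Function.update u p a) q b) T = ∑ E, ∑ F, a E * b F *
      ct (Function.update (Function.update u p (Pi.single E 1)) q (Pi.single F 1)) T := by
  have h : ∀ a : m → R, a = ∑ E, a E • Pi.single E (1 : R) := fun a => by
    funext E
    simp [Finset.sum_apply, Pi.single_apply]
  rw [Function.update_comm hpq]
  conv_lhs => rw [h a]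
  rw [ct_update_sum]
  refine Finset.sum_congr rfl fun E _ => ?_
  rw [ct_update_smul, ← Function.update_comm hpq]
  conv_lhs => rw [h b]
  rw [ct_update_sum, Finset.mul_sum]
  refine Finset.sum_congr rfl fun F _ => ?_
  rw [ct_update_smul]
  ring

/-- The ambient trace over the second slots of two columns is the Euclidean trace plus mixed terms.
Each mixed term puts Φ into a second slot whose partner already contains Φ, so it vanishes by
skewness. -/
theorem fieldPoly_trace {T : AmbTensor n s} (hT : IsCurvatureLike T)
    (hT' : T ∈ traceFree _ (ambientMetric n)) (i : Fin s → Fin n) {p q : Fin s} (hpq : p ≠ q) :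
    ∑ a, fieldPoly T (Function.update (Function.update i p a) q a) = 0 := by
  simp only [traceFree, Submodule.mem_iInf, LinearMap.mem_ker] at hT'
  have hne : ((p, 1) : Fin s × Fin 2) ≠ (q, 1) := fun e => hpq (congrArg Prod.fst e)
  have h1 := ct_contract (covec i) _ hne (hT' _ _ hne)
  have h2 : ct (Function.update (Function.update (covec i) (p, 1) (lowP (phiUp n))) (q, 1)
      (lowP (iotaUp n))) T = 0 := by
    refine hT.ct_eq_zero _ p ?_
    rw [Function.update_of_ne (by simp), Function.update_of_ne (by simp), Function.update_of_ne hne,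
      Function.update_self]
    rfl
  have h3 : ct (Function.update (Function.update (covec i) (p, 1) (lowP (iotaUp n))) (q, 1)
      (lowP (phiUp n))) T = 0 := by
    refine hT.ct_eq_zero _ q ?_
    rw [Function.update_of_ne (by simp), Function.update_of_ne (by simp), Function.update_self]
    rfl
  rw [ct_pair_expand _ _ _ _ _ _ hne] at h2 h3
  have h4 : ∀ a, fieldPoly T (Function.update (Function.update i p a) q a) = ∑ E, ∑ F,
      lowP (psiUp a) E * lowP (psiUp a) F * ct (Function.update (Function.update (covec i)
        (p, 1) (Pi.single E 1)) (q, 1) (Pi.single F 1)) T := fun a => by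
    rw [fieldPoly, covec_update, covec_update, ct_pair_expand _ _ _ _ _ _ hne]
  rw [Finset.sum_congr rfl fun a _ => h4 a, Finset.sum_comm]
  have h5 := congrArg₂ (· + ·) h2 h3
  simp only [add_zero] at h5
  refine Eq.trans ?_ h1
  refine (add_zero _).symm.trans ?_
  rw [← h5, ← Finset.sum_add_distrib, ← Finset.sum_add_distrib]
  refine Finset.sum_congr rfl fun E _ => ?_
  rw [Finset.sum_comm, ← Finset.sum_add_distrib, ← Finset.sum_add_distrib]
  refine Finset.sum_congr rfl fun F _ => ?_
  rw [← Finset.sum_mul, ← add_mul, ← add_mul, ← add_assoc, sum_psi_psi, ← smul_eq_C_mul]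

/-- The operator p·∂/∂x takes Φ to p_b Ψ^b, which repeats the other entry of the skew pair, and
takes p_b Ψ^b to -p² times the constant vector at infinity. -/
theorem euclid_dvd_rowDer_restrict {T : AmbTensor n s} (hT : IsCurvatureLike T) :
    euclid n 1 1 ∣ rowDer 1 0 (restrict n (toPoly T)) := by
  have hX : ∀ r A, rowDer 1 0 (X (r, A)) =
      if r = 0 then (X (1, A) : MvPolynomial (Fin 2 × Fin n) ℝ) else 0 := fun r A => by
    simp [rowDer, mkDerivation_X]
  have hD0 : ∀ A, rowDer 1 0 (restrict n (X (0, A))) = restrict n (X (1, A)) := by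
    intro A
    rcases A with _ | _ | _
    · have h2 : (C (1 / 2) : MvPolynomial (Fin 2 × Fin n) ℝ) * 2 = 1 := by
        rw [← map_ofNat C 2, ← C_mul]
        norm_num
      simp only [restrict, aeval_X, map_neg, Derivation.leibniz, rowDer_metricForm, if_true,
        smul_eq_mul]
      rw [metricForm_comm Matrix.isSymm_one 1 0]
      have : rowDer 1 0 (C (1 / 2) : MvPolynomial (Fin 2 × Fin n) ℝ) = 0 := by
        rw [← algebraMap_eq, Derivation.map_algebraMap]
      rw [this]
      linear_combination (-euclid n 0 1) * h2
    · simp [restrict, hX]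
    · simp [restrict]
  have hD1 : ∀ A, rowDer 1 0 (restrict n (X (1, A))) =
      euclid n 1 1 * if A = .inl () then -1 else 0 := by
    intro A
    rcases A with _ | _ | _
    · simp [restrict, rowDer_metricForm]
    · simp [restrict, hX]
    · simp [restrict]
  rw [toPoly, ct_map, ct_derivation]
  refine Finset.dvd_sum fun q _ => ?_
  obtain ⟨k, r⟩ := q
  fin_cases r
  · simp only [Fin.zero_eta, hD0]
    rw [hT.ct_eq_zero _ k]
    · exact dvd_zero _
    · rw [Function.update_self, Function.update_of_ne (by simp)]
  · simp only [Fin.mk_one, hD1]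
    have : (fun A : AmbIndex n => euclid n 1 1 * if A = .inl () then -1 else 0) =
        euclid n 1 1 • fun A : AmbIndex n => if A = .inl () then -1 else 0 := rfl
    rw [this, ct_update_smul]
    exact dvd_mul_right _ _

theorem contDiff_polyField (v : (Fin s → Fin n) → MvPolynomial (Fin n) ℝ) :
    ContDiff ℝ ∞ (polyField v) := contDiff_pi.2 fun i => contDiff_eval (v i)

theorem ambientToField_mem {T : AmbTensor n s} (hT : T ∈ ambientKilling n s) :
    ambientToField T ∈ conformalKilling n s := by
  obtain ⟨hT, hT'⟩ := mem_ambientKilling.1 hT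
  rw [ambientToField_eq]
  refine ⟨contDiff_polyField _, fun x => mem_symmetric.2 fun σ => ?_, fun x => ?_, fun x => ?_⟩
  · funext i
    exact congrArg (eval x.ofLp) (fieldPoly_comp_perm hT σ i)
  · simp only [traceFree, Submodule.mem_iInf, LinearMap.mem_ker]
    intro p q hpq
    funext i
    have h := congrArg (eval x.ofLp) (fieldPoly_trace hT hT' i hpq)
    rw [map_sum, map_zero] at h
    simp only [contract, LinearMap.coe_mk, AddHom.coe_mk, Matrix.one_apply, ite_mul, one_mul,
      zero_mul, Finset.sum_ite_eq, Finset.mem_univ, if_true]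
    exact h
  · rw [symmetrize_mem_pureTrace_iff, ← evalAt_rowDer_genPoly, genPoly_fieldPoly]
    exact euclid_dvd_iff.1 (euclid_dvd_rowDer_restrict hT) x

end Frame

/-! ### Injectivity -/

section Injective

variable {n s : ℕ}

/-- A multiple of the first entry added to the second is invisible to a skew pair. -/
theorem IsCurvatureLike.ct_shear {m R : Type} [Fintype m] [CommRing R] [Algebra ℝ R]
    {T : Tens (Fin s × Fin 2) m} (hT : IsCurvatureLike T) (a b : m → R) (r : R) :
    ct (fun q => if q.2 = 0 then a else b + r • a) T = ct (fun q => if q.2 = 0 then a else b) T := by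
  suffices h : ∀ B : Finset (Fin s), ct (fun q => if q.2 = 0 then a else if q.1 ∈ B then b + r • a
      else b) T = ct (fun q => if q.2 = 0 then a else b) T by
    simpa using h Finset.univ
  intro B
  induction B using Finset.induction_on with
  | empty => simp
  | insert k B hk ih =>
    rw [← ih]
    set u : Fin s × Fin 2 → m → R := fun q => if q.2 = 0 then a else if q.1 ∈ B then b + r • a else b
      with hu
    have h1 : (fun q : Fin s × Fin 2 => if q.2 = 0 then a else if q.1 ∈ insert k B then b + r • a
        else b) = Function.update u (k, 1) (b + r • a) := by
      funext q
      obtain ⟨j, c⟩ := q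
      by_cases hq : (j, c) = (k, 1)
      · rw [hq, Function.update_self]
        simp
      · rw [Function.update_of_ne hq]
        fin_cases c
        · simp [hu]
        · have : j ≠ k := fun e => hq (by rw [e]; rfl)
          simp [hu, this]
    have h2 : u = Function.update u (k, 1) b := by
      rw [eq_comm, Function.update_eq_self_iff]
      simp [hu, hk]
    rw [h1, ct_update_add, ct_update_smul, hT.ct_eq_zero (Function.update u (k, 1) a) k, mul_zero,
      add_zero, ← h2]
    rw [Function.update_self, Function.update_of_ne (by simp)]
    simp [hu]

/-- A polynomial parametrisation of the totally null pairs of ambient vectors. -/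
noncomputable def nullParam (n : ℕ) : Fin 2 × AmbIndex n → MvPolynomial (Fin 2 × AmbIndex n) ℝ
  | (0, .inl _) => -dot (ambMid 0) (ambMid 0) Finset.univ
  | (0, .inr (.inl b)) => 2 * X (ambInf n 0) * X (ambMid 0 b)
  | (0, .inr (.inr _)) => 2 * X (ambInf n 0) ^ 2
  | (1, .inl _) => X (ambInf n 1) * dot (ambMid 0) (ambMid 0) Finset.univ -
      2 * X (ambInf n 0) * dot (ambMid 0) (ambMid 1) Finset.univ
  | (1, .inr (.inl b)) => 2 * X (ambInf n 0) ^ 2 * X (ambMid 1 b)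
  | (1, .inr (.inr _)) => 2 * X (ambInf n 0) ^ 2 * X (ambInf n 1)

/-- On null pairs the parametrisation only rescales X by 2y and P by 2y². Substituting it into a
polynomial of bidegree (s, s) therefore multiplies it, modulo the ideal, by a constant times a power
of y. -/
theorem nullParam_sub_mem (i : Fin 2 × AmbIndex n) :
    nullParam n i - (2 * X (ambInf n 0)) ^ (rowWeight (AmbIndex n) i).1 *
      (2 * X (ambInf n 0) ^ 2) ^ (rowWeight (AmbIndex n) i).2 * X i ∈
        nullIdeal (ambientMetric n) := by
  obtain ⟨r, A⟩ := i
  fin_cases r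
  · rcases A with _ | b | _
    · have : nullParam n (0, .inl ()) - (2 * X (ambInf n 0)) ^ 1 *
          (2 * X (ambInf n 0) ^ 2) ^ 0 * X (0, .inl ()) =
          -metricForm (ambientMetric n) 0 0 := by
        rw [metricForm_ambientMetric, nullParam]
        ring
      exact this ▸ neg_mem (metricForm_mem_nullIdeal _ _ _)
    · simp [nullParam, rowWeight]
    · simp [nullParam, rowWeight]
      convert zero_mem (nullIdeal (ambientMetric n)) using 1
      ring
  · rcases A with _ | b | _
    · have : nullParam n (1, .inl ()) - (2 * X (ambInf n 0)) ^ 0 *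
          (2 * X (ambInf n 0) ^ 2) ^ 1 * X (1, .inl ()) =
          X (ambInf n 1) * metricForm (ambientMetric n) 0 0 -
            2 * X (ambInf n 0) * metricForm (ambientMetric n) 0 1 := by
        rw [metricForm_ambientMetric, metricForm_ambientMetric, nullParam]
        ring
      exact this ▸ sub_mem (Ideal.mul_mem_left _ _ (metricForm_mem_nullIdeal _ _ _))
        (Ideal.mul_mem_left _ _ (metricForm_mem_nullIdeal _ _ _))
    · simp [nullParam, rowWeight]
    · simp [nullParam, rowWeight]

/-- Wherever y ≠ 0 the parametrised pair is a common multiple of Φ and p_b Ψ^b + dΦ at a point of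
ℝⁿ; the term dΦ is removed by `ct_shear`, and `h` applies. Multiplying by y first disposes of the
points with y = 0. -/
theorem aeval_nullParam_eq_zero {T : AmbTensor n s} (hT : IsCurvatureLike T)
    (h : restrict n (toPoly T) = 0) : aeval (nullParam n) (toPoly T) = 0 := by
  have hX : (X (ambInf n 0) : MvPolynomial (Fin 2 × AmbIndex n) ℝ) ≠ 0 := X_ne_zero _
  refine (mul_eq_zero.1 ?_).resolve_left hX
  refine MvPolynomial.funext fun y => ?_
  rw [map_mul, eval_X, map_zero]
  by_cases hy : y (ambInf n 0) = 0
  · rw [hy, zero_mul]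
  set c := y (ambInf n 0) with hc
  set d := y (ambInf n 1) with hd
  let x : Fin n → ℝ := fun b => y (ambMid 0 b) / c
  let p : Fin n → ℝ := fun b => y (ambMid 1 b) - d * x b
  let a : AmbIndex n → ℝ
    | .inl _ => -(1 / 2 * ∑ b, x b * x b)
    | .inr (.inl b) => x b
    | .inr (.inr _) => 1
  let e : AmbIndex n → ℝ
    | .inl _ => -∑ b, x b * p b
    | .inr (.inl b) => p b
    | .inr (.inr _) => 0
  have hxc : ∀ b, c * x b = y (ambMid 0 b) := fun b => mul_div_cancel₀ _ hy
  have h0 : ct (fun q => if q.2 = 0 then a else e) T = 0 := by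
    have h1 := congrArg (aeval fun q : Fin 2 × Fin n => if q.1 = 0 then x q.2 else p q.2) h
    rw [map_zero, toPoly, ct_map, ct_map] at h1
    rw [← h1]
    congr 2
    funext q A
    obtain ⟨k, r⟩ := q
    fin_cases r
    · rcases A with _ | _ | _ <;> simp [restrict, a, euclid_eq]
    · rcases A with _ | _ | _ <;> simp [restrict, e, euclid_eq]
  rw [← hT.ct_shear a e d] at h0
  have h2 : eval y (aeval (nullParam n) (toPoly T)) =
      aeval (fun i => eval y (nullParam n i)) (toPoly T) := by
    rw [← aeval_eq_eval, ← AlgHom.comp_apply, comp_aeval]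
  have hdot0 : eval y (dot (ambMid 0) (ambMid 0) Finset.univ) = c ^ 2 * ∑ b, x b * x b := by
    simp only [dot, map_sum, map_mul, eval_X, ← hxc, Finset.mul_sum]
    exact Finset.sum_congr rfl fun b _ => by ring
  have hdot1 : eval y (dot (ambMid 0) (ambMid 1) Finset.univ) =
      c * (∑ b, x b * p b + d * ∑ b, x b * x b) := by
    simp only [dot, map_sum, map_mul, eval_X, ← hxc, Finset.mul_sum, ← Finset.sum_add_distrib]
    refine Finset.sum_congr rfl fun b _ => ?_
    simp only [p]
    ring
  have h3 : ∀ i, eval y (nullParam n i) = (2 * c ^ 2) ^ (rowWeight (AmbIndex n) i).1 *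
      (2 * c ^ 2) ^ (rowWeight (AmbIndex n) i).2 * (if i.1 = 0 then a else e + d • a) i.2 := by
    rintro ⟨r, A⟩
    fin_cases r
    · rcases A with _ | b | _
      · simp [nullParam, rowWeight, a, hdot0]
        ring
      · simp [nullParam, rowWeight, a, ← hxc, ← hc]
        ring
      · simp [nullParam, rowWeight, a, ← hc]
    · rcases A with _ | b | _
      · simp [nullParam, rowWeight, a, e, hdot0, hdot1, ← hc, ← hd]
        ring
      · simp [nullParam, rowWeight, a, e, p, ← hc]
      · simp [nullParam, rowWeight, a, e, ← hc, ← hd]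
  rw [h2]
  simp only [h3]
  rw [aeval_scale (isWeightedHomogeneous_toPoly T), toPoly, ct_map]
  simp only [aeval_X]
  have h4 : (fun (q : Fin s × Fin 2) A => (if q.2 = 0 then a else e + d • a) A) =
    fun q => if q.2 = 0 then a else e + d • a := rfl
  rw [h4, h0, mul_zero, mul_zero]

/-- Vanishing along the parametrisation puts a power of y times `toPoly T` into the null ideal. As y
can be cancelled, the polynomial is both harmonic and in the ideal. -/
theorem eq_zero_of_restrict_eq_zero (hn : 3 ≤ n) {T : AmbTensor n s} (hT : T ∈ ambientKilling n s)
    (h : restrict n (toPoly T) = 0) : T = 0 := by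
  obtain ⟨hT, hT'⟩ := mem_ambientKilling.1 hT
  refine hT.eq_zero_of_toPoly (eq_zero_of_mem_nullIdeal (laplace_toPoly _ hT') ?_)
  have h1 := aeval_sub_aeval_mem (nullIdeal (ambientMetric n)) nullParam_sub_mem (toPoly T)
  rw [aeval_nullParam_eq_zero hT h, aeval_scale (isWeightedHomogeneous_toPoly T), zero_sub,
    neg_mem_iff, aeval_X_left, AlgHom.id_apply] at h1
  refine mem_nullIdeal_of_X_inf_pow_mul hn (s + 2 * s) ?_
  have h2 : (2 : MvPolynomial (Fin 2 × AmbIndex n) ℝ) * C (1 / 2) = 1 := by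
    rw [← map_ofNat C 2, ← C_mul]
    norm_num
  have h3 : X (ambInf n 0) ^ (s + 2 * s) * toPoly T = (C (1 / 2)) ^ (2 * s) *
      ((2 * X (ambInf n 0)) ^ s * (2 * X (ambInf n 0) ^ 2) ^ s * toPoly T) := by
    have h4 : (C (1 / 2)) ^ (2 * s) * ((2 * X (ambInf n 0)) ^ s *
        (2 * X (ambInf n 0) ^ 2) ^ s * toPoly T) = (2 * C (1 / 2)) ^ (2 * s) *
          (X (ambInf n 0) ^ (s + 2 * s) * toPoly T) := by ring
    rw [h4, h2, one_pow, one_mul]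
  rw [h3]
  exact Ideal.mul_mem_left _ _ h1

theorem eq_zero_of_ambientToField (hn : 3 ≤ n) {T : AmbTensor n s} (hT : T ∈ ambientKilling n s)
    (h : ambientToField T = 0) : T = 0 := by
  refine eq_zero_of_restrict_eq_zero hn hT ?_
  rw [← genPoly_fieldPoly]
  refine eq_zero_of_evalAt fun x => ?_
  rw [evalAt_genPoly, ← ambientToField_eq, h]
  exact map_zero formPoly

end Injective

/-! ### Lie derivatives -/

section Lie

variable {n s : ℕ}

/-- The bilinear form `v_B A^B_Q w^Q`, where the index of `v` is lowered. -/
noncomputable def skewForm (A : Matrix (AmbIndex n) (AmbIndex n) ℝ)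
    (v w : AmbIndex n → MvPolynomial (Fin n) ℝ) : MvPolynomial (Fin n) ℝ :=
  ∑ B, ∑ Q, lowP v B * C (A B Q) * w Q

theorem lowP_eq_sum (v : AmbIndex n → MvPolynomial (Fin n) ℝ) (B : AmbIndex n) :
    lowP v B = ∑ E, C (ambientMetric n B E) * v E := by
  rcases B with _ | b | _ <;>
    simp [lowP, ambientMetric, Fintype.sum_sum_type, Matrix.one_apply, apply_ite]

theorem skewForm_eq (A : Matrix (AmbIndex n) (AmbIndex n) ℝ)
    (v w : AmbIndex n → MvPolynomial (Fin n) ℝ) :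
    skewForm A v w = ∑ E, ∑ Q, C ((ambientMetric n * A) E Q) * (v E * w Q) := by
  simp only [skewForm, lowP_eq_sum, Matrix.mul_apply, map_sum, Finset.sum_mul]
  rw [Finset.sum_comm_cycle]
  refine Finset.sum_congr rfl fun E _ => ?_
  rw [Finset.sum_comm]
  refine Finset.sum_congr rfl fun Q _ => Finset.sum_congr rfl fun B _ => ?_
  rw [← ambientMetric_isSymm.apply, C_mul]
  ring

theorem skewForm_swap {A : Matrix (AmbIndex n) (AmbIndex n) ℝ} (hA : A ∈ so n)
    (v w : AmbIndex n → MvPolynomial (Fin n) ℝ) : skewForm A v w = -skewForm A w v := by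
  rw [mem_skewAdjointMatricesLieSubalgebra, mem_skewAdjointMatricesSubmodule] at hA
  have h : A.transpose * ambientMetric n = ambientMetric n * -A := hA
  have h1 : (ambientMetric n * A).transpose = -(ambientMetric n * A) := by
    rw [Matrix.transpose_mul, ambientMetric_isSymm.eq, h, mul_neg]
  rw [skewForm_eq, skewForm_eq, Finset.sum_comm, ← Finset.sum_neg_distrib]
  refine Finset.sum_congr rfl fun E _ => ?_
  rw [← Finset.sum_neg_distrib]
  refine Finset.sum_congr rfl fun Q _ => ?_
  have h2 := congrFun (congrFun h1 E) Q
  rw [Matrix.transpose_apply, Matrix.neg_apply] at h2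
  rw [h2, C_neg]
  ring

/-- The components of the conformal Killing vector of `A`. -/
noncomputable def killingPoly (A : Matrix (AmbIndex n) (AmbIndex n) ℝ) (b : Fin n) :
    MvPolynomial (Fin n) ℝ := skewForm A (phiUp n) (psiUp b)

theorem killingVector_eq (A : so n) (x : EuclideanSpace ℝ (Fin n)) (b : Fin n) :
    killingVector A x b = eval x.ofLp (killingPoly (A : Matrix (AmbIndex n) (AmbIndex n) ℝ) b) := by
  simp only [killingVector, killingPoly, skewForm, map_sum, map_mul, eval_lowP, eval_C, eval_phiUp,
    eval_psiUp]

theorem pderiv_lowP (a : Fin n) (v : AmbIndex n → MvPolynomial (Fin n) ℝ) (B : AmbIndex n) :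
    pderiv a (lowP v B) = lowP (fun A => pderiv a (v A)) B := by
  rcases B with _ | _ | _ <;> rfl

theorem pderiv_skewForm (A : Matrix (AmbIndex n) (AmbIndex n) ℝ) (a : Fin n)
    (v w : AmbIndex n → MvPolynomial (Fin n) ℝ) :
    pderiv a (skewForm A v w) = skewForm A (fun B => pderiv a (v B)) w +
      skewForm A v (fun B => pderiv a (w B)) := by
  simp only [skewForm, map_sum, Derivation.leibniz, pderiv_C, smul_eq_mul,
    pderiv_lowP, ← Finset.sum_add_distrib]
  refine Finset.sum_congr rfl fun B _ => Finset.sum_congr rfl fun Q _ => ?_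
  ring

/-- The derivative is a skew part plus a multiple of the identity, the conformal factor. -/
theorem pderiv_killingPoly (A : Matrix (AmbIndex n) (AmbIndex n) ℝ) (a b : Fin n) :
    pderiv a (killingPoly A b) = skewForm A (psiUp a) (psiUp b) -
      (if a = b then 1 else 0) * skewForm A (phiUp n) (iotaUp n) := by
  have h : (fun B => pderiv a (psiUp b B)) =
      fun B => -((if a = b then 1 else 0) * iotaUp n B) := funext fun B => pderiv_psiUp a b B
  rw [killingPoly, pderiv_skewForm, h, sub_eq_add_neg]
  simp only [pderiv_phiUp]
  congr 1
  simp only [skewForm, mul_neg, Finset.sum_neg_distrib, Finset.mul_sum]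
  refine congrArg _ (Finset.sum_congr rfl fun B _ => Finset.sum_congr rfl fun Q _ => ?_)
  ring

/-- The covector `v_B A^B_E`. -/
noncomputable def coact (A : Matrix (AmbIndex n) (AmbIndex n) ℝ)
    (v : AmbIndex n → MvPolynomial (Fin n) ℝ) : AmbIndex n → MvPolynomial (Fin n) ℝ :=
  fun E => ∑ B, A B E • lowP v B

theorem sum_coact_mul (A : Matrix (AmbIndex n) (AmbIndex n) ℝ)
    (v w : AmbIndex n → MvPolynomial (Fin n) ℝ) : ∑ Q, coact A v Q * w Q = skewForm A v w := by
  simp only [coact, skewForm, Finset.sum_mul, smul_eq_C_mul]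
  rw [Finset.sum_comm]
  refine Finset.sum_congr rfl fun B _ => Finset.sum_congr rfl fun Q _ => ?_
  ring

/-- Skewness of A removes the component along I, so A acts on Φ by the Killing vector along Ψ and by
the conformal factor. -/
theorem coact_phiUp {A : Matrix (AmbIndex n) (AmbIndex n) ℝ} (hA : A ∈ so n) :
    coact A (phiUp n) = ∑ a, killingPoly A a • lowP (psiUp a) +
      skewForm A (phiUp n) (iotaUp n) • lowP (phiUp n) := by
  have h0 : skewForm A (phiUp n) (phiUp n) = 0 := by
    have h := skewForm_swap hA (phiUp n) (phiUp n)
    have h2 : (2 : ℝ) • skewForm A (phiUp n) (phiUp n) = 0 := by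
      rw [two_smul]
      linear_combination h
    exact (smul_eq_zero.1 h2).resolve_left two_ne_zero
  conv_lhs => rw [frame_expansion (coact A (phiUp n))]
  simp only [sum_coact_mul, h0, zero_smul, add_zero]
  rfl

theorem coact_psiUp {A : Matrix (AmbIndex n) (AmbIndex n) ℝ} (hA : A ∈ so n) (b : Fin n) :
    coact A (psiUp b) = ∑ a, skewForm A (psiUp b) (psiUp a) • lowP (psiUp a) +
      skewForm A (psiUp b) (iotaUp n) • lowP (phiUp n) + -(killingPoly A b • lowP (iotaUp n)) := by
  conv_lhs => rw [frame_expansion (coact A (psiUp b))]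
  simp only [sum_coact_mul]
  rw [skewForm_swap hA (psiUp b) (phiUp n), neg_smul]
  rfl

theorem pderiv_fieldPoly (T : AmbTensor n s) (i : Fin s → Fin n) (a : Fin n) :
    pderiv a (fieldPoly T i) = ∑ k, (ct (Function.update (covec i) (k, 0) (lowP (psiUp a))) T +
      ct (Function.update (covec i) (k, 1) (-((if a = i k then (1 : MvPolynomial (Fin n) ℝ) else 0) •
        lowP (iotaUp n)))) T) := by
  rw [fieldPoly, ct_derivation, Fintype.sum_prod_type]
  refine Finset.sum_congr rfl fun k _ => ?_
  rw [Fin.sum_univ_two]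
  have h0 : (fun B => pderiv a (covec i (k, 0) B)) = lowP (psiUp a) := by
    funext B
    simp only [covec, if_true, pderiv_lowP, pderiv_phiUp]
  have h1 : (fun B => pderiv a (covec i (k, 1) B)) =
      -((if a = i k then (1 : MvPolynomial (Fin n) ℝ) else 0) • lowP (iotaUp n)) := by
    funext B
    simp only [covec, one_ne_zero, if_false, pderiv_lowP, pderiv_psiUp]
    rcases B with _ | _ | _ <;> rfl
  rw [h0, h1]

/-- Both sides are expanded in the frame. Components along Φ in a second slot drop out by skewness.
The Ψ components in first slots and the I components in second slots form the transport term; the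
skew part and the conformal factor form the terms with the derivative of the vector field. -/
theorem fieldPoly_tensAct {A : Matrix (AmbIndex n) (AmbIndex n) ℝ} (hA : A ∈ so n)
    {T : AmbTensor n s} (hT : IsCurvatureLike T) (i : Fin s → Fin n) :
    fieldPoly (tensAct A T) i = ∑ a, killingPoly A a * pderiv a (fieldPoly T i) -
      ∑ k, ∑ a, fieldPoly T (Function.update i k a) * pderiv a (killingPoly A (i k)) := by
  have h0 : ∀ k, (fun E => ∑ B, A B E • covec i (k, 0) B) = coact A (phiUp n) := fun k => rfl
  have h1 : ∀ k, (fun E => ∑ B, A B E • covec i (k, 1) B) = coact A (psiUp (i k)) := fun k => rfl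
  have hc : ∀ k, fieldPoly T i = ct (Function.update (covec i) (k, 0) (lowP (phiUp n))) T := by
    intro k
    rw [fieldPoly]
    congr 2
    rw [eq_comm, Function.update_eq_self_iff]
    rfl
  have hz : ∀ k, ct (Function.update (covec i) (k, 1) (lowP (phiUp n))) T = 0 := by
    intro k
    refine hT.ct_eq_zero _ k ?_
    rw [Function.update_self, Function.update_of_ne (by simp)]
    rfl
  have hL : fieldPoly (tensAct A T) i = ∑ k,
      (∑ a, killingPoly A a * ct (Function.update (covec i) (k, 0) (lowP (psiUp a))) T +
        skewForm A (phiUp n) (iotaUp n) * fieldPoly T i +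
        (∑ a, skewForm A (psiUp (i k)) (psiUp a) * fieldPoly T (Function.update i k a) -
        killingPoly A (i k) * ct (Function.update (covec i) (k, 1) (lowP (iotaUp n))) T)) := by
    rw [fieldPoly, ct_tensAct, Fintype.sum_prod_type]
    refine Finset.sum_congr rfl fun k _ => ?_
    rw [Fin.sum_univ_two, h0, h1, coact_phiUp hA, coact_psiUp hA]
    simp only [ct_update_add, ct_update_sum, ct_update_smul, ct_update_neg, hz, mul_zero, add_zero,
      ← hc, fieldPoly, covec_update, sub_eq_add_neg]
  have hR1 : ∑ a, killingPoly A a * pderiv a (fieldPoly T i) = ∑ k,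
      (∑ a, killingPoly A a * ct (Function.update (covec i) (k, 0) (lowP (psiUp a))) T -
        killingPoly A (i k) * ct (Function.update (covec i) (k, 1) (lowP (iotaUp n))) T) := by
    simp only [pderiv_fieldPoly, Finset.mul_sum]
    rw [Finset.sum_comm]
    refine Finset.sum_congr rfl fun k _ => ?_
    simp only [mul_add, Finset.sum_add_distrib, sub_eq_add_neg, ct_update_neg, ct_update_smul]
    congr 1
    rw [Finset.sum_eq_single (i k)]
    · simp
    · intro a _ ha
      simp [ha]
    · simp
  have hR2 : ∀ k, ∑ a, fieldPoly T (Function.update i k a) * pderiv a (killingPoly A (i k)) =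
      -(skewForm A (phiUp n) (iotaUp n) * fieldPoly T i) -
        ∑ a, skewForm A (psiUp (i k)) (psiUp a) * fieldPoly T (Function.update i k a) := by
    intro k
    simp only [pderiv_killingPoly, mul_sub, Finset.sum_sub_distrib]
    have e1 : ∑ a, fieldPoly T (Function.update i k a) * ((if a = i k then 1 else 0) *
        skewForm A (phiUp n) (iotaUp n)) = skewForm A (phiUp n) (iotaUp n) * fieldPoly T i := by
      rw [Finset.sum_eq_single (i k)]
      · simp [mul_comm]
      · intro a _ ha
        simp [ha]
      · simp
    have e2 : ∑ a, fieldPoly T (Function.update i k a) * skewForm A (psiUp a) (psiUp (i k)) =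
        -∑ a, skewForm A (psiUp (i k)) (psiUp a) * fieldPoly T (Function.update i k a) := by
      rw [← Finset.sum_neg_distrib]
      refine Finset.sum_congr rfl fun a _ => ?_
      rw [skewForm_swap hA (psiUp a)]
      ring
    rw [e1, e2]
    ring
  rw [hL, hR1, Finset.sum_congr rfl fun k _ => hR2 k, ← Finset.sum_sub_distrib]
  refine Finset.sum_congr rfl fun k _ => ?_
  ring

/-- The action on ambient tensors corresponds to the Lie derivative. -/
theorem ambientToField_tensAct (A : so n) {T : AmbTensor n s} (hT : T ∈ ambientKilling n s) :
    ambientToField (tensAct (A : Matrix (AmbIndex n) (AmbIndex n) ℝ) T) =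
      lieDerivative (killingVector A) (ambientToField T) := by
  rw [ambientToField_eq, ambientToField_eq]
  funext x i
  have h := congrArg (eval x.ofLp) (fieldPoly_tensAct A.2 (mem_ambientKilling.1 hT).1 i)
  simp only [map_sub, map_sum, map_mul] at h
  simp only [lieDerivative, polyField, partialDeriv_eval, killingVector_eq]
  exact h

end Lie

/-! ### Jets -/

section Jets

variable {n : ℕ}

theorem contDiff_partialDeriv {f : EuclideanSpace ℝ (Fin n) → ℝ} (hf : ContDiff ℝ ∞ f)
    (a : Fin n) : ContDiff ℝ ∞ (partialDeriv a f) :=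
  (hf.fderiv_right (m := ∞) (by simp)).clm_apply contDiff_const

theorem partialDeriv_comm {f : EuclideanSpace ℝ (Fin n) → ℝ} (hf : ContDiff ℝ ∞ f)
    (a b : Fin n) : partialDeriv a (partialDeriv b f) = partialDeriv b (partialDeriv a f) := by
  funext x
  have h1 : DifferentiableAt ℝ (fderiv ℝ f) x :=
    (hf.fderiv_right (m := ∞) (by simp)).differentiable (by simp) x
  have h2 : ∀ a b, partialDeriv a (partialDeriv b f) x =
      fderiv ℝ (fderiv ℝ f) x (EuclideanSpace.single a 1) (EuclideanSpace.single b 1) := by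
    intro a b
    have h3 : HasFDerivAt (partialDeriv b f) ((fderiv ℝ (fderiv ℝ f) x).flip
        (EuclideanSpace.single b 1)) x := by
      refine (h1.hasFDerivAt.clm_apply
        (hasFDerivAt_const (EuclideanSpace.single b (1 : ℝ)) x)).congr_fderiv ?_
      ext v
      simp
    rw [partialDeriv, h3.fderiv]
    rfl
  rw [h2, h2]
  exact (hf.contDiffAt.isSymmSndFDerivAt (by
    rw [minSmoothness_of_isRCLikeNormedField]
    exact WithTop.coe_le_coe.2 (le_top (a := (2 : ℕ∞))))).eq _ _

theorem partialDeriv_sum {κ : Type} (t : Finset κ) (c : κ → ℝ)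
    {f : κ → EuclideanSpace ℝ (Fin n) → ℝ} (hf : ∀ k, ContDiff ℝ ∞ (f k)) (a : Fin n) :
    partialDeriv a (fun y => ∑ k ∈ t, c k * f k y) = fun y => ∑ k ∈ t, c k * partialDeriv a (f k) y := by
  funext x
  have h : HasFDerivAt (fun y => ∑ k ∈ t, c k * f k y) (∑ k ∈ t, c k • fderiv ℝ (f k) x) x :=
    HasFDerivAt.fun_sum fun k _ => (((hf k).differentiable (by simp) x).hasFDerivAt).const_mul (c k)
  rw [partialDeriv, h.fderiv]
  simp [partialDeriv]

/-- The homogeneous part of degree `d` of the Taylor polynomial of `f` at `x₀`. -/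
noncomputable def jet (x₀ : EuclideanSpace ℝ (Fin n)) :
    ℕ → (EuclideanSpace ℝ (Fin n) → ℝ) → MvPolynomial (Fin n) ℝ
  | 0, f => C (f x₀)
  | d + 1, f => ((d : ℝ) + 1)⁻¹ • ∑ a, X a * jet x₀ d (partialDeriv a f)

theorem isHomogeneous_jet (x₀ : EuclideanSpace ℝ (Fin n)) (d : ℕ)
    (f : EuclideanSpace ℝ (Fin n) → ℝ) : IsHomogeneous (jet x₀ d f) d := by
  induction d generalizing f with
  | zero => exact isHomogeneous_C _ _
  | succ d ih =>
    rw [jet, smul_eq_C_mul]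
    refine IsHomogeneous.C_mul (IsHomogeneous.sum _ _ _ fun a _ => ?_) _
    rw [add_comm]
    exact (isHomogeneous_X ℝ a).mul (ih _)

theorem jet_sum (x₀ : EuclideanSpace ℝ (Fin n)) (d : ℕ) {κ : Type} (t : Finset κ) (c : κ → ℝ)
    {f : κ → EuclideanSpace ℝ (Fin n) → ℝ} (hf : ∀ k, ContDiff ℝ ∞ (f k)) :
    jet x₀ d (fun y => ∑ k ∈ t, c k * f k y) = ∑ k ∈ t, c k • jet x₀ d (f k) := by
  induction d generalizing f with
  | zero => simp [jet, smul_eq_C_mul]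
  | succ d ih =>
    simp only [jet, partialDeriv_sum t c hf, ih fun k => contDiff_partialDeriv (hf k) _,
      Finset.mul_sum, Finset.smul_sum]
    rw [Finset.sum_comm]
    refine Finset.sum_congr rfl fun k _ => Finset.sum_congr rfl fun a _ => ?_
    rw [mul_smul_comm, smul_comm]

/-- Induction with Euler's identity: the two terms of the product rule contribute 1 and d + 1
copies, which the normalising factor (d + 2)⁻¹ absorbs. -/
theorem pderiv_jet_succ (x₀ : EuclideanSpace ℝ (Fin n)) (d : ℕ)
    {f : EuclideanSpace ℝ (Fin n) → ℝ} (hf : ContDiff ℝ ∞ f) (b : Fin n) :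
    pderiv b (jet x₀ (d + 1) f) = jet x₀ d (partialDeriv b f) := by
  induction d generalizing f with
  | zero =>
    simp [jet, pderiv_X, Pi.single_apply]
  | succ d ih =>
    have h1 : ∑ a, X a * pderiv b (jet x₀ (d + 1) (partialDeriv a f)) =
        ((d : ℝ) + 1) • jet x₀ (d + 1) (partialDeriv b f) := by
      rw [jet, smul_smul, mul_inv_cancel₀ (by positivity), one_smul]
      refine Finset.sum_congr rfl fun a _ => ?_
      rw [ih (contDiff_partialDeriv hf a), partialDeriv_comm hf]
    rw [jet, Derivation.map_smul, map_sum]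
    simp only [Derivation.leibniz, smul_eq_mul, Finset.sum_add_distrib]
    rw [h1, Finset.sum_eq_single b]
    · simp only [pderiv_X_self, mul_one]
      rw [← one_smul ℝ (jet x₀ (d + 1) (partialDeriv b f)), smul_smul, ← add_smul, smul_smul]
      congr 1
      push_cast
      field_simp
    · intro a _ ha
      simp [pderiv_X_of_ne ha]
    · simp

theorem eq_const_of_partialDeriv_eq_zero {f : EuclideanSpace ℝ (Fin n) → ℝ} (hf : ContDiff ℝ ∞ f)
    (h : ∀ a x, partialDeriv a f x = 0) (x y : EuclideanSpace ℝ (Fin n)) : f x = f y := by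
  refine is_const_of_fderiv_eq_zero (hf.differentiable (by simp)) (fun z => ?_) x y
  ext v
  have hv : v = ∑ a, v.ofLp a • EuclideanSpace.single a (1 : ℝ) := by
    ext b
    simp [Pi.single_apply]
  rw [hv, map_sum]
  simp only [map_smul]
  refine (Finset.sum_eq_zero fun a _ => ?_).trans rfl
  have := h a z
  rw [partialDeriv] at this
  rw [this, smul_zero]

/-- A function whose jets of some order vanish everywhere is a polynomial. -/
theorem eq_sum_jet (N : ℕ) {f : EuclideanSpace ℝ (Fin n) → ℝ} (hf : ContDiff ℝ ∞ f)
    (h : ∀ x₀, jet x₀ N f = 0) (y : EuclideanSpace ℝ (Fin n)) :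
    f y = ∑ d ∈ Finset.range N, eval y.ofLp (jet 0 d f) := by
  induction N generalizing f y with
  | zero => simpa [jet] using h y
  | succ N ih =>
    have hd : ∀ a z, partialDeriv a f z =
        ∑ d ∈ Finset.range N, eval z.ofLp (jet 0 d (partialDeriv a f)) := fun a z =>
      ih (contDiff_partialDeriv hf a) (fun x₀ => by rw [← pderiv_jet_succ x₀ N hf, h, map_zero]) z
    -- The Taylor polynomial at the origin. By induction its partial derivatives agree with those of
    -- `f`, and so does its value at the origin.
    let g : MvPolynomial (Fin n) ℝ := ∑ d ∈ Finset.range (N + 1), jet 0 d f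
    have hg : ContDiff ℝ ∞ fun y : EuclideanSpace ℝ (Fin n) => eval y.ofLp g := contDiff_eval g
    have hfg : ContDiff ℝ ∞ fun y : EuclideanSpace ℝ (Fin n) => f y - eval y.ofLp g := hf.sub hg
    have hz : ∀ a x, partialDeriv a (fun y : EuclideanSpace ℝ (Fin n) => f y - eval y.ofLp g) x = 0 := by
      intro a x
      have h1 : HasFDerivAt (fun y : EuclideanSpace ℝ (Fin n) => f y - eval y.ofLp g)
          (fderiv ℝ f x - fderiv ℝ (fun y : EuclideanSpace ℝ (Fin n) => eval y.ofLp g) x) x :=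
        (hf.differentiable (by simp) x).hasFDerivAt.sub (hg.differentiable (by simp) x).hasFDerivAt
      have h2 : partialDeriv a (fun y : EuclideanSpace ℝ (Fin n) => f y - eval y.ofLp g) x =
          partialDeriv a f x - partialDeriv a (fun y => eval y.ofLp g) x := by
        rw [partialDeriv, h1.fderiv]
        rfl
      rw [h2, hd, partialDeriv_eval]
      simp only [g, map_sum]
      rw [Finset.sum_range_succ']
      simp only [pderiv_jet_succ 0 _ hf]
      simp [jet]
    have h0 := eq_const_of_partialDeriv_eq_zero hfg hz y 0
    have h1 : eval (0 : EuclideanSpace ℝ (Fin n)).ofLp g = f 0 := by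
      simp only [g, map_sum]
      rw [Finset.sum_range_succ']
      simp [jet]
    simp only [h1, sub_self] at h0
    rw [← map_sum]
    linarith

end Jets

/-! ### Surjectivity -/

section Surjective

variable {n s : ℕ}

/-- The components of the jets of a tensor field. -/
noncomputable def jetField (x₀ : EuclideanSpace ℝ (Fin n)) (d : ℕ) (V : TensorField n s)
    (i : Fin s → Fin n) : MvPolynomial (Fin n) ℝ := jet x₀ d fun y => V y i

/-- A subspace is cut out by linear functionals, and these commute with taking jets; so every
pointwise linear condition with constant coefficients passes to jets. -/
theorem jetField_mem (S : Submodule ℝ (Tens (Fin s) (Fin n))) {V : TensorField n s}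
    (hV : ContDiff ℝ ∞ V) (hS : ∀ x, V x ∈ S) (x₀ : EuclideanSpace ℝ (Fin n)) (d : ℕ)
    (y : EuclideanSpace ℝ (Fin n)) : polyField (jetField x₀ d V) y ∈ S := by
  by_contra hc
  obtain ⟨l, hl, hlS⟩ := Submodule.exists_le_ker_of_notMem hc
  refine hl ?_
  have hl' : ∀ W : Tens (Fin s) (Fin n), l W = ∑ i, l (Pi.single i 1) * W i := by
    intro W
    have h : W = ∑ i, W i • Pi.single i (1 : ℝ) := by
      funext j
      simp [Finset.sum_apply, Pi.single_apply]
    conv_lhs => rw [h]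
    rw [map_sum]
    exact Finset.sum_congr rfl fun i _ => by rw [map_smul, smul_eq_mul, mul_comm]
  have h0 : (fun x => ∑ i, l (Pi.single i 1) * V x i) = fun _ => 0 := by
    funext x
    rw [← hl']
    exact hlS (hS x)
  have h1 := jet_sum x₀ d Finset.univ (fun i => l (Pi.single i 1)) (f := fun i y => V y i)
    fun i => contDiff_pi.1 hV i
  have h2 : jet x₀ d (fun _ => (0 : ℝ)) = 0 := by
    have := jet_sum x₀ d (∅ : Finset Unit) (fun _ => 0) (f := fun _ _ => (0 : ℝ))
      fun _ => contDiff_const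
    simpa using this
  rw [h0, h2] at h1
  rw [hl']
  have h3 := congrArg (eval y.ofLp) h1
  rw [map_zero, map_sum] at h3
  rw [h3]
  exact Finset.sum_congr rfl fun i _ => by rw [smul_eval]; rfl

/-- The defining equations have constant coefficients, and the differential one involves first
derivatives only, so each homogeneous Taylor component satisfies them separately. -/
theorem polyField_jetField_mem {V : TensorField n s} (hV : V ∈ conformalKilling n s)
    (x₀ : EuclideanSpace ℝ (Fin n)) (d : ℕ) :
    polyField (jetField x₀ d V) ∈ conformalKilling n s := by
  obtain ⟨hV, hs, ht, hK⟩ := hV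
  refine ⟨contDiff_polyField _, jetField_mem _ hV hs x₀ d, jetField_mem _ hV ht x₀ d, fun x => ?_⟩
  cases d with
  | zero =>
    have : grad (polyField (jetField x₀ 0 V)) x = 0 := by
      funext j
      simp only [grad, polyField, partialDeriv_eval, jetField, jet]
      simp
    rw [this, map_zero]
    exact zero_mem _
  | succ d =>
    have hg : ContDiff ℝ ∞ (grad V) := contDiff_pi.2 fun j =>
      contDiff_partialDeriv (contDiff_pi.1 hV (Fin.tail j)) (j 0)
    have : grad (polyField (jetField x₀ (d + 1) V)) x = polyField (jetField x₀ d (grad V)) x := by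
      funext j
      simp only [grad, polyField, partialDeriv_eval, jetField]
      rw [pderiv_jet_succ x₀ d (contDiff_pi.1 hV (Fin.tail j))]
    rw [this]
    exact jetField_mem ((pureTrace n (s + 1)).comap symmetrize) hg hK x₀ d x

theorem rename_eq_aeval {σ τ : Type} (f : σ → τ) (p : MvPolynomial σ ℝ) :
    rename f p = aeval (fun b => (X (f b) : MvPolynomial τ ℝ)) p := by
  rw [← aeval_X_left_apply (rename f p), aeval_rename]
  rfl

theorem isWeightedHomogeneous_genPoly {d : ℕ} {v : (Fin s → Fin n) → MvPolynomial (Fin n) ℝ}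
    (hv : ∀ i, IsHomogeneous (v i) d) :
    IsWeightedHomogeneous (rowWeight (Fin n)) (genPoly v) (d, s) := by
  refine IsWeightedHomogeneous.sum _ _ _ fun i _ => ?_
  have h1 : IsWeightedHomogeneous (rowWeight (Fin n)) (rename (Prod.mk (0 : Fin 2)) (v i)) (d, 0) := by
    rw [rename_eq_aeval]
    exact isWeightedHomogeneous_aeval (w := (1 : Fin n → ℕ)) (AddMonoidHom.inl ℕ ℕ)
      (fun b => isWeightedHomogeneous_X ℝ (rowWeight (Fin n)) ((0 : Fin 2), b)) (hv i)
  have h2 : IsWeightedHomogeneous (rowWeight (Fin n))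
      (∏ k, (X ((1 : Fin 2), i k) : MvPolynomial (Fin 2 × Fin n) ℝ)) (∑ _k : Fin s, (0, 1)) :=
    IsWeightedHomogeneous.prod _ _ _ fun k _ =>
      isWeightedHomogeneous_X ℝ (rowWeight (Fin n)) ((1 : Fin 2), i k)
  have h3 := h1.mul h2
  have h4 : (d, 0) + ∑ _k : Fin s, ((0, 1) : ℕ × ℕ) = (d, s) := by simp
  rwa [h4] at h3

theorem exists_ambientToField_eq_of_homogeneous (hn : 3 ≤ n) {d : ℕ}
    {v : (Fin s → Fin n) → MvPolynomial (Fin n) ℝ} (hv : ∀ i, IsHomogeneous (v i) d)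
    (hK : polyField v ∈ conformalKilling n s) :
    ∃ T ∈ ambientKilling n s, polyField v = ambientToField T := by
  obtain ⟨-, hs, ht, hK⟩ := hK
  obtain ⟨T, hT, hd⟩ := exists_ambientKilling_of_poly hn (isWeightedHomogeneous_genPoly hv)
    (euclid_dvd_iff.2 fun x => by
      rw [evalAt_rowDer_genPoly, ← symmetrize_mem_pureTrace_iff]
      exact hK x)
  refine ⟨T, hT, ?_⟩
  obtain ⟨-, hs', ht', -⟩ := ambientToField_mem hT
  funext x
  refine eq_of_normSq_dvd_sub (hs x) (ht x) (hs' x) (ht' x) ?_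
  have h := euclid_dvd_iff.1 hd x
  rwa [← genPoly_fieldPoly, map_sub, evalAt_genPoly, evalAt_genPoly, ← ambientToField_eq] at h

theorem totalDegree_lowP_phiUp (A : AmbIndex n) : (lowP (phiUp n) A).totalDegree ≤ 2 := by
  rcases A with _ | _ | _
  · change (-(C (1 / 2) * normSq (Fin n))).totalDegree ≤ 2
    rw [totalDegree_neg]
    exact (IsHomogeneous.C_mul isHomogeneous_normSq _).totalDegree_le
  · simp [lowP, phiUp]
  · simp [lowP, phiUp]

theorem totalDegree_lowP_psiUp (b : Fin n) (A : AmbIndex n) :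
    (lowP (psiUp b) A).totalDegree ≤ 1 := by
  rcases A with _ | _ | _
  · simp [lowP, psiUp]
  · simp only [lowP, psiUp]
    split_ifs <;> simp
  · simp [lowP, psiUp]

/-- Each column contributes at most 2 from Φ and 1 from Ψ. Any bound that depends on s alone would
serve. -/
theorem totalDegree_fieldPoly_le (T : AmbTensor n s) (i : Fin s → Fin n) :
    (fieldPoly T i).totalDegree ≤ 3 * s := by
  rw [fieldPoly, ct_apply]
  refine totalDegree_finsetSum_le fun I _ => (totalDegree_smul_le _ _).trans ?_
  refine (totalDegree_finsetProd _ _).trans ?_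
  rw [Fintype.sum_prod_type]
  refine (Finset.sum_le_sum (g := fun _ => 3) fun k _ => ?_).trans (by simp [mul_comm])
  rw [Fin.sum_univ_two]
  exact add_le_add (totalDegree_lowP_phiUp _) (totalDegree_lowP_psiUp _ _)

theorem polyField_injective {v w : (Fin s → Fin n) → MvPolynomial (Fin n) ℝ}
    (h : polyField v = polyField w) : v = w := by
  funext i
  refine MvPolynomial.funext fun y => ?_
  exact congrFun (congrFun h (WithLp.toLp 2 y)) i

/-- The jet is homogeneous of degree d and comes from an ambient tensor, whose field has degree at
most 3s. -/
theorem jet_eq_zero (hn : 3 ≤ n) {V : TensorField n s} (hV : V ∈ conformalKilling n s)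
    (x₀ : EuclideanSpace ℝ (Fin n)) {d : ℕ} (hd : 3 * s < d) (i : Fin s → Fin n) :
    jet x₀ d (fun y => V y i) = 0 := by
  have hv : ∀ i, IsHomogeneous (jetField x₀ d V i) d := fun i => isHomogeneous_jet x₀ d _
  obtain ⟨T, hT, h⟩ := exists_ambientToField_eq_of_homogeneous hn hv
    (polyField_jetField_mem hV x₀ d)
  rw [ambientToField_eq] at h
  have h1 := congrFun (polyField_injective h) i
  change jetField x₀ d V i = 0
  by_contra hne
  have h2 := (hv i).totalDegree hne
  rw [h1] at h2
  have h3 := totalDegree_fieldPoly_le T i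
  omega

/-- `ambientToField` as a linear map. -/
noncomputable def fieldMap (n s : ℕ) : AmbTensor n s →ₗ[ℝ] TensorField n s where
  toFun := ambientToField
  map_add' T U := by
    funext x i
    simp [ambientToField, add_mul, Finset.sum_add_distrib]
  map_smul' c T := by
    funext x i
    simp [ambientToField, mul_assoc, Finset.mul_sum]

/-- Every conformal Killing tensor comes from an ambient tensor. -/
theorem exists_ambientToField_eq (hn : 3 ≤ n) {V : TensorField n s}
    (hV : V ∈ conformalKilling n s) : ∃ T ∈ ambientKilling n s, ambientToField T = V := by
  have h1 : ∀ d, ∃ T ∈ ambientKilling n s, polyField (jetField 0 d V) = ambientToField T :=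
    fun d => exists_ambientToField_eq_of_homogeneous hn (fun i => isHomogeneous_jet 0 d _)
      (polyField_jetField_mem hV 0 d)
  choose T hT hTV using h1
  refine ⟨∑ d ∈ Finset.range (3 * s + 1), T d, sum_mem fun d _ => hT d, ?_⟩
  have h2 : ambientToField (∑ d ∈ Finset.range (3 * s + 1), T d) =
      ∑ d ∈ Finset.range (3 * s + 1), ambientToField (T d) := map_sum (fieldMap n s) _ _
  rw [h2]
  funext y i
  rw [eq_sum_jet (3 * s + 1) (f := fun y => V y i) (contDiff_pi.1 hV.1 i)
    (fun x₀ => jet_eq_zero hn hV x₀ (by omega) i) y, Finset.sum_apply, Finset.sum_apply]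
  refine Finset.sum_congr rfl fun d _ => ?_
  rw [← hTV]
  rfl

/-- The isomorphism of the ambient tensors with the conformal Killing tensors. -/
noncomputable def fieldEquiv (hn : 3 ≤ n) : ambientKilling n s ≃ₗ[ℝ] conformalKilling n s :=
  LinearEquiv.ofBijective
    (((fieldMap n s).comp (ambientKilling n s).toSubmodule.subtype).codRestrict
      (conformalKilling n s) fun T => ambientToField_mem T.2) <| by
    constructor
    · rw [← LinearMap.ker_eq_bot, LinearMap.ker_eq_bot']
      intro T hT
      exact Subtype.ext (eq_zero_of_ambientToField hn T.2 (congrArg Subtype.val hT))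
    · intro V
      obtain ⟨T, hT, h⟩ := exists_ambientToField_eq hn V.2
      exact ⟨⟨T, hT⟩, Subtype.ext h⟩

end Surjective

/-! ### Invariant subspaces of harmonic polynomials -/

section Harmonic

variable {m : Type}

/-- The infinitesimal rotation `p_a ∂_b - p_b ∂_a`. -/
noncomputable def rot (a b : m) : Derivation ℝ (MvPolynomial m ℝ) (MvPolynomial m ℝ) :=
  (X a : MvPolynomial m ℝ) • pderiv b - (X b : MvPolynomial m ℝ) • pderiv a

theorem rot_apply (a b : m) (f : MvPolynomial m ℝ) :
    rot a b f = X a * pderiv b f - X b * pderiv a f := rfl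

theorem fischer_rot (a b : m) (f g : MvPolynomial m ℝ) :
    fischer (rot a b f) g = -fischer f (rot a b g) := by
  have h : ∀ a b : m, fischer (X a * pderiv b f) g = fischer f (X b * pderiv a g) := by
    intro a b
    rw [fischer_X_mul, fischer_comm, ← fischer_X_mul, fischer_comm]
  rw [rot_apply, rot_apply, map_sub, map_sub, LinearMap.sub_apply, h, h]
  ring

theorem linear_eq_zero_of_X_mul {l : MvPolynomial m ℝ →ₗ[ℝ] ℝ} {j : ℕ}
    (h : ∀ a (d : m →₀ ℕ), d.degree = j → l (X a * monomial d 1) = 0) {f : MvPolynomial m ℝ}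
    (hf : IsHomogeneous f (j + 1)) : l f = 0 := by
  classical
  rw [f.as_sum, map_sum]
  refine Finset.sum_eq_zero fun d hd => ?_
  have h1 : d.degree = j + 1 := by
    by_contra hne
    exact mem_support_iff.1 hd (hf.coeff_eq_zero hne)
  obtain ⟨a, ha⟩ : ∃ a, d a ≠ 0 := by
    by_contra hc
    push Not at hc
    have : d = 0 := Finsupp.ext hc
    rw [this, map_zero] at h1
    omega
  have h2 : d = Finsupp.single a 1 + (d - Finsupp.single a 1) := by
    rw [add_tsub_cancel_of_le]
    rw [Finsupp.single_le_iff]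
    omega
  have h3 : (d - Finsupp.single a 1).degree = j := by
    rw [h2, map_add, Finsupp.degree_single] at h1
    omega
  have h4 : monomial d (coeff d f) = coeff d f • (X a * monomial (d - Finsupp.single a 1) 1) := by
    rw [X, monomial_mul, ← h2, smul_monomial, one_mul, smul_eq_mul, mul_one]
  rw [h4, map_smul, h a _ h3, smul_zero]

theorem isHomogeneous_X_mul_pderiv (a b : m) {f : MvPolynomial m ℝ} {j : ℕ}
    (hf : IsHomogeneous f j) : IsHomogeneous (X a * pderiv b f) j := by
  cases j with
  | zero =>
    rw [(totalDegree_eq_zero_iff_eq_C).1 (Nat.le_zero.1 hf.totalDegree_le), pderiv_C, mul_zero]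
    exact isHomogeneous_zero _ _ _
  | succ j =>
    have h := (isHomogeneous_X ℝ a).mul (hf.pderiv (i := b))
    rwa [Nat.add_sub_cancel, add_comm] at h

/-- A rotation invariant space of homogeneous polynomials whose elements do not contain the power
of a variable is trivial. -/
theorem eq_zero_of_forall_fischer_X_pow {U : Submodule ℝ (MvPolynomial m ℝ)} {s : ℕ} (o : m)
    (hrot : ∀ a b, ∀ f ∈ U, rot a b f ∈ U) (h : ∀ f ∈ U, fischer f (X o ^ s) = 0)
    {f : MvPolynomial m ℝ} (hf : f ∈ U) (hfs : IsHomogeneous f s) : f = 0 := by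
  have key : ∀ j k, k + j = s → ∀ v ∈ U, ∀ g, IsHomogeneous g j → fischer v (X o ^ k * g) = 0 := by
    intro j
    induction j with
    | zero =>
      intro k hk v hv g hg
      rw [(totalDegree_eq_zero_iff_eq_C).1 (Nat.le_zero.1 hg.totalDegree_le), mul_comm,
        ← smul_eq_C_mul, map_smul, ← add_zero k, hk, h v hv, smul_zero]
    | succ j ih =>
      intro k hk v hv g hg
      let l : MvPolynomial m ℝ →ₗ[ℝ] ℝ := fischer v ∘ₗ LinearMap.mulLeft ℝ (X o ^ k)
      refine linear_eq_zero_of_X_mul (l := l) (fun a d hd => ?_) hg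
      change fischer v (X o ^ k * (X a * monomial d 1)) = 0
      have hm : IsHomogeneous (monomial d (1 : ℝ)) j := isHomogeneous_monomial _ hd
      set q := monomial d (1 : ℝ)
      by_cases ha : a = o
      · rw [ha, ← mul_assoc, ← pow_succ]
        exact ih (k + 1) (by omega) v hv q hm
      -- Up to terms with a higher power of the distinguished variable, X_o^k X_a q is a rotation of
      -- X_o^(k+1) q. Rotations are skew and preserve U, so everything on the right pairs to zero by
      -- induction.
      · have e : ((k : ℝ) + 1) • (X o ^ k * (X a * q)) = rot a o (X o ^ (k + 1) * q) -
            X o ^ (k + 1) * (X a * pderiv o q) + X o ^ (k + 1) * (X o * pderiv a q) := by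
          rw [rot_apply, Derivation.leibniz, Derivation.leibniz, Derivation.leibniz_pow,
            Derivation.leibniz_pow, pderiv_X_self, pderiv_X_of_ne (Ne.symm ha), smul_eq_C_mul]
          simp only [smul_eq_mul, nsmul_eq_mul, Nat.add_sub_cancel, map_add, map_one]
          push_cast
          rw [← C_eq_coe_nat]
          ring
        have e1 := congrArg (fischer v) e
        rw [map_smul, map_add, map_sub, ih (k + 1) (by omega) v hv _
          (isHomogeneous_X_mul_pderiv a o hm), ih (k + 1) (by omega) v hv _
          (isHomogeneous_X_mul_pderiv o a hm), ← neg_eq_iff_eq_neg.2 (fischer_rot a o v _),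
          ih (k + 1) (by omega) _ (hrot a o v hv) q hm] at e1
        refine (smul_eq_zero.1 (e1.trans (by simp))).resolve_left (by positivity)
  have h1 := key s 0 (zero_add s) f hf f hfs
  rw [pow_zero, one_mul] at h1
  exact fischer_self_eq_zero h1

variable [Fintype m] [DecidableEq m]

/-- The zonal harmonics are determined by the coefficient of the power of the first variable. -/
theorem eq_zero_of_zonal (hm : 3 ≤ Fintype.card m) {s : ℕ} (o : m) {w : MvPolynomial m ℝ}
    (hw : IsHomogeneous w s) (hlap : lap w = 0) (hrot : ∀ a b, a ≠ o → b ≠ o → rot a b w = 0)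
    (h : fischer w (X o ^ s) = 0) : w = 0 := by
  let E : Finset m := Finset.univ.erase o
  have hcard : (E.card : ℝ) = Fintype.card m - 1 := by
    rw [Finset.card_erase_of_mem (Finset.mem_univ o), Finset.card_univ, Nat.cast_sub (by omega)]
    simp
  -- the radial part of the Laplacian
  have hrad : ∀ a, a ≠ o → ((Fintype.card m : ℝ) - 2) • pderiv a w +
      ∑ b ∈ E, X b * pderiv b (pderiv a w) = -(X a * pderiv o (pderiv o w)) := by
    intro a ha
    -- Invariance under rotations fixing `o` lets X_a ∂_b be replaced by X_b ∂_a; applying ∂_b,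
    -- summing over b and using harmonicity eliminates the Laplacian in the directions other than
    -- `o`.
    have h1 : ∀ b ∈ E, X a * pderiv b w = X b * pderiv a w := fun b hb => by
      have := hrot a b ha (Finset.ne_of_mem_erase hb)
      rw [rot_apply] at this
      exact sub_eq_zero.1 this
    have h2 : ∑ b ∈ E, pderiv b (X a * pderiv b w) = ∑ b ∈ E, pderiv b (X b * pderiv a w) :=
      Finset.sum_congr rfl fun b hb => by rw [h1 b hb]
    have haE : a ∈ E := Finset.mem_erase.2 ⟨ha, Finset.mem_univ a⟩
    have h3 : ∑ b ∈ E, pderiv b (X a * pderiv b w) =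
        X a * ∑ b ∈ E, pderiv b (pderiv b w) + pderiv a w := by
      simp only [Derivation.leibniz, smul_eq_mul, Finset.sum_add_distrib, Finset.mul_sum]
      congr 1
      rw [Finset.sum_eq_single a]
      · rw [pderiv_X_self, mul_one]
      · intro b _ hb
        rw [pderiv_X_of_ne hb.symm, mul_zero]
      · exact fun h => absurd haE h
    have h4 : ∑ b ∈ E, pderiv b (X b * pderiv a w) =
        ∑ b ∈ E, X b * pderiv b (pderiv a w) + (E.card : ℝ) • pderiv a w := by
      simp only [Derivation.leibniz, smul_eq_mul, Finset.sum_add_distrib, pderiv_X_self, mul_one,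
        Finset.sum_const, ← Nat.cast_smul_eq_nsmul ℝ]
    have h5 : pderiv o (pderiv o w) + ∑ b ∈ E, pderiv b (pderiv b w) = 0 := by
      rw [← hlap, lap, Finset.add_sum_erase _ (fun b => pderiv b (pderiv b w)) (Finset.mem_univ o)]
    rw [h3, h4, hcard] at h2
    have h6 : ((Fintype.card m : ℝ) - 1) • pderiv a w =
        ((Fintype.card m : ℝ) - 2) • pderiv a w + pderiv a w := by
      module
    rw [h6] at h2
    linear_combination X a * h5 - h2
  have key : ∀ j k, k + j = s → ∀ g, IsHomogeneous g j → fischer w (X o ^ k * g) = 0 := by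
    intro j
    induction j with
    | zero =>
      intro k hk g hg
      rw [(totalDegree_eq_zero_iff_eq_C).1 (Nat.le_zero.1 hg.totalDegree_le), mul_comm,
        ← smul_eq_C_mul, map_smul, ← add_zero k, hk, h, smul_zero]
    | succ j ih =>
      intro k hk g hg
      let l : MvPolynomial m ℝ →ₗ[ℝ] ℝ := fischer w ∘ₗ LinearMap.mulLeft ℝ (X o ^ k)
      refine linear_eq_zero_of_X_mul (l := l) (fun a d hd => ?_) hg
      change fischer w (X o ^ k * (X a * monomial d 1)) = 0
      have hq : IsHomogeneous (monomial d (1 : ℝ)) j := isHomogeneous_monomial _ hd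
      have hEuler : ∀ b, b ≠ o → X b * pderiv b (X o ^ k * monomial d (1 : ℝ)) =
          (d b : ℝ) • (X o ^ k * monomial d 1) := by
        intro b hb
        rw [Derivation.leibniz, Derivation.leibniz_pow, pderiv_X_of_ne hb.symm]
        have : X b * pderiv b (monomial d (1 : ℝ)) = (d b : ℝ) • monomial d 1 := by
          rw [X_mul_pderiv_monomial, Nat.cast_smul_eq_nsmul]
        simp only [smul_eq_mul, mul_zero, smul_zero, add_zero]
        rw [mul_left_comm, this, mul_smul_comm]
      set q := monomial d (1 : ℝ)
      by_cases ha : a = o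
      · rw [ha, ← mul_assoc, ← pow_succ]
        exact ih (k + 1) (by omega) q hq
      · have h1 := congrArg (fun f => fischer f (X o ^ k * q)) (hrad a ha)
        have h2 : fischer (-(X a * pderiv o (pderiv o w))) (X o ^ k * q) = 0 := by
          rw [map_neg, LinearMap.neg_apply, neg_eq_zero, fischer_X_mul, fischer_comm,
            ← fischer_X_mul_X_mul, fischer_comm, Derivation.leibniz, Derivation.leibniz_pow,
            pderiv_X_of_ne (Ne.symm ha)]
          simp only [smul_eq_mul, mul_zero, smul_zero, add_zero]
          have : X o * X o * (X o ^ k * pderiv a q) = X o ^ (k + 1) * (X o * pderiv a q) := by ring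
          rw [this]
          exact ih (k + 1) (by omega) _ (isHomogeneous_X_mul_pderiv o a hq)
        have h3 : ∀ b ∈ E, fischer (X b * pderiv b (pderiv a w)) (X o ^ k * q) =
            (d b : ℝ) * fischer (pderiv a w) (X o ^ k * q) := by
          intro b hb
          rw [fischer_X_mul, fischer_comm, ← fischer_X_mul, fischer_comm,
            hEuler b (Finset.ne_of_mem_erase hb), map_smul, smul_eq_mul]
        simp only [map_add, LinearMap.add_apply, map_smul, LinearMap.smul_apply, map_sum,
          LinearMap.sum_apply, smul_eq_mul] at h1
        rw [h2, Finset.sum_congr rfl h3, ← Finset.sum_mul, ← add_mul] at h1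
        -- Pairing the radial equation with X_o^k q reduces the coefficient in question to
        -- coefficients with a higher power of X_o. The multiplier does not vanish because the
        -- dimension is at least 3.
        have h4 : (0 : ℝ) < (Fintype.card m : ℝ) - 2 + ∑ b ∈ E, (d b : ℝ) := by
          have h5 : (3 : ℝ) ≤ Fintype.card m := by exact_mod_cast hm
          have h6 : (0 : ℝ) ≤ ∑ b ∈ E, (d b : ℝ) := Finset.sum_nonneg fun _ _ => by positivity
          linarith
        have h7 := (mul_eq_zero.1 h1).resolve_left h4.ne'
        rw [← mul_left_comm, fischer_comm, fischer_X_mul, fischer_comm]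
        exact h7
  have h1 := key s 0 (zero_add s) w hw
  rw [pow_zero, one_mul] at h1
  exact fischer_self_eq_zero h1

/-- Two nontrivial rotation invariant spaces of harmonic polynomials of the same degree
intersect. -/
theorem exists_mem_of_rot_invariant (hm : 3 ≤ Fintype.card m) {s : ℕ}
    {U W : Submodule ℝ (MvPolynomial m ℝ)} [FiniteDimensional ℝ U] [FiniteDimensional ℝ W]
    (hU : ∀ f ∈ U, IsHomogeneous f s ∧ lap f = 0) (hW : ∀ f ∈ W, IsHomogeneous f s ∧ lap f = 0)
    (hUr : ∀ a b, ∀ f ∈ U, rot a b f ∈ U) (hWr : ∀ a b, ∀ f ∈ W, rot a b f ∈ W)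
    (hU0 : U ≠ ⊥) (hW0 : W ≠ ⊥) : ∃ f ∈ U, f ∈ W ∧ f ≠ 0 := by
  obtain ⟨o⟩ : Nonempty m := Fintype.card_pos_iff.1 (by omega)
  have zonal : ∀ U : Submodule ℝ (MvPolynomial m ℝ), FiniteDimensional ℝ U →
      (∀ f ∈ U, IsHomogeneous f s ∧ lap f = 0) → (∀ a b, ∀ f ∈ U, rot a b f ∈ U) → U ≠ ⊥ →
      ∃ z ∈ U, (∀ a b, a ≠ o → b ≠ o → rot a b z = 0) ∧ fischer z (X o ^ s) ≠ 0 := by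
    intro U _ hU hUr hU0
    -- The projection of X_o^s to U inherits the invariance of X_o^s under rotations fixing `o`. If
    -- it were zero, every element of U would be orthogonal to X_o^s, which forces U to be trivial.
    obtain ⟨z, hz⟩ := exists_fischer_proj U ((fischer (X o ^ s)) ∘ₗ U.subtype)
    have hz' : ∀ v ∈ U, fischer z.1 v = fischer (X o ^ s) v := fun v hv => hz ⟨v, hv⟩
    refine ⟨z, z.2, fun a b ha hb => ?_, fun h0 => hU0 ?_⟩
    · refine fischer_self_eq_zero ?_
      have h1 := hUr a b z.1 z.2
      rw [fischer_rot, hz' _ (hUr a b _ h1), ← fischer_rot]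
      have : rot a b (X o ^ s) = 0 := by
        rw [rot_apply, Derivation.leibniz_pow, Derivation.leibniz_pow, pderiv_X_of_ne ha.symm,
          pderiv_X_of_ne hb.symm]
        simp
      rw [this, map_zero, LinearMap.zero_apply]
    · have hz0 : z.1 = 0 := fischer_self_eq_zero (by rw [hz' _ z.2, fischer_comm, h0])
      refine (Submodule.eq_bot_iff U).2 fun f hf => ?_
      refine eq_zero_of_forall_fischer_X_pow o hUr (fun v hv => ?_) hf (hU f hf).1
      rw [fischer_comm, ← hz' v hv, hz0, map_zero, LinearMap.zero_apply]
  obtain ⟨z, hz, hzr, hz0⟩ := zonal U inferInstance hU hUr hU0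
  obtain ⟨y, hy, hyr, hy0⟩ := zonal W inferInstance hW hWr hW0
  -- The combination is chosen to be orthogonal to X_o^s, so uniqueness of the zonal harmonic makes
  -- it vanish and z and y are proportional.
  have h0 : fischer y (X o ^ s) • z - fischer z (X o ^ s) • y = 0 := by
    refine eq_zero_of_zonal hm o ?_ ?_ (fun a b ha hb => ?_) ?_ (s := s)
    · simp only [smul_eq_C_mul]
      exact ((hU z hz).1.C_mul _).sub ((hW y hy).1.C_mul _)
    · have h1 := (hU z hz).2
      have h2 := (hW y hy).2
      rw [lap] at h1 h2
      simp only [lap, map_sub, Derivation.map_smul, Finset.sum_sub_distrib, ← Finset.smul_sum, h1,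
        h2, smul_zero, sub_zero]
    · rw [map_sub, Derivation.map_smul, Derivation.map_smul, hzr a b ha hb, hyr a b ha hb,
        smul_zero, smul_zero, sub_zero]
    · rw [map_sub, map_smul, map_smul, LinearMap.sub_apply, LinearMap.smul_apply,
        LinearMap.smul_apply, smul_eq_mul, smul_eq_mul]
      ring
  refine ⟨z, hz, ?_, fun e => hz0 (by rw [e, map_zero, LinearMap.zero_apply])⟩
  rw [← inv_smul_smul₀ hy0 z, sub_eq_zero.1 h0]
  exact W.smul_mem _ (W.smul_mem _ hy)

end Harmonic

/-! ### Translations and rotations -/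

section Generators

variable {n s : ℕ}

theorem skewForm_sub (A B : Matrix (AmbIndex n) (AmbIndex n) ℝ)
    (v w : AmbIndex n → MvPolynomial (Fin n) ℝ) :
    skewForm (A - B) v w = skewForm A v w - skewForm B v w := by
  simp only [skewForm, Matrix.sub_apply, C_sub, mul_sub, sub_mul, Finset.sum_sub_distrib]

theorem skewForm_single (E F : AmbIndex n) (v w : AmbIndex n → MvPolynomial (Fin n) ℝ) :
    skewForm (Matrix.single E F 1) v w = lowP v E * w F := by
  simp only [skewForm, Matrix.single_apply]
  rw [Finset.sum_eq_single E, Finset.sum_eq_single F]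
  · simp
  · intro Q _ hQ
    simp [hQ.symm]
  · simp
  · intro B _ hB
    simp [hB.symm]
  · simp

/-- The generator of the translations in the direction `a`. -/
def translation (a : Fin n) : Matrix (AmbIndex n) (AmbIndex n) ℝ :=
  Matrix.single (.inr (.inr ())) (.inr (.inl a)) 1 - Matrix.single (.inr (.inl a)) (.inl ()) 1

/-- The generator of the rotations in the plane of the directions `a` and `b`. -/
def rotation (a b : Fin n) : Matrix (AmbIndex n) (AmbIndex n) ℝ :=
  Matrix.single (.inr (.inl a)) (.inr (.inl b)) 1 - Matrix.single (.inr (.inl b)) (.inr (.inl a)) 1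

theorem mem_so_iff {A : Matrix (AmbIndex n) (AmbIndex n) ℝ} :
    A ∈ so n ↔ A.transpose * ambientMetric n = -(ambientMetric n * A) := by
  rw [mem_skewAdjointMatricesLieSubalgebra, mem_skewAdjointMatricesSubmodule, ← mul_neg]
  rfl

theorem ambientMetric_mul_single (E F : AmbIndex n) (G : AmbIndex n)
    (hG : ∀ B, ambientMetric n B E = if B = G then 1 else 0) :
    ambientMetric n * Matrix.single E F 1 = Matrix.single G F 1 := by
  ext B Q
  rw [Matrix.mul_apply, Finset.sum_eq_single E]
  · rw [hG, Matrix.single_apply, Matrix.single_apply]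
    by_cases h : B = G
    · simp [h]
    · simp [h, Ne.symm h]
  · intro C _ hC
    rw [Matrix.single_apply, if_neg (fun h => hC h.1.symm), mul_zero]
  · simp

theorem mem_so_of_skew {A : Matrix (AmbIndex n) (AmbIndex n) ℝ}
    (h : (ambientMetric n * A).transpose = -(ambientMetric n * A)) : A ∈ so n := by
  rw [mem_so_iff, ← h, Matrix.transpose_mul, ambientMetric_isSymm.eq]

theorem ambientMetric_inf (B : AmbIndex n) :
    ambientMetric n B (.inr (.inr ())) = if B = .inl () then 1 else 0 := by
  rcases B with _ | _ | _ <;> simp [ambientMetric]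

theorem ambientMetric_mid (a : Fin n) (B : AmbIndex n) :
    ambientMetric n B (.inr (.inl a)) = if B = .inr (.inl a) then 1 else 0 := by
  rcases B with _ | _ | _ <;> simp [ambientMetric, Matrix.one_apply]

theorem translation_mem (a : Fin n) : translation a ∈ so n := by
  refine mem_so_of_skew ?_
  rw [translation, mul_sub, ambientMetric_mul_single _ _ _ ambientMetric_inf,
    ambientMetric_mul_single _ _ _ (ambientMetric_mid a), Matrix.transpose_sub,
    Matrix.transpose_single, Matrix.transpose_single, neg_sub]

theorem rotation_mem (a b : Fin n) : rotation a b ∈ so n := by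
  refine mem_so_of_skew ?_
  rw [rotation, mul_sub, ambientMetric_mul_single _ _ _ (ambientMetric_mid a),
    ambientMetric_mul_single _ _ _ (ambientMetric_mid b), Matrix.transpose_sub,
    Matrix.transpose_single, Matrix.transpose_single, neg_sub]

/-- The ambient metric is its own inverse as a matrix. Stability under transposition makes the
Euclidean orthogonal complement of an invariant subspace invariant. -/
theorem transpose_mem_so {A : Matrix (AmbIndex n) (AmbIndex n) ℝ} (hA : A ∈ so n) :
    A.transpose ∈ so n := by
  have hg : ambientMetric n * ambientMetric n = 1 := by
    ext B Q
    rw [Matrix.mul_apply]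
    rcases B with _ | _ | _ <;> rcases Q with _ | _ | _ <;>
      simp [ambientMetric, Fintype.sum_sum_type, Matrix.one_apply]
  rw [mem_so_iff] at hA ⊢
  have h := congrArg (fun M => ambientMetric n * M * ambientMetric n) hA
  simp only [mul_neg, neg_mul, ← mul_assoc, hg, one_mul] at h
  rw [mul_assoc, mul_assoc, hg, mul_one] at h
  rw [Matrix.transpose_transpose, h, neg_neg]

theorem killingPoly_translation (a b : Fin n) :
    killingPoly (translation a) b = if b = a then 1 else 0 := by
  rw [killingPoly, translation, skewForm_sub, skewForm_single, skewForm_single]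
  simp [lowP, phiUp, psiUp]

theorem killingPoly_rotation (a b c : Fin n) :
    killingPoly (rotation a b) c = (if c = b then X a else 0) - if c = a then X b else 0 := by
  rw [killingPoly, rotation, skewForm_sub, skewForm_single, skewForm_single]
  simp [lowP, phiUp, psiUp]

theorem fieldPoly_translation {T : AmbTensor n s} (hT : T ∈ ambientKilling n s) (a : Fin n)
    (i : Fin s → Fin n) : fieldPoly (tensAct (translation a) T) i = pderiv a (fieldPoly T i) := by
  rw [fieldPoly_tensAct (translation_mem a) (mem_ambientKilling.1 hT).1]
  have h : ∀ b c, pderiv c (killingPoly (translation a) b) = 0 := by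
    intro b c
    rw [killingPoly_translation]
    split_ifs <;> simp
  simp only [h, mul_zero, Finset.sum_const_zero, sub_zero]
  simp only [killingPoly_translation, ite_mul, one_mul, zero_mul, Finset.sum_ite_eq',
    Finset.mem_univ, if_true]

theorem pderiv_killingPoly_rotation (a b c d : Fin n) :
    pderiv d (killingPoly (rotation a b) c) =
      C ((if c = b ∧ d = a then 1 else 0) - if c = a ∧ d = b then 1 else 0) := by
  rw [killingPoly_rotation]
  by_cases h1 : c = b <;> by_cases h2 : c = a <;> by_cases h3 : d = a <;> by_cases h4 : d = b <;>
    simp [h1, h2, h3, h4, pderiv_X, Pi.single_apply, eq_comm] <;> simp_all [eq_comm]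

end Generators

/-! ### Constant conformal Killing tensors -/

section Constant

variable {n s : ℕ}

/-- The ambient tensors whose tensor fields are constant. -/
noncomputable def constantField (n s : ℕ) : Submodule ℝ (AmbTensor n s) where
  carrier := {T | ∀ a i, pderiv a (fieldPoly T i) = 0}
  add_mem' {T U} hT hU a i := by
    rw [fieldPoly, map_add, map_add]
    exact (congrArg₂ (· + ·) (hT a i) (hU a i)).trans (add_zero 0)
  zero_mem' a i := by rw [fieldPoly, map_zero, map_zero]
  smul_mem' c T hT a i := by
    rw [fieldPoly, map_smul, Derivation.map_smul]
    exact (congrArg _ (hT a i)).trans (smul_zero c)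

/-- The value at the origin of the tensor field of an ambient tensor, as a polynomial. -/
noncomputable def valueAtZero (n s : ℕ) : AmbTensor n s →ₗ[ℝ] MvPolynomial (Fin n) ℝ :=
  formPoly ∘ₗ LinearMap.proj (0 : EuclideanSpace ℝ (Fin n)) ∘ₗ fieldMap n s

theorem valueAtZero_apply (T : AmbTensor n s) :
    valueAtZero n s T = formPoly (ambientToField T 0) := rfl

theorem valueAtZero_spec {T : AmbTensor n s} (hT : T ∈ ambientKilling n s) :
    IsHomogeneous (valueAtZero n s T) s ∧ lap (valueAtZero n s T) = 0 := by
  constructor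
  · have h : Fintype.card (Fin s) = s := Fintype.card_fin s
    exact (congrArg (IsHomogeneous _) h).mp (isHomogeneous_formPoly (ambientToField T 0))
  · exact lap_formPoly ((ambientToField_mem hT).2.2.1 0)

theorem eq_C_of_pderiv_eq_zero {f : MvPolynomial (Fin n) ℝ} (h : ∀ a, pderiv a f = 0) :
    f = C (coeff 0 f) := by
  ext d
  rw [coeff_C]
  split_ifs with hd
  · rw [hd]
  · obtain ⟨a, ha⟩ : ∃ a, d a ≠ 0 := by
      by_contra hc
      push Not at hc
      exact hd (Finsupp.ext fun a => (hc a).symm)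
    have h1 := congrArg (coeff (d - Finsupp.single a 1)) (h a)
    have h2 : d - Finsupp.single a 1 + Finsupp.single a 1 = d :=
      tsub_add_cancel_of_le (Finsupp.single_le_iff.2 (by omega))
    rw [coeff_pderiv, coeff_zero, h2] at h1
    exact (mul_eq_zero.1 h1).resolve_right (by positivity)

/-- A constant field is known from its value at the origin, and a symmetric tensor from its
polynomial. -/
theorem eq_zero_of_valueAtZero (hn : 3 ≤ n) {T : AmbTensor n s} (hT : T ∈ ambientKilling n s)
    (hc : T ∈ constantField n s) (h : valueAtZero n s T = 0) : T = 0 := by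
  refine eq_zero_of_ambientToField hn hT ?_
  have h0 : ambientToField T 0 = 0 := eq_zero_of_formPoly ((ambientToField_mem hT).2.1 0) h
  funext x i
  have h1 := congrFun h0 i
  rw [ambientToField_eq] at h1 ⊢
  simp only [polyField] at h1 ⊢
  rw [eq_C_of_pderiv_eq_zero fun a => hc a i, eval_C] at h1 ⊢
  exact h1

/-- Translations act as partial derivatives and lower the degree of the field, so applying them as
long as the result is nonzero ends with a constant field. -/
theorem exists_constantField {W : Submodule ℝ (AmbTensor n s)}
    (hW : ∀ T ∈ W, T ∈ ambientKilling n s) (hinv : ∀ A ∈ so n, ∀ T ∈ W, tensAct A T ∈ W)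
    (h0 : W ≠ ⊥) : ∃ T ∈ W, T ∈ constantField n s ∧ T ≠ 0 := by
  have key : ∀ D : ℕ, ∀ T ∈ W, T ≠ 0 → (∀ i, (fieldPoly T i).totalDegree ≤ D) →
      ∃ T ∈ W, T ∈ constantField n s ∧ T ≠ 0 := by
    intro D
    induction D with
    | zero =>
      intro T hT hT0 hD
      refine ⟨T, hT, fun a i => ?_, hT0⟩
      rw [totalDegree_eq_zero_iff_eq_C.1 (Nat.le_zero.1 (hD i)), pderiv_C]
    | succ D ih =>
      intro T hT hT0 hD
      by_cases h : ∀ a, tensAct (translation a) T = 0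
      · refine ⟨T, hT, fun a i => ?_, hT0⟩
        rw [← fieldPoly_translation (hW T hT), h, fieldPoly, map_zero]
      · push Not at h
        obtain ⟨a, ha⟩ := h
        refine ih _ (hinv _ (translation_mem a) T hT) ha fun i => ?_
        rw [fieldPoly_translation (hW T hT)]
        exact totalDegree_pderiv_le (hD i)
  obtain ⟨T, hT, hT0⟩ := Submodule.exists_mem_ne_zero_of_ne_bot h0
  exact key (3 * s) T hT hT0 (totalDegree_fieldPoly_le T)

theorem formPoly_tensAct (A : Matrix (Fin n) (Fin n) ℝ)
    (D : Derivation ℝ (MvPolynomial (Fin n) ℝ) (MvPolynomial (Fin n) ℝ))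
    (hD : ∀ c, D (X c) = ∑ d, A d c • X d) (V : Tens (Fin s) (Fin n)) :
    formPoly (tensAct A V) = D (formPoly V) := by
  rw [formPoly, ct_tensAct, ct_derivation]
  simp only [hD]

theorem rotation_mem_constantField {T : AmbTensor n s} (hT : T ∈ ambientKilling n s)
    (hc : T ∈ constantField n s) (a b : Fin n) :
    tensAct (rotation a b) T ∈ constantField n s := by
  intro c i
  have hc' : ∀ a i, pderiv a (fieldPoly T i) = 0 := hc
  rw [fieldPoly_tensAct (rotation_mem a b) (mem_ambientKilling.1 hT).1]
  simp only [hc', mul_zero, Finset.sum_const_zero, zero_sub, map_neg, map_sum, Derivation.leibniz,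
    pderiv_killingPoly_rotation, pderiv_C, smul_zero, add_zero, neg_zero]

theorem valueAtZero_rotation {T : AmbTensor n s} (hT : T ∈ ambientKilling n s)
    (hc : T ∈ constantField n s) (a b : Fin n) :
    valueAtZero n s (tensAct (rotation a b) T) = rot a b (valueAtZero n s T) := by
  have hc' : ∀ a i, pderiv a (fieldPoly T i) = 0 := hc
  let M : Matrix (Fin n) (Fin n) ℝ := Matrix.of fun c d =>
    -((if c = b ∧ d = a then 1 else 0) - if c = a ∧ d = b then 1 else 0)
  have h : ambientToField (tensAct (rotation a b) T) 0 = tensAct M (ambientToField T 0) := by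
    funext i
    rw [ambientToField_eq, ambientToField_eq, polyField,
      fieldPoly_tensAct (rotation_mem a b) (mem_ambientKilling.1 hT).1]
    simp only [hc', mul_zero, Finset.sum_const_zero, zero_sub, map_neg, map_sum, map_mul,
      pderiv_killingPoly_rotation, eval_C, tensAct_apply, Finset.sum_apply, slotAct,
      LinearMap.coe_mk, AddHom.coe_mk, ← Finset.sum_neg_distrib]
    refine Finset.sum_congr rfl fun k _ => Finset.sum_congr rfl fun c _ => ?_
    simp only [M, Matrix.of_apply, polyField]
    ring
  rw [valueAtZero_apply, valueAtZero_apply, h]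
  refine formPoly_tensAct M (rot a b) (fun c => ?_) _
  simp only [M, Matrix.of_apply, neg_smul, sub_smul, Finset.sum_neg_distrib, Finset.sum_sub_distrib,
    ite_smul, one_smul, zero_smul, rot_apply, pderiv_X, Pi.single_apply, ite_and, mul_ite, mul_one,
    mul_zero]
  have h : ∀ (p : Prop) [Decidable p] (e : Fin n), (∑ d, if d = e then (if p then
      (X d : MvPolynomial (Fin n) ℝ) else 0) else 0) = if p then X e else 0 := by
    intro p _ e
    simp
  rw [h, h]
  ring

/-- There are nontrivial conformal Killing tensors. -/
theorem exists_conformalKilling_ne_zero (hn : 3 ≤ n) : ∃ V ∈ conformalKilling n s, V ≠ 0 := by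
  -- A complex null vector. The real part of its s-th tensor power is symmetric and trace-free, and
  -- defines a constant field; its component with all indices 0 is 1.
  let z : Fin n → ℂ := fun a => if a.1 = 0 then 1 else if a.1 = 1 then Complex.I else 0
  have hz : ∑ a, z a * z a = 0 := by
    obtain ⟨k, rfl⟩ : ∃ k, n = k + 2 := ⟨n - 2, by omega⟩
    rw [Fin.sum_univ_succ, Fin.sum_univ_succ, Finset.sum_eq_zero]
    · simp [z]
    · intro a _
      simp [z]
  let W : Tens (Fin s) (Fin n) := fun i => (∏ k, z (i k)).re
  refine ⟨fun _ => W, ⟨contDiff_const, fun _ => mem_symmetric.2 fun σ => ?_, fun _ => ?_, fun x => ?_⟩,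
    fun h => ?_⟩
  · funext i
    exact congrArg Complex.re (Equiv.prod_comp σ fun k => z (i k))
  · simp only [traceFree, Submodule.mem_iInf, LinearMap.mem_ker]
    intro p q hpq
    funext i
    have h1 : ∀ a, ∏ k, z (Function.update (Function.update i p a) q a k) =
        z a * z a * ∏ k ∈ (Finset.univ.erase q).erase p, z (i k) := by
      intro a
      rw [← Finset.mul_prod_erase _ _ (Finset.mem_univ q),
        ← Finset.mul_prod_erase (Finset.univ.erase q) _
          (Finset.mem_erase.2 ⟨hpq, Finset.mem_univ p⟩), Function.update_self,
        Function.update_of_ne hpq, Function.update_self, mul_assoc]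
      congr 2
      refine Finset.prod_congr rfl fun k hk => ?_
      rw [Function.update_of_ne (Finset.ne_of_mem_erase (Finset.mem_of_mem_erase hk)),
        Function.update_of_ne (Finset.ne_of_mem_erase hk)]
    simp only [contract, LinearMap.coe_mk, AddHom.coe_mk, Matrix.one_apply, ite_mul, one_mul,
      zero_mul, Finset.sum_ite_eq, Finset.mem_univ, if_true, W, h1]
    rw [← Complex.re_sum, ← Finset.sum_mul, hz, zero_mul]
    rfl
  · have : grad (fun _ : EuclideanSpace ℝ (Fin n) => W) x = 0 := by
      funext j
      simp [grad, partialDeriv]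
    rw [this, map_zero]
    exact zero_mem _
  · have h1 := congrFun (congrFun h 0) fun _ => ⟨0, by omega⟩
    simp [W, z] at h1

end Constant

/-! ### Irreducibility -/

section Irreducible

variable {n s : ℕ}

/-- The standard inner product of tensors. -/
noncomputable def tensInner {ι m : Type} [Fintype ι] [DecidableEq ι] [Fintype m] :
    Tens ι m →ₗ[ℝ] Tens ι m →ₗ[ℝ] ℝ :=
  LinearMap.mk₂ ℝ (fun T U => ∑ i, T i * U i)
    (fun _ _ _ => by simp [add_mul, Finset.sum_add_distrib])
    (fun _ _ _ => by simp [mul_assoc, Finset.mul_sum])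
    (fun _ _ _ => by simp [mul_add, Finset.sum_add_distrib])
    fun _ _ _ => by simp [mul_left_comm, Finset.mul_sum]

section Inner

variable {ι m : Type} [Fintype ι] [DecidableEq ι] [Fintype m]

theorem tensInner_apply (T U : Tens ι m) : tensInner T U = ∑ i, T i * U i := rfl

theorem tensInner_self_eq_zero {T : Tens ι m} (h : tensInner T T = 0) : T = 0 := by
  rw [tensInner_apply, Finset.sum_eq_zero_iff_of_nonneg fun i _ => mul_self_nonneg (T i)] at h
  funext i
  exact mul_self_eq_zero.1 (h i (Finset.mem_univ i))

theorem tensInner_slotAct (A : Matrix m m ℝ) (p : ι) (T U : Tens ι m) :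
    tensInner (slotAct A p T) U = tensInner T (slotAct A.transpose p U) := by
  simp only [tensInner_apply, slotAct, LinearMap.coe_mk, AddHom.coe_mk, Finset.sum_mul,
    Finset.mul_sum]
  rw [← Fintype.sum_prod_type', ← Fintype.sum_prod_type']
  refine Fintype.sum_equiv (Function.Involutive.toPerm
    (fun x : (ι → m) × m => (Function.update x.1 p x.2, x.1 p)) ?_) _ _ fun x => ?_
  · rintro ⟨I, E⟩
    simp
  · obtain ⟨I, E⟩ := x
    change A (I p) E * T (Function.update I p E) * U I = T (Function.update I p E) *
      (A.transpose (Function.update I p E p) (I p) *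
        U (Function.update (Function.update I p E) p (I p)))
    rw [Function.update_self, Function.update_idem, Function.update_eq_self, Matrix.transpose_apply]
    ring

theorem tensInner_tensAct (A : Matrix m m ℝ) (T U : Tens ι m) :
    tensInner (tensAct A T) U = tensInner T (tensAct A.transpose U) := by
  simp only [tensAct_apply, map_sum, LinearMap.sum_apply, tensInner_slotAct]

end Inner

theorem exists_ne_zero_orthogonal {W K : Submodule ℝ (AmbTensor n s)} (h : W < K) :
    ∃ T ∈ K, T ≠ 0 ∧ ∀ U ∈ W, tensInner U T = 0 := by
  obtain ⟨S, hS, hSW⟩ := Set.exists_of_ssubset h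
  obtain ⟨l, hl, hlW⟩ := Submodule.exists_le_ker_of_notMem hSW
  -- The inner product is definite on K, so it represents a functional that vanishes on W but not on
  -- all of K; the representing vector is the one sought.
  let φ : K →ₗ[ℝ] Module.Dual ℝ K := (LinearMap.lcomp ℝ ℝ K.subtype) ∘ₗ tensInner ∘ₗ K.subtype
  have hφ : ∀ w v : K, φ w v = tensInner (w : AmbTensor n s) v := fun _ _ => rfl
  have hinj : Function.Injective φ := by
    rw [injective_iff_map_eq_zero]
    intro w hw
    have h1 : tensInner (w : AmbTensor n s) w = 0 := by rw [← hφ, hw]; rfl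
    exact Subtype.ext (tensInner_self_eq_zero h1)
  have hsurj : Function.Surjective φ :=
    (LinearMap.injective_iff_surjective_of_finrank_eq_finrank
      (Subspace.dual_finrank_eq).symm).1 hinj
  obtain ⟨w, hw⟩ := hsurj (l ∘ₗ K.subtype)
  have hw' : ∀ v ∈ K, tensInner w.1 v = l v := fun v hv => by
    rw [← hφ w ⟨v, hv⟩, hw]
    rfl
  refine ⟨w, w.2, fun h0 => hl ?_, fun U hU => ?_⟩
  · rw [← hw' S hS, h0, map_zero, LinearMap.zero_apply]
  · have h1 := hw' U (h.le hU)
    rw [show l U = 0 from hlW hU] at h1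
    rw [← h1, tensInner_apply, tensInner_apply]
    exact Finset.sum_congr rfl fun i _ => mul_comm _ _

/-- Nontrivial invariant subspaces of the space of ambient tensors intersect. -/
theorem exists_mem_of_invariant (hn : 3 ≤ n) {W₁ W₂ : Submodule ℝ (AmbTensor n s)}
    (hW₁ : ∀ T ∈ W₁, T ∈ ambientKilling n s) (hW₂ : ∀ T ∈ W₂, T ∈ ambientKilling n s)
    (hinv₁ : ∀ A ∈ so n, ∀ T ∈ W₁, tensAct A T ∈ W₁)
    (hinv₂ : ∀ A ∈ so n, ∀ T ∈ W₂, tensAct A T ∈ W₂) (h₁ : W₁ ≠ ⊥) (h₂ : W₂ ≠ ⊥) :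
    ∃ T ∈ W₁, T ∈ W₂ ∧ T ≠ 0 := by
  have hspec : ∀ W : Submodule ℝ (AmbTensor n s), (∀ T ∈ W, T ∈ ambientKilling n s) →
      ∀ f ∈ (W ⊓ constantField n s).map (valueAtZero n s), IsHomogeneous f s ∧ lap f = 0 := by
    rintro W hW _ ⟨T, hT, rfl⟩
    exact valueAtZero_spec (hW T hT.1)
  have hrot : ∀ W : Submodule ℝ (AmbTensor n s), (∀ T ∈ W, T ∈ ambientKilling n s) →
      (∀ A ∈ so n, ∀ T ∈ W, tensAct A T ∈ W) → ∀ a b,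
      ∀ f ∈ (W ⊓ constantField n s).map (valueAtZero n s),
        rot a b f ∈ (W ⊓ constantField n s).map (valueAtZero n s) := by
    rintro W hW hinv a b _ ⟨T, hT, rfl⟩
    exact ⟨tensAct (rotation a b) T, ⟨hinv _ (rotation_mem a b) T hT.1,
      rotation_mem_constantField (hW T hT.1) hT.2 a b⟩, valueAtZero_rotation (hW T hT.1) hT.2 a b⟩
  have hne : ∀ W : Submodule ℝ (AmbTensor n s), (∀ T ∈ W, T ∈ ambientKilling n s) →
      (∀ A ∈ so n, ∀ T ∈ W, tensAct A T ∈ W) → W ≠ ⊥ →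
      (W ⊓ constantField n s).map (valueAtZero n s) ≠ ⊥ := by
    intro W hW hinv h0 hbot
    obtain ⟨T, hT, hc, hT0⟩ := exists_constantField hW hinv h0
    refine hT0 (eq_zero_of_valueAtZero hn (hW T hT) hc ?_)
    have : valueAtZero n s T ∈ (W ⊓ constantField n s).map (valueAtZero n s) := ⟨T, ⟨hT, hc⟩, rfl⟩
    rw [hbot] at this
    exact (Submodule.mem_bot ℝ).1 this
  -- The values of the constant fields of each subspace form nonzero rotation-invariant spaces of
  -- harmonic polynomials, so these share an element; constant fields with the same value are equal.
  obtain ⟨_, ⟨T, hT, rfl⟩, ⟨U, hU, hTU⟩, hT0⟩ := exists_mem_of_rot_invariant (by simpa using hn)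
    (hspec W₁ hW₁) (hspec W₂ hW₂) (hrot W₁ hW₁ hinv₁) (hrot W₂ hW₂ hinv₂) (hne W₁ hW₁ hinv₁ h₁)
    (hne W₂ hW₂ hinv₂ h₂)
  have h := eq_zero_of_valueAtZero hn (sub_mem (hW₁ T hT.1) (hW₂ U hU.1)) (sub_mem hT.2 hU.2)
    (by rw [map_sub, hTU, sub_self])
  refine ⟨T, hT.1, ?_, fun e => hT0 (by rw [e, map_zero])⟩
  rw [sub_eq_zero.1 h]
  exact hU.1

/-- A proper nonzero submodule and its orthogonal complement would both be invariant and nonzero,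
hence would intersect, contrary to definiteness. -/
theorem isIrreducible_ambientKilling (hn : 3 ≤ n) :
    LieModule.IsIrreducible ℝ (so n) (ambientKilling n s) := by
  have hnt : Nontrivial (ambientKilling n s) := by
    obtain ⟨V, hV, hV0⟩ := exists_conformalKilling_ne_zero (s := s) hn
    obtain ⟨T, hT, hTV⟩ := exists_ambientToField_eq hn hV
    refine nontrivial_of_ne (⟨T, hT⟩ : ambientKilling n s) 0 fun e => hV0 ?_
    have : T = 0 := congrArg Subtype.val e
    rw [← hTV, this]
    exact map_zero (fieldMap n s)
  refine LieModule.IsIrreducible.mk fun N hN => ?_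
  by_contra htop
  let K : Submodule ℝ (AmbTensor n s) := (ambientKilling n s).toSubmodule
  let W₁ : Submodule ℝ (AmbTensor n s) := N.toSubmodule.map K.subtype
  have hmem : ∀ T ∈ W₁, ∃ h : T ∈ ambientKilling n s, (⟨T, h⟩ : ambientKilling n s) ∈ N := by
    rintro _ ⟨T, hT, rfl⟩
    exact ⟨T.2, hT⟩
  have hlt : W₁ < K := by
    refine lt_of_le_of_ne (fun T hT => (hmem T hT).1) fun e => htop ?_
    rw [eq_top_iff]
    intro T _
    have : T.1 ∈ W₁ := e ▸ T.2
    exact (hmem _ this).2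
  let W₂ : Submodule ℝ (AmbTensor n s) :=
    { carrier := {T | T ∈ ambientKilling n s ∧ ∀ U ∈ W₁, tensInner U T = 0}
      add_mem' := fun {T U} hT hU => ⟨add_mem hT.1 hU.1, fun S hS => by
        rw [map_add, hT.2 S hS, hU.2 S hS, add_zero]⟩
      zero_mem' := ⟨zero_mem _, fun S _ => map_zero _⟩
      smul_mem' := fun c T hT => ⟨(ambientKilling n s).smul_mem c hT.1, fun S hS => by
        rw [map_smul, hT.2 S hS, smul_zero]⟩ }
  have hinv₁ : ∀ A ∈ so n, ∀ T ∈ W₁, tensAct A T ∈ W₁ := by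
    intro A hA T hT
    obtain ⟨h1, h2⟩ := hmem T hT
    exact ⟨_, N.lie_mem (x := (⟨A, hA⟩ : so n)) h2, rfl⟩
  have hinv₂ : ∀ A ∈ so n, ∀ T ∈ W₂, tensAct A T ∈ W₂ := by
    intro A hA T hT
    refine ⟨(ambientKilling n s).lie_mem (x := (⟨A, hA⟩ : so n)) hT.1, fun U hU => ?_⟩
    have h := tensInner_tensAct A.transpose U T
    rw [Matrix.transpose_transpose] at h
    rw [← h]
    exact hT.2 _ (hinv₁ _ (transpose_mem_so hA) U hU)
  obtain ⟨T, hT, hT0, hTW⟩ := exists_ne_zero_orthogonal hlt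
  have hW₁ : W₁ ≠ ⊥ := fun e => hN <| by
    rw [LieSubmodule.eq_bot_iff]
    intro S hS
    have : S.1 ∈ W₁ := ⟨S, hS, rfl⟩
    rw [e] at this
    exact Subtype.ext ((Submodule.mem_bot ℝ).1 this)
  have hW₂ : W₂ ≠ ⊥ := fun e => hT0 <| by
    have : T ∈ W₂ := ⟨hT, hTW⟩
    rw [e] at this
    exact (Submodule.mem_bot ℝ).1 this
  obtain ⟨U, hU₁, hU₂, hU0⟩ := exists_mem_of_invariant hn (fun T hT => (hmem T hT).1)
    (W₂ := W₂) (fun T hT => And.left hT) hinv₁ hinv₂ hW₁ hW₂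
  exact hU0 (tensInner_self_eq_zero (hU₂.2 U hU₁))

end Irreducible

end ConformalKilling


open ConformalKilling

theorem proposition3 (n s : ℕ) (hn : 3 ≤ n) :
    (∃ e : ambientKilling n s ≃ₗ[ℝ] conformalKilling n s,
      (∀ T : ambientKilling n s, (e T : TensorField n s) = ambientToField (T : AmbTensor n s)) ∧
      ∀ (A : so n) (T : ambientKilling n s),
        (e ⁅A, T⁆ : TensorField n s) =
          lieDerivative (killingVector A) (e T : TensorField n s)) ∧
    FiniteDimensional ℝ (conformalKilling n s) ∧
    LieModule.IsIrreducible ℝ (so n) (ambientKilling n s) ∧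
    (ambientKilling n s : Submodule ℝ (AmbTensor n s)) = traceFreeTableau n s := by
  refine ⟨⟨fieldEquiv hn, fun T => rfl, fun A T => ambientToField_tensAct A T.2⟩, ?_,
    isIrreducible_ambientKilling hn, ambientKilling_eq_traceFreeTableau n s⟩
  have : FiniteDimensional ℝ (ambientKilling n s) :=
    inferInstanceAs (FiniteDimensional ℝ (ambientKilling n s).toSubmodule)
  exact (fieldEquiv hn).finiteDimensional
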